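/- **Theorem.** Call a norm $\|\cdot\|$ on $\mathbb{R}^2$ monotone if $\|(x,y)\|\ge\|(x',y')\|$ whenever $|x|\ge|x'|$ and $|y|\ge|y'|$, and let $\delta(a,b)=\|a-b\|$ be the metric induced by it. For a finite set $S\subset\mathbb{R}^2$ of colored points, a pair $\{a,b\}$ of points of $S$ is bichromatic if $a$ and $b$ have different colors, and it is $o$-anchored, for $o\in\mathbb{R}^2$, if the minimum axis-parallel bounding box of $\{a,b\}$ contains $o$. For an axis-parallel rectangle $R=[x^-,x^+]\times[y^-,y^+]$ let $\Pi_{S}(R,o)$ be the set of all $o$-anchored bichromatic pairs of points of $S$ that are contained in $R$. For $\varepsilon>0$, a $(1+\varepsilon)$-approximate anchored colored-range-closest-pair (CRCP) data structure on $S$ for rectangle queries answers each query $(R,o)$ by reporting a pair $\{a,b\}\in\Pi_S(R,o)$ with $\delta(a,b)\le(1+\varepsilon)\min_{\{a',b'\}\in\Pi_S(R,o)}\delta(a',b')$, or by reporting that $\Pi_S(R,o)$ is empty if it is. The model of computation is the real RAM: a memory of $s$ cells, each holding a real number and an integer word in $\{0,\dots,s\}$, with unit-cost arithmetic and comparisons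 on reals and on words, unit-cost evaluation of $\|\cdot\|$, and no rounding or conversion between reals and words. The space of a data structure is its number $s$ of cells (including all working memory for queries except for a constant number of registers); preprocessing time is not considered; after a query the memory has its original contents again. There are a query program and a constant $C$ (both independent of everything below) such that for every monotone norm on $\mathbb{R}^2$, every $\varepsilon>0$, and every set $S$ of $n\ge2$ colored points in $\mathbb{R}^2$ (with any coloring), there is a $(1+\varepsilon)$-approximate anchored CRCP data structure on $S$ for rectangle queries under $\delta$, queried by this program, which uses space at most $$C\,\hat\varepsilon^{-1}\,n\log^3 n$$ and has query time at most $$C\left(\log^3 n+\hat\varepsilon^{-1}\log^2 n+\hat\varepsilon^{-2}\right),\qquad\text{where }\hat\varepsilon=\min\{\varepsilon,1\}.$$ In particular, for $0<\varepsilon\le1$ the space is $O(\varepsilon^{-1}n\log^3 n)$ and the query time is $O(\log^3 n+\varepsilon^{-1}\log^2 n+\varepsilon^{-2})$. -/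

import Mathlib

namespace AnchoredCRCP

/-! ### Geometry: monotone norms, colored point pairs, approximate closest pairs -/

/-- A point of the plane, as the pair of its `x`- and `y`-coordinate. The order used on `Point` is
the coordinatewise one, so `Set.Icc u v` is the axis-parallel rectangle
`[u.1, v.1] × [u.2, v.2]`. -/
abbrev Point : Type := ℝ × ℝ

/-- `N` is a norm (a definite seminorm) on the plane which is monotone in the absolute values of
the coordinates. -/
def IsMonotoneNorm (N : Seminorm ℝ Point) : Prop :=
  (∀ p : Point, N p = 0 → p = 0) ∧
    ∀ p q : Point, |p.1| ≤ |q.1| → |p.2| ≤ |q.2| → N p ≤ N q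

/-- The length `|{a, b}| = N (a - b)` of a point pair in the metric induced by `N`. -/
def pairLength (N : Seminorm ℝ Point) : Sym2 Point → ℝ :=
  Sym2.lift ⟨fun a b => N (a - b), fun a b => map_sub_rev N a b⟩

/-- The minimum axis-parallel bounding box of a set of points: the intersection of all the
axis-parallel rectangles that contain the set. -/
def boundingBox (A : Set Point) : Set Point :=
  {p | ∀ u v : Point, A ⊆ Set.Icc u v → p ∈ Set.Icc u v}

/-- The set of bichromatic pairs of points of `S`, for the coloring `cl`. -/
def bich {κ : Type*} (S : Finset Point) (cl : Point → κ) : Set (Sym2 Point) :=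
  {φ | ∃ a ∈ S, ∃ b ∈ S, cl a ≠ cl b ∧ φ = s(a, b)}

/-- The set of `o`-anchored bichromatic pairs: those whose bounding box contains `o`. -/
def anchoredBich {κ : Type*} (S : Finset Point) (cl : Point → κ) (o : Point) :
    Set (Sym2 Point) :=
  {φ | φ ∈ bich S cl ∧ o ∈ boundingBox (φ : Set Point)}

/-- The pairs of a family which are contained in the range `X`. -/
def pairsIn (P : Set (Sym2 Point)) (X : Set Point) : Set (Sym2 Point) :=
  {φ | φ ∈ P ∧ (φ : Set Point) ⊆ X}

/-- `φ` is a closest pair of the family `P`. -/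
def IsClosestPair (N : Seminorm ℝ Point) (P : Set (Sym2 Point)) (φ : Sym2 Point) : Prop :=
  φ ∈ P ∧ ∀ ψ ∈ P, pairLength N φ ≤ pairLength N ψ

/-- `φ` is a `(1 + ε)`-approximate closest pair of the family `P`. -/
def IsApproxClosestPair (N : Seminorm ℝ Point) (ε : ℝ) (P : Set (Sym2 Point))
    (φ : Sym2 Point) : Prop :=
  φ ∈ P ∧ ∃ ψ, IsClosestPair N P ψ ∧ pairLength N φ ≤ (1 + ε) * pairLength N ψ

/-! ### The real RAM

The machine has a memory of `s` cells, each of which holds one integer word and one real number,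
and the finitely many word registers and real registers that the program mentions. Integer words
range over `0, …, s` (so that they have `O(log s)` bits and can hold addresses); word arithmetic
saturates at `s`. Reals support exact field operations and comparisons, and an evaluation of the
norm; there is no rounding and no conversion between reals and words. Every operation costs one
unit of time. -/

/-- A configuration of the machine: registers and memory. -/
structure State where
  wreg : ℕ → ℕ
  rreg : ℕ → ℝ
  wmem : ℕ → ℕ
  rmem : ℕ → ℝ

/-- Word-valued expressions. -/
inductive WordExpr : Type
  | const (c : ℕ)
  | reg (i : ℕ)
  | load (a : WordExpr)
  | add (a b : WordExpr)
  | sub (a b : WordExpr)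
  | mul (a b : WordExpr)
  | div (a b : WordExpr)

/-- Real-valued expressions; `normOf x y` is the norm of the vector `(x, y)`. -/
inductive RealExpr : Type
  | const (q : ℚ)
  | reg (i : ℕ)
  | load (a : WordExpr)
  | add (x y : RealExpr)
  | sub (x y : RealExpr)
  | mul (x y : RealExpr)
  | div (x y : RealExpr)
  | normOf (x y : RealExpr)

/-- Tests on which a program can branch. -/
inductive Test : Type
  | wordLe (a b : WordExpr)
  | realLe (x y : RealExpr)
  | not (t : Test)
  | and (t u : Test)

/-- Programs. -/
inductive Program : Type
  | skip
  | setWord (i : ℕ) (a : WordExpr)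
  | setReal (i : ℕ) (x : RealExpr)
  | storeWord (addr a : WordExpr)
  | storeReal (addr : WordExpr) (x : RealExpr)
  | seq (c d : Program)
  | ite (t : Test) (c d : Program)
  | loop (t : Test) (c : Program)

/-- Value of a word expression on a machine with `s` cells. -/
def WordExpr.eval (s : ℕ) (σ : State) : WordExpr → ℕ
  | .const c => min c s
  | .reg i => σ.wreg i
  | .load a => σ.wmem (a.eval s σ)
  | .add a b => min (a.eval s σ + b.eval s σ) s
  | .sub a b => a.eval s σ - b.eval s σ
  | .mul a b => min (a.eval s σ * b.eval s σ) s
  | .div a b => a.eval s σ / b.eval s σ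

/-- Time for the evaluation of a word expression: the number of its nodes. -/
def WordExpr.cost : WordExpr → ℕ
  | .const _ => 1
  | .reg _ => 1
  | .load a => a.cost + 1
  | .add a b => a.cost + b.cost + 1
  | .sub a b => a.cost + b.cost + 1
  | .mul a b => a.cost + b.cost + 1
  | .div a b => a.cost + b.cost + 1

/-- Value of a real expression on a machine with `s` cells and norm `N`. -/
noncomputable def RealExpr.eval (N : Seminorm ℝ Point) (s : ℕ) (σ : State) : RealExpr → ℝ
  | .const q => (q : ℝ)
  | .reg i => σ.rreg i
  | .load a => σ.rmem (a.eval s σ)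
  | .add x y => x.eval N s σ + y.eval N s σ
  | .sub x y => x.eval N s σ - y.eval N s σ
  | .mul x y => x.eval N s σ * y.eval N s σ
  | .div x y => x.eval N s σ / y.eval N s σ
  | .normOf x y => N (x.eval N s σ, y.eval N s σ)

/-- Time for the evaluation of a real expression: the number of its nodes. -/
def RealExpr.cost : RealExpr → ℕ
  | .const _ => 1
  | .reg _ => 1
  | .load a => a.cost + 1
  | .add x y => x.cost + y.cost + 1
  | .sub x y => x.cost + y.cost + 1
  | .mul x y => x.cost + y.cost + 1
  | .div x y => x.cost + y.cost + 1
  | .normOf x y => x.cost + y.cost + 1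

/-- Truth of a test. -/
def Test.Holds (N : Seminorm ℝ Point) (s : ℕ) (σ : State) : Test → Prop
  | .wordLe a b => a.eval s σ ≤ b.eval s σ
  | .realLe x y => x.eval N s σ ≤ y.eval N s σ
  | .not t => ¬ t.Holds N s σ
  | .and t u => t.Holds N s σ ∧ u.Holds N s σ

/-- Time for the evaluation of a test. -/
def Test.cost : Test → ℕ
  | .wordLe a b => a.cost + b.cost + 1
  | .realLe x y => x.cost + y.cost + 1
  | .not t => t.cost + 1
  | .and t u => t.cost + u.cost + 1

/-- `Exec N s c σ τ t`: on a machine with `s` cells and norm `N`, the program `c` started in `σ`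
halts in `τ` after `t` units of time. Only the cells `0, …, s - 1` can be written: a store to
another address has no effect. -/
inductive Exec (N : Seminorm ℝ Point) (s : ℕ) : Program → State → State → ℕ → Prop
  | skip (σ : State) : Exec N s .skip σ σ 1
  | setWord (i : ℕ) (a : WordExpr) (σ : State) :
      Exec N s (.setWord i a) σ
        { σ with wreg := Function.update σ.wreg i (a.eval s σ) } (a.cost + 1)
  | setReal (i : ℕ) (x : RealExpr) (σ : State) :
      Exec N s (.setReal i x) σ
        { σ with rreg := Function.update σ.rreg i (x.eval N s σ) } (x.cost + 1)
  | storeWord (addr a : WordExpr) (σ : State) :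
      Exec N s (.storeWord addr a) σ
        { σ with wmem := if addr.eval s σ < s then
            Function.update σ.wmem (addr.eval s σ) (a.eval s σ) else σ.wmem }
        (addr.cost + a.cost + 1)
  | storeReal (addr : WordExpr) (x : RealExpr) (σ : State) :
      Exec N s (.storeReal addr x) σ
        { σ with rmem := if addr.eval s σ < s then
            Function.update σ.rmem (addr.eval s σ) (x.eval N s σ) else σ.rmem }
        (addr.cost + x.cost + 1)
  | seq {c d : Program} {σ τ υ : State} {t u : ℕ} :
      Exec N s c σ τ t → Exec N s d τ υ u → Exec N s (.seq c d) σ υ (t + u)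
  | iteTrue {b : Test} {c d : Program} {σ τ : State} {t : ℕ} :
      b.Holds N s σ → Exec N s c σ τ t → Exec N s (.ite b c d) σ τ (b.cost + t + 1)
  | iteFalse {b : Test} {c d : Program} {σ τ : State} {t : ℕ} :
      ¬ b.Holds N s σ → Exec N s d σ τ t → Exec N s (.ite b c d) σ τ (b.cost + t + 1)
  | loopDone {b : Test} {c : Program} {σ : State} :
      ¬ b.Holds N s σ → Exec N s (.loop b c) σ σ (b.cost + 1)
  | loopStep {b : Test} {c : Program} {σ τ υ : State} {t u : ℕ} :
      b.Holds N s σ → Exec N s c σ τ t → Exec N s (.loop b c) τ υ u →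
        Exec N s (.loop b c) σ υ (b.cost + t + u + 1)

/-! ### Data structures and queries -/

/-- A data structure as it lies in memory: `size` cells, filled with words and reals. The
contents are set to `0` outside of these cells. -/
structure Storage where
  size : ℕ
  word : ℕ → ℕ
  real : ℕ → ℝ
  word_le : ∀ i, word i ≤ size
  word_out : ∀ i, size ≤ i → word i = 0
  real_out : ∀ i, size ≤ i → real i = 0

/-- The state in which a query with the rectangle `Set.Icc a b` and the anchor point `o` starts:
real registers `0, …, 5` hold the coordinates of `a`, `b`, `o`, and all the others are `0`. -/
noncomputable def queryState (D : Storage) (a b o : Point) : State where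
  wreg := fun _ => 0
  rreg := fun i => ([a.1, a.2, b.1, b.2, o.1, o.2] : List ℝ).getD i 0
  wmem := D.word
  rmem := D.real

/-- The answer that is reported in a final state: nothing if word register `0` holds `0`, and
otherwise the pair of the two points whose coordinates are in real registers `0, …, 3`. -/
noncomputable def reported (σ : State) : Option (Sym2 Point) :=
  if σ.wreg 0 = 0 then none
  else some s((σ.rreg 0, σ.rreg 1), (σ.rreg 2, σ.rreg 3))

/-- A report is correct for the family `P` if it is a `(1 + ε)`-approximate closest pair of `P`,
or if nothing is reported and `P` is empty. -/
def IsCorrectReport (N : Seminorm ℝ Point) (ε : ℝ) (P : Set (Sym2 Point)) :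
    Option (Sym2 Point) → Prop
  | none => P = ∅
  | some φ => IsApproxClosestPair N ε P φ

/-- With the query program `c`, the storage `D` is a `(1 + ε)`-approximate anchored CRCP data
structure built on the colored dataset `(S, cl)`, for rectangle queries under the metric induced
by `N`, with query time at most `T`: each query halts within time `T` with a correct report, and
leaves the memory as it was, so that any number of further queries can follow. -/
def IsApproxAnchoredCRCP {κ : Type*} (N : Seminorm ℝ Point) (ε : ℝ) (S : Finset Point)
    (cl : Point → κ) (c : Program) (D : Storage) (T : ℝ) : Prop :=
  ∀ a b o : Point, a ≤ b →
    ∃ (τ : State) (t : ℕ), Exec N D.size c (queryState D a b o) τ t ∧ (t : ℝ) ≤ T ∧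
      τ.wmem = D.word ∧ τ.rmem = D.real ∧
      IsCorrectReport N ε (pairsIn (anchoredBich S cl o) (Set.Icc a b)) (reported τ)

end AnchoredCRCP

/-! The bounding box of `{p, q}` contains `o` exactly when `p` and `q` lie in opposite closed
quadrants at `o`. There are two pairs of opposite quadrants, and `searchDiagonal` handles each of
them in the same way. One point (`v = 1`) or both (`v = -1`) are reflected so that both lie in upper
right quadrants, with corners `c` and `-c`. Then `p - q` becomes, up to a sign of its second
coordinate, a sum `a + b = (a - c) + (b + c)` of vectors with nonnegative coordinates. By
monotonicity of the norm, moving `a` or `b` down or to the left within its quadrant never makes the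
pair longer.

Scale. Let `r` be the least number for which some bichromatic pair has all four coordinate distances
from the corners at most `r`, each measured by the norm of the unit vector. Every bichromatic pair
has length at least `r`, because each distance is at most the length of the pair. A pair that
attains `r` has length at most `4 * r` by the triangle inequality. The number `r` is one of the
distances of a point from its corner, so binary searches over the sorted coordinates find it
(`findScale_spec`). They only need a test for bichromatic pairs in two rectangles (`probe_spec`).

Candidates. Each quadrant is cut into `K` vertical columns that together have width `4 * r` in the
norm, enough for every pair of length at most `4 * r`. Each column supplies two candidates: a lowest
point, and a lowest point among those of another color than the first. For any point of the column
and any color other than its own, one of the two avoids that color, is not higher, and is at most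
one column width further right. Replacing `a`, then `b`, by such candidates keeps the pair
bichromatic and adds at most `8 * r / K ≤ ε * r` to its length, that is, at most `ε` times the
length (`Candidates.approx`). It suffices to compare all pairs of candidates.

Lowest points. A lowest point in a rectangle whose color differs from a given one is found in a
range tree. Its nodes are sorted by height, and each record points to the next record of another
color in its node. Hence a binary search and one jump settle a node, and a rectangle costs `O(log²
n)` (`lowest_spec`).

Cost. With `E = max 1 ε⁻¹` and `K = ⌈8 * E⌉`, the scale costs `O(log n)` tests of cost `O(log² n)`,
the candidates `O(K)` searches of cost `O(log² n)`, and the comparison `O(K²)`. Four range trees,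
one for each reflection, and `4 * K` working cells are stored. The working cells hold zeros between
queries, so clearing them restores the memory. -/

namespace AnchoredCRCP

/-! ### A program logic for the machine -/

namespace State

/-- Assignment to a word register. -/
def setW (σ : State) (i v : ℕ) : State := { σ with wreg := Function.update σ.wreg i v }

/-- Assignment to a real register. -/
def setR (σ : State) (i : ℕ) (v : ℝ) : State := { σ with rreg := Function.update σ.rreg i v }

/-- Assignment to the word of a memory cell. -/
def setM (σ : State) (p v : ℕ) : State := { σ with wmem := Function.update σ.wmem p v }

variable (σ : State) (i j v : ℕ) (x : ℝ)

@[simp] lemma setW_wreg : (σ.setW i v).wreg j = if j = i then v else σ.wreg j := by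
  simp [setW, Function.update_apply]
@[simp] lemma setW_rreg : (σ.setW i v).rreg = σ.rreg := rfl
@[simp] lemma setW_wmem : (σ.setW i v).wmem = σ.wmem := rfl
@[simp] lemma setW_rmem : (σ.setW i v).rmem = σ.rmem := rfl
@[simp] lemma setR_rreg : (σ.setR i x).rreg j = if j = i then x else σ.rreg j := by
  simp [setR, Function.update_apply]
@[simp] lemma setR_wreg : (σ.setR i x).wreg = σ.wreg := rfl
@[simp] lemma setR_wmem : (σ.setR i x).wmem = σ.wmem := rfl
@[simp] lemma setR_rmem : (σ.setR i x).rmem = σ.rmem := rfl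
@[simp] lemma setM_wmem : (σ.setM i v).wmem j = if j = i then v else σ.wmem j := by
  simp [setM, Function.update_apply]
@[simp] lemma setM_wreg : (σ.setM i v).wreg = σ.wreg := rfl
@[simp] lemma setM_rreg : (σ.setM i v).rreg = σ.rreg := rfl
@[simp] lemma setM_rmem : (σ.setM i v).rmem = σ.rmem := rfl

end State

attribute [simp] WordExpr.eval RealExpr.eval Test.Holds WordExpr.cost RealExpr.cost Test.cost

/-- Total correctness: started in `σ`, the program `c` halts in a state and after a time that
satisfy `Q`. -/
def WP (N : Seminorm ℝ Point) (s : ℕ) (c : Program) (Q : State → ℕ → Prop) (σ : State) : Prop :=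
  ∃ τ t, Exec N s c σ τ t ∧ Q τ t

section rules

variable {N : Seminorm ℝ Point} {s : ℕ} {c d : Program} {Q Q' : State → ℕ → Prop} {σ : State}

lemma WP.mono (h : WP N s c Q σ) (hQ : ∀ τ t, Q τ t → Q' τ t) : WP N s c Q' σ := by
  obtain ⟨τ, t, he, hq⟩ := h
  exact ⟨τ, t, he, hQ _ _ hq⟩

lemma WP.skip (h : Q σ 1) : WP N s .skip Q σ := ⟨_, _, .skip σ, h⟩

lemma WP.setWord {i : ℕ} {a : WordExpr} (h : Q (σ.setW i (a.eval s σ)) (a.cost + 1)) :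
    WP N s (.setWord i a) Q σ := ⟨_, _, .setWord i a σ, h⟩

lemma WP.setReal {i : ℕ} {x : RealExpr} (h : Q (σ.setR i (x.eval N s σ)) (x.cost + 1)) :
    WP N s (.setReal i x) Q σ := ⟨_, _, .setReal i x σ, h⟩

lemma WP.setWord' {i : ℕ} {a : WordExpr} (v : ℕ) (hv : a.eval s σ = v)
    (h : Q (σ.setW i v) (a.cost + 1)) : WP N s (.setWord i a) Q σ := by
  subst hv; exact WP.setWord h

lemma WP.setReal' {i : ℕ} {x : RealExpr} (v : ℝ) (hv : x.eval N s σ = v)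
    (h : Q (σ.setR i v) (x.cost + 1)) : WP N s (.setReal i x) Q σ := by
  subst hv; exact WP.setReal h

lemma WP.storeWord {p a : WordExpr} (q v : ℕ) (hq : p.eval s σ = q) (hv : a.eval s σ = v)
    (hs : q < s) (h : Q (σ.setM q v) (p.cost + a.cost + 1)) :
    WP N s (.storeWord p a) Q σ := by
  subst hq hv
  refine ⟨_, _, .storeWord p a σ, ?_⟩
  rw [if_pos hs]
  exact h

lemma WP.seq (h : WP N s c (fun τ t => WP N s d (fun υ u => Q υ (t + u)) τ) σ) :
    WP N s (.seq c d) Q σ := by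
  obtain ⟨τ, t, he, υ, u, he', hq⟩ := h
  exact ⟨υ, t + u, .seq he he', hq⟩

lemma WP.ite {b : Test} (h₁ : b.Holds N s σ → WP N s c (fun τ t => Q τ (b.cost + t + 1)) σ)
    (h₂ : ¬ b.Holds N s σ → WP N s d (fun τ t => Q τ (b.cost + t + 1)) σ) :
    WP N s (.ite b c d) Q σ := by
  by_cases hb : b.Holds N s σ
  · obtain ⟨τ, t, he, hq⟩ := h₁ hb
    exact ⟨τ, _, .iteTrue hb he, hq⟩
  · obtain ⟨τ, t, he, hq⟩ := h₂ hb
    exact ⟨τ, _, .iteFalse hb he, hq⟩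

/-- Loops with an invariant `I` that bounds the number of the remaining iterations. -/
lemma WP.loop {b : Test} (I : ℕ → State → Prop) (B k : ℕ)
    (hstep : ∀ k σ, I k σ → b.Holds N s σ →
      WP N s c (fun τ t => t ≤ B ∧ ∃ k' < k, I k' τ) σ)
    (h : I k σ)
    (hQ : ∀ τ t k', I k' τ → ¬ b.Holds N s τ → t ≤ (B + b.cost + 1) * k + b.cost + 1 → Q τ t) :
    WP N s (.loop b c) Q σ := by
  suffices H : WP N s (.loop b c) (fun τ t => (∃ k', I k' τ) ∧ ¬ b.Holds N s τ ∧
      t ≤ (B + b.cost + 1) * k + b.cost + 1) σ from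
    H.mono fun τ t ⟨⟨k', h₁⟩, h₂, h₃⟩ => hQ τ t k' h₁ h₂ h₃
  clear hQ
  induction k using Nat.strong_induction_on generalizing σ with
  | _ k ih =>
    by_cases hb : b.Holds N s σ
    · obtain ⟨τ, t, he, ht, k', hk, hI⟩ := hstep k σ h hb
      obtain ⟨υ, u, he', h₁, h₂, h₃⟩ := ih k' hk hI
      refine ⟨υ, _, .loopStep hb he he', h₁, h₂, ?_⟩
      -- The strict decrease from `k` to `k'` pays for one iteration: the body, the test and one
      -- further unit.
      have : (B + b.cost + 1) * (k' + 1) ≤ (B + b.cost + 1) * k := Nat.mul_le_mul_left _ hk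
      rw [Nat.mul_add] at this
      omega
    · exact ⟨σ, _, .loopDone hb, ⟨k, h⟩, hb, by omega⟩

end rules

/-! ### Frame conditions that follow from the text of a program -/

/-- The program writes only registers with numbers `≥ k`. -/
def Program.Above (k : ℕ) : Program → Prop
  | .skip => True
  | .setWord i _ => k ≤ i
  | .setReal i _ => k ≤ i
  | .storeWord _ _ => True
  | .storeReal _ _ => True
  | .seq c d => c.Above k ∧ d.Above k
  | .ite _ c d => c.Above k ∧ d.Above k
  | .loop _ c => c.Above k

/-- The program does not write to the memory. -/
def Program.NoStore : Program → Prop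
  | .skip => True
  | .setWord _ _ => True
  | .setReal _ _ => True
  | .storeWord _ _ => False
  | .storeReal _ _ => False
  | .seq c d => c.NoStore ∧ d.NoStore
  | .ite _ c d => c.NoStore ∧ d.NoStore
  | .loop _ c => c.NoStore

attribute [simp] Program.Above Program.NoStore

/-- The registers below `k` have the same contents. -/
structure Frame (k : ℕ) (σ τ : State) : Prop where
  w : ∀ i < k, τ.wreg i = σ.wreg i
  r : ∀ i < k, τ.rreg i = σ.rreg i

/-- The memory has the same contents. -/
structure SameMem (σ τ : State) : Prop where
  w : τ.wmem = σ.wmem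
  r : τ.rmem = σ.rmem

lemma Program.Above.mono {k l : ℕ} (hkl : k ≤ l) {c : Program} (h : c.Above l) : c.Above k := by
  induction c with
  | setWord | setReal => exact hkl.trans h
  | skip | storeWord | storeReal => trivial
  | seq c d ihc ihd => exact ⟨ihc h.1, ihd h.2⟩
  | ite b c d ihc ihd => exact ⟨ihc h.1, ihd h.2⟩
  | loop b c ih => exact ih h

lemma Frame.refl (k : ℕ) (σ : State) : Frame k σ σ := ⟨fun _ _ => rfl, fun _ _ => rfl⟩

lemma Frame.trans {k : ℕ} {σ τ υ : State} (h : Frame k σ τ) (h' : Frame k τ υ) : Frame k σ υ :=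
  ⟨fun i hi => (h'.w i hi).trans (h.w i hi), fun i hi => (h'.r i hi).trans (h.r i hi)⟩

lemma Frame.mono {k l : ℕ} (hkl : k ≤ l) {σ τ : State} (h : Frame l σ τ) : Frame k σ τ :=
  ⟨fun i hi => h.w i (by omega), fun i hi => h.r i (by omega)⟩

lemma SameMem.refl (σ : State) : SameMem σ σ := ⟨rfl, rfl⟩

lemma SameMem.trans {σ τ υ : State} (h : SameMem σ τ) (h' : SameMem τ υ) : SameMem σ υ :=
  ⟨h'.w.trans h.w, h'.r.trans h.r⟩

/-- Registers are allocated in layers: a subprogram writes only registers with higher numbers than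
those its caller relies on. The syntactic condition therefore replaces a preservation clause in each
specification. -/
lemma Exec.frame {N : Seminorm ℝ Point} {s : ℕ} {c : Program} {σ τ : State} {t k : ℕ}
    (h : Exec N s c σ τ t) (hc : c.Above k) : Frame k σ τ := by
  induction h with
  | skip | storeWord | storeReal | loopDone => exact ⟨fun _ _ => rfl, fun _ _ => rfl⟩
  | setWord i a σ =>
    refine ⟨fun j hj => Function.update_of_ne ?_ _ _, fun _ _ => rfl⟩
    simp only [Program.Above] at hc; omega
  | setReal i a σ =>
    refine ⟨fun _ _ => rfl, fun j hj => Function.update_of_ne ?_ _ _⟩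
    simp only [Program.Above] at hc; omega
  | seq _ _ ih₁ ih₂ => exact (ih₁ hc.1).trans (ih₂ hc.2)
  | iteTrue _ _ ih => exact ih hc.1
  | iteFalse _ _ ih => exact ih hc.2
  | loopStep _ _ _ ih₁ ih₂ => exact (ih₁ hc).trans (ih₂ hc)

lemma Exec.sameMem {N : Seminorm ℝ Point} {s : ℕ} {c : Program} {σ τ : State} {t : ℕ}
    (h : Exec N s c σ τ t) (hc : c.NoStore) : SameMem σ τ := by
  induction h with
  | skip | setWord | setReal | loopDone => exact ⟨rfl, rfl⟩
  | storeWord | storeReal => exact hc.elim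
  | seq _ _ ih₁ ih₂ => exact (ih₁ hc.1).trans (ih₂ hc.2)
  | iteTrue _ _ ih => exact ih hc.1
  | iteFalse _ _ ih => exact ih hc.2
  | loopStep _ _ _ ih₁ ih₂ => exact (ih₁ hc).trans (ih₂ hc)

section rules

variable {N : Seminorm ℝ Point} {s : ℕ} {c d : Program} {Q Q' : State → ℕ → Prop} {σ : State}

lemma WP.frame {k : ℕ} (hc : c.Above k)
    (h : WP N s c (fun τ t => Frame k σ τ → Q τ t) σ) : WP N s c Q σ := by
  obtain ⟨τ, t, he, hq⟩ := h
  exact ⟨τ, t, he, hq (he.frame hc)⟩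

/-- Use of a specification of a program, together with what its text shows that it preserves. -/
lemma WP.call {k : ℕ} (hc : c.Above k) (hm : c.NoStore) (h : WP N s c Q σ)
    (hQ : ∀ τ t, Frame k σ τ → SameMem σ τ → Q τ t → Q' τ t) : WP N s c Q' σ := by
  obtain ⟨τ, t, he, hq⟩ := h
  exact ⟨τ, t, he, hQ _ _ (he.frame hc) (he.sameMem hm) hq⟩

/-- Loops, with what the text of the body shows that it preserves. -/
lemma WP.loopFrame {b : Test} {l : ℕ} (hc : c.Above l) (hm : c.NoStore)
    (I : ℕ → State → Prop) (B k : ℕ)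
    (hstep : ∀ k τ, Frame l σ τ → SameMem σ τ → I k τ → b.Holds N s τ →
      WP N s c (fun τ t => t ≤ B ∧ ∃ k' < k, I k' τ) τ)
    (h : I k σ)
    (hQ : ∀ τ t k', Frame l σ τ → SameMem σ τ → I k' τ → ¬ b.Holds N s τ →
      t ≤ (B + b.cost + 1) * k + b.cost + 1 → Q τ t) :
    WP N s (.loop b c) Q σ := by
  refine WP.loop (fun k τ => (Frame l σ τ ∧ SameMem σ τ) ∧ I k τ) B k ?_
    ⟨⟨.refl _ _, .refl _⟩, h⟩ (fun τ t k' h => hQ τ t k' h.1.1 h.1.2 h.2)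
  rintro k τ ⟨⟨hF, hM⟩, hI⟩ hb
  refine WP.call hc hm (hstep k τ hF hM hI hb) ?_
  rintro υ t hF' hM' ⟨ht, k', hk', hI'⟩
  exact ⟨ht, k', hk', ⟨hF.trans hF', hM.trans hM'⟩, hI'⟩

end rules

/-! ### Binary search -/

/-- The test `a < b`. -/
def Test.wlt (a b : WordExpr) : Test := .not (.wordLe b a)

@[simp] lemma Test.wlt_holds (N : Seminorm ℝ Point) (s : ℕ) (σ : State) (a b : WordExpr) :
    (Test.wlt a b).Holds N s σ ↔ a.eval s σ < b.eval s σ := by simp [Test.wlt]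

@[simp] lemma Test.wlt_cost (a b : WordExpr) :
    (Test.wlt a b).cost = b.cost + a.cost + 2 := by simp [Test.wlt]

/-- Binary search for the first number in the interval between the registers `lo` and `hi` for
which `body` makes the test `b` true. -/
def bsearch (lo hi mid : ℕ) (body : Program) (b : Test) : Program :=
  .loop (.wlt (.reg lo) (.reg hi))
    (.seq (.setWord mid (.div (.add (.reg lo) (.reg hi)) (.const 2)))
      (.seq body
        (.ite b (.setWord hi (.reg mid)) (.setWord lo (.add (.reg mid) (.const 1))))))

/-- The interval always contains the border between failures and successes of the monotone predicate
`P`, and its length is halved `j` times. The condition `2 * σ.wreg hi + 2 ≤ s` prevents saturation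
in the computation of the midpoint. The body is described only through the answer of the test `b`,
so that whole searches can be used as bodies. -/
lemma WP.bsearch {N : Seminorm ℝ Point} {s : ℕ} {Q : State → ℕ → Prop} {σ : State}
    {lo hi mid l : ℕ} {body : Program} {b : Test}
    (h₁ : lo < hi) (h₂ : hi < mid) (hl : l ≤ lo) (hc : body.Above (mid + 1)) (hm : body.NoStore)
    (P : ℕ → Prop) (B j : ℕ)
    (hle : σ.wreg lo ≤ σ.wreg hi) (hs : 2 * σ.wreg hi + 2 ≤ s)
    (hj : σ.wreg hi - σ.wreg lo < 2 ^ j)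
    (hmono : ∀ i i', σ.wreg lo ≤ i → i ≤ i' → i' < σ.wreg hi → P i → P i')
    (hbody : ∀ τ, Frame l σ τ → SameMem σ τ → σ.wreg lo ≤ τ.wreg mid → τ.wreg mid < σ.wreg hi →
      WP N s body (fun υ t => t ≤ B ∧ (b.Holds N s υ ↔ P (τ.wreg mid))) τ)
    (hQ : ∀ τ t, Frame l σ τ → SameMem σ τ → σ.wreg lo ≤ τ.wreg lo → τ.wreg lo ≤ σ.wreg hi →
      (∀ i, σ.wreg lo ≤ i → i < τ.wreg lo → ¬ P i) →
      (∀ i, τ.wreg lo ≤ i → i < σ.wreg hi → P i) →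
      t ≤ (B + b.cost + 20) * j + 5 → Q τ t) :
    WP N s (AnchoredCRCP.bsearch lo hi mid body b) Q σ := by
  have hc' : body.Above l := hc.mono (by omega)
  refine WP.loopFrame (l := l) ⟨show l ≤ mid by omega, hc', show l ≤ hi by omega, hl⟩
    ⟨trivial, hm, trivial, trivial⟩
    (fun k τ => σ.wreg lo ≤ τ.wreg lo ∧ τ.wreg lo ≤ τ.wreg hi ∧ τ.wreg hi ≤ σ.wreg hi ∧
      τ.wreg hi - τ.wreg lo < 2 ^ k ∧ (∀ i, σ.wreg lo ≤ i → i < τ.wreg lo → ¬ P i) ∧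
      (∀ i, τ.wreg hi ≤ i → i < σ.wreg hi → P i)) (B + b.cost + 12) j ?_
    ⟨le_rfl, hle, le_rfl, hj, fun i _ _ => by omega, fun i _ _ => by omega⟩ ?_
  · rintro k τ hF hM ⟨i₁, i₂, i₃, i₄, i₅, i₆⟩ hb
    simp only [Test.wlt_holds, WordExpr.eval] at hb
    -- A nonempty interval is not shorter than `2 ^ 0`, so there is still an iteration left in the
    -- budget.
    obtain ⟨k, rfl⟩ : ∃ k', k = k' + 1 := by
      rcases k with _ | k
      · simp at i₄; omega
      · exact ⟨k, rfl⟩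
    rw [pow_succ] at i₄
    refine WP.seq (WP.setWord' ((τ.wreg lo + τ.wreg hi) / 2) ?_ (WP.seq ?_))
    · simp only [WordExpr.eval]
      rw [min_eq_left (by omega), min_eq_left (by omega)]
    set m := (τ.wreg lo + τ.wreg hi) / 2 with hmdef
    have hF' : Frame l τ (τ.setW mid m) := by
      refine ⟨fun i hi => ?_, fun _ _ => rfl⟩
      simp [show i ≠ mid by omega]
    refine WP.call hc hm (hbody (τ.setW mid m) (hF.trans hF') ⟨hM.w, hM.r⟩
      (by simp; omega) (by simp; omega)) ?_
    rintro υ t hFυ hMυ ⟨ht, hP⟩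
    have e₁ : υ.wreg lo = τ.wreg lo := by
      rw [hFυ.w lo (by omega)]; simp [show lo ≠ mid by omega]
    have e₂ : υ.wreg hi = τ.wreg hi := by
      rw [hFυ.w hi (by omega)]; simp [show hi ≠ mid by omega]
    have e₃ : υ.wreg mid = m := by rw [hFυ.w mid (by omega)]; simp
    have hPm : P m ↔ b.Holds N s υ := by simpa using hP.symm
    have n₁ : lo ≠ hi := by omega
    refine WP.ite (fun hh => WP.setWord ?_) (fun hh => WP.setWord' (m + 1) ?_ ?_)
    · refine ⟨by simp; omega, k, by omega, ?_⟩
      simp only [WordExpr.eval, State.setW_wreg, if_neg n₁, if_true, e₁, e₃]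
      refine ⟨i₁, by omega, by omega, by omega, i₅, fun i hi₁ hi₂ => ?_⟩
      exact hmono m i (by omega) hi₁ hi₂ (hPm.2 hh)
    · simp only [WordExpr.eval, e₃]
      rw [min_eq_left (a := 1) (by omega), min_eq_left (by omega)]
    · refine ⟨by simp; omega, k, by omega, ?_⟩
      simp only [State.setW_wreg, if_neg n₁.symm, if_true, e₂]
      refine ⟨by omega, by omega, by omega, by omega, fun i hi₁ hi₂ hPi => hh (hPm.1 ?_), i₆⟩
      exact hmono i m hi₁ (by omega) (by omega) hPi
  · rintro τ t k hF hM ⟨i₁, i₂, i₃, i₄, i₅, i₆⟩ hb ht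
    simp only [Test.wlt_holds, WordExpr.eval] at hb
    have : τ.wreg lo = τ.wreg hi := by omega
    refine hQ τ t hF hM i₁ (by omega) i₅ (by rwa [this]) (ht.trans ?_)
    simp only [Test.wlt_cost, WordExpr.cost]
    have : (B + b.cost + 12 + (1 + 1 + 2) + 1) * j ≤ (B + b.cost + 20) * j :=
      Nat.mul_le_mul_right _ (by omega)
    omega

/-! ### Range trees in memory and lowest points in rectangles -/

/-- A point with a color, in the form `(x, y, color)`. -/
abbrev ColoredPoint : Type := ℝ × ℝ × ℕ

/-- The colored point recorded in the cells `p` and `p + 1`. -/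
def entry (wm : ℕ → ℕ) (rm : ℕ → ℝ) (p : ℕ) : ColoredPoint := (rm p, rm (p + 1), wm p)

/-- Address of the record number `i` on level `k` of a range tree of height `h`. -/
def addr (base h k i : ℕ) : ℕ := base + 2 * (k * 2 ^ h + i)

/-- The indices of the block number `j` on level `k` of a range tree of height `h`. -/
def block (h k j : ℕ) : Set ℕ := {i | i < 2 ^ h ∧ i / 2 ^ k = j}

/-- The memory holds, from the address `base` on, a range tree of height `h` for the set `T` of
colored points: on level `k` it is divided into blocks of `2 ^ k` records that are sorted by
`y`-coordinate; the block contains the same points on level `0`, where all records are sorted by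
`x`-coordinate. Each record points to the next one of its block with a different color. -/
structure RangeTree (wm : ℕ → ℕ) (rm : ℕ → ℝ) (base h : ℕ) (T : Set ColoredPoint) : Prop where
  one_lt_base : 1 < base
  points : (fun i => entry wm rm (addr base h 0 i)) '' {i | i < 2 ^ h} = T
  sorted_fst : ∀ i j, i ≤ j → j < 2 ^ h → rm (addr base h 0 i) ≤ rm (addr base h 0 j)
  sorted_snd : ∀ k ≤ h, ∀ i j, i ≤ j → j < 2 ^ h → i / 2 ^ k = j / 2 ^ k →
    rm (addr base h k i + 1) ≤ rm (addr base h k j + 1)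
  image_block : ∀ k ≤ h, ∀ j, (fun i => entry wm rm (addr base h k i)) '' block h k j =
    (fun i => entry wm rm (addr base h 0 i)) '' block h k j
  next : ∀ k ≤ h, ∀ i < 2 ^ h,
    (wm (addr base h k i + 1) = 0 ∧ ∀ j, i ≤ j → j < 2 ^ h → j / 2 ^ k = i / 2 ^ k →
      wm (addr base h k j) = wm (addr base h k i)) ∨
    ∃ j, i < j ∧ j < 2 ^ h ∧ j / 2 ^ k = i / 2 ^ k ∧ wm (addr base h k i + 1) = addr base h k j ∧
      wm (addr base h k j) ≠ wm (addr base h k i) ∧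
      ∀ l, i ≤ l → l < j → wm (addr base h k l) = wm (addr base h k i)

/-- `p` points to a lowest point of `J` whose color is not `c`; it is `0` if there is none. -/
def Lowest (wm : ℕ → ℕ) (rm : ℕ → ℝ) (J : Set ColoredPoint) (c p : ℕ) : Prop :=
  (p = 0 ∧ ∀ q ∈ J, q.2.2 = c) ∨
    (p ≠ 0 ∧ entry wm rm p ∈ J ∧ wm p ≠ c ∧ ∀ q ∈ J, q.2.2 ≠ c → rm (p + 1) ≤ q.2.1)

/-- The hypothesis `hle` says that `p` is at least as good as `p'`, where a null pointer is worse
than everything. It is the form in which the comparison made by `improveByBlock` is available, in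
both of its outcomes. -/
lemma Lowest.union_left {wm : ℕ → ℕ} {rm : ℕ → ℝ} {J J' : Set ColoredPoint} {c p p' : ℕ}
    (h : Lowest wm rm J c p) (h' : Lowest wm rm J' c p')
    (hle : p' ≠ 0 → p ≠ 0 ∧ rm (p + 1) ≤ rm (p' + 1)) : Lowest wm rm (J ∪ J') c p := by
  rcases h' with ⟨h0, h'⟩ | ⟨h0, h₁, h₂, h₃⟩
  · rcases h with ⟨g0, h⟩ | ⟨g0, g₁, g₂, g₃⟩
    · left
      refine ⟨g0, fun q hq => hq.elim (h q) (h' q)⟩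
    · right
      refine ⟨g0, Or.inl g₁, g₂, fun q hq hc => hq.elim (fun hq => g₃ q hq hc) fun hq => ?_⟩
      exact absurd (h' q hq) hc
  · obtain ⟨hp, hle⟩ := hle h0
    rcases h with ⟨g0, h⟩ | ⟨g0, g₁, g₂, g₃⟩
    · exact absurd g0 hp
    · right
      refine ⟨g0, Or.inl g₁, g₂, fun q hq hc => hq.elim (fun hq => g₃ q hq hc) fun hq => ?_⟩
      exact hle.trans (h₃ q hq hc)

/-- The points of `J` with `y`-coordinate at least `y`. -/
def atLeast (J : Set ColoredPoint) (y : ℝ) : Set ColoredPoint := {q | q ∈ J ∧ y ≤ q.2.1}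

/-- Query to a block: finds a lowest point of height at least `r30` and with a color other than
`w31` in the block with the number `w37` on the level that begins at the address `w35` and has
blocks of size `w36`. The pointer to it is put into `w42`. -/
def lowestInBlock : Program :=
  .seq (.setWord 39 (.mul (.reg 37) (.reg 36))) <|
  .seq (.setWord 38 (.add (.reg 39) (.reg 36))) <|
  .seq (.setWord 40 (.reg 38)) <|
  .seq (bsearch 39 40 41 .skip
    (.realLe (.reg 30) (.load (.add (.add (.reg 35) (.mul (.const 2) (.reg 41))) (.const 1))))) <|
  .ite (.wlt (.reg 39) (.reg 38))
    (.seq (.setWord 42 (.add (.reg 35) (.mul (.const 2) (.reg 39)))) <|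
      .ite (.and (.wordLe (.load (.reg 42)) (.reg 31)) (.wordLe (.reg 31) (.load (.reg 42))))
        (.setWord 42 (.load (.add (.reg 42) (.const 1)))) .skip)
    (.setWord 42 (.const 0))

lemma lowestInBlock_above : lowestInBlock.Above 38 := by
  simp [lowestInBlock, bsearch]

lemma lowestInBlock_noStore : lowestInBlock.NoStore := by
  simp [lowestInBlock, bsearch]

section

variable {N : Seminorm ℝ Point} {s base h : ℕ} {T : Set ColoredPoint} {σ : State}

lemma mem_block {k j i : ℕ} : i ∈ block h k j ↔
    i < 2 ^ h ∧ j * 2 ^ k ≤ i ∧ i < j * 2 ^ k + 2 ^ k := by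
  have hp : 0 < 2 ^ k := by positivity
  simp only [block, Set.mem_ofPred_eq, Nat.div_eq_iff hp]
  have : 1 ≤ 2 ^ k := hp
  omega

/-- In a block sorted by height, the records above the threshold form a final segment. If its first
record has the forbidden color, all records before the target of its `next` pointer have that color
too, so the target is the answer. One binary search and one jump suffice. -/
lemma lowestInBlock_spec (hT : RangeTree σ.wmem σ.rmem base h T)
    (hs : base + 2 * ((h + 1) * 2 ^ h) ≤ s) {k j : ℕ} (hk : k ≤ h)
    (hj : j * 2 ^ k + 2 ^ k ≤ 2 ^ h)
    (h35 : σ.wreg 35 = base + 2 * (k * 2 ^ h)) (h36 : σ.wreg 36 = 2 ^ k) (h37 : σ.wreg 37 = j) :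
    WP N s lowestInBlock (fun τ t =>
      Lowest σ.wmem σ.rmem (atLeast
        ((fun i => entry σ.wmem σ.rmem (addr base h 0 i)) '' block h k j) (σ.rreg 30))
        (σ.wreg 31) (τ.wreg 42) ∧ τ.wreg 42 + 1 < base + 2 * ((h + 1) * 2 ^ h) ∧
      t ≤ 40 * (h + 1) + 60) σ := by
  have hp : 1 ≤ 2 ^ k := Nat.one_le_two_pow
  have hb := hT.one_lt_base
  have hkh : k * 2 ^ h + 2 ^ h ≤ (h + 1) * 2 ^ h := by
    rw [← Nat.succ_mul]; exact Nat.mul_le_mul_right _ (by omega)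
  have hhh : 2 ^ h ≤ (h + 1) * 2 ^ h := Nat.le_mul_of_pos_left _ (by omega)
  -- Blocks are specified by their points on level `0`, where they are ranges of `x`-coordinates;
  -- the search uses their order on level `k`.
  rw [← hT.image_block k hk j]
  refine WP.seq (WP.setWord' (j * 2 ^ k) ?_ (WP.seq (WP.setWord' (j * 2 ^ k + 2 ^ k) ?_
    (WP.seq (WP.setWord' (j * 2 ^ k + 2 ^ k) ?_ (WP.seq ?_))))))
  · simp [h36, h37]; omega
  · simp [h36]; omega
  · simp
  set σ₁ := ((σ.setW 39 (j * 2 ^ k)).setW 38 (j * 2 ^ k + 2 ^ k)).setW 40 (j * 2 ^ k + 2 ^ k)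
    with hσ₁
  have e39 : σ₁.wreg 39 = j * 2 ^ k := by simp [hσ₁]
  have e40 : σ₁.wreg 40 = j * 2 ^ k + 2 ^ k := by simp [hσ₁]
  have e38 : σ₁.wreg 38 = j * 2 ^ k + 2 ^ k := by simp [hσ₁]
  have e35 : σ₁.wreg 35 = base + 2 * (k * 2 ^ h) := by simp [hσ₁, h35]
  have e31 : σ₁.wreg 31 = σ.wreg 31 := by simp [hσ₁]
  have e32 : σ₁.rreg 30 = σ.rreg 30 := by simp [hσ₁]
  have em : σ₁.rmem = σ.rmem := by simp [hσ₁]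
  have ew : σ₁.wmem = σ.wmem := by simp [hσ₁]
  clear_value σ₁
  have hdiv : ∀ i, j * 2 ^ k ≤ i → i < j * 2 ^ k + 2 ^ k → i / 2 ^ k = j := fun i h₁ h₂ =>
    (mem_block.2 ⟨by omega, h₁, h₂⟩ : i ∈ block h k j).2
  refine WP.bsearch (l := 39) (by norm_num) (by norm_num) le_rfl trivial trivial
    (fun i => σ.rreg 30 ≤ σ.rmem (addr base h k i + 1)) 1 (k + 1) (by omega) (by omega)
    (by rw [e39, e40, pow_succ]; omega) ?_ ?_ ?_
  · intro i i' h₁ h₂ h₃ h₄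
    refine h₄.trans (hT.sorted_snd k hk i i' h₂ (by omega) ?_)
    rw [hdiv i (by omega) (by omega), hdiv i' (by omega) (by omega)]
  · intro τ hF hM h₁ h₂
    refine WP.skip ⟨le_rfl, ?_⟩
    have : min (min (τ.wreg 35 + min (min 2 s * τ.wreg 41) s) s + min 1 s) s =
        addr base h k (τ.wreg 41) + 1 := by
      rw [hF.w 35 (by norm_num), e35, min_eq_left (a := 2) (by omega),
        min_eq_left (a := 2 * _) (by omega), min_eq_left (a := 1) (by omega), addr]
      omega
    simp only [Test.Holds, RealExpr.eval, WordExpr.eval, this, hF.r 30 (by norm_num), hM.r, e32,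
      em]
  · intro τ t hF hM h₁ h₂ h₃ h₄ ht
    rw [e39] at h₁ h₃
    rw [e40] at h₂ h₄
    have f38 : τ.wreg 38 = j * 2 ^ k + 2 ^ k := by rw [hF.w 38 (by norm_num), e38]
    have f31 : τ.wreg 31 = σ.wreg 31 := by rw [hF.w 31 (by norm_num), e31]
    have f35 : τ.wreg 35 = base + 2 * (k * 2 ^ h) := by rw [hF.w 35 (by norm_num), e35]
    have fw : τ.wmem = σ.wmem := by rw [hM.w, ew]
    simp at ht
    have ht' : t ≤ 40 * (h + 1) + 5 := by omega
    set i₀ := τ.wreg 39 with hi₀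
    have hbelow : ∀ i ∈ block h k j, σ.rreg 30 ≤ σ.rmem (addr base h k i + 1) → i₀ ≤ i := by
      intro i hi hy
      obtain ⟨g₁, g₂, g₃⟩ := mem_block.1 hi
      by_contra hlt
      exact h₃ i g₂ (by omega) hy
    -- Three cases: the first record that is high enough has the forbidden color, it has another
    -- color, or there is no such record.
    refine WP.ite (fun hlt => WP.seq (WP.setWord' (addr base h k i₀) ?_ (WP.ite (fun hc =>
      WP.setWord' (σ.wmem (addr base h k i₀ + 1)) ?_ ?_) fun hc => WP.skip ?_)))
      (fun hge => WP.setWord ?_)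
    · simp only [WordExpr.eval, f35, ← hi₀, addr]
      simp only [Test.wlt_holds, WordExpr.eval, f38, ← hi₀] at hlt
      rw [min_eq_left (a := 2) (by omega), min_eq_left (a := 2 * _) (by omega)]
      omega
    · simp only [Test.wlt_holds, WordExpr.eval, f38, ← hi₀] at hlt
      simp only [WordExpr.eval, State.setW_wreg, if_true, State.setW_wmem, fw]
      rw [min_eq_left (a := 1) (by omega), min_eq_left]
      simp only [addr]; omega
    · simp only [Test.wlt_holds, WordExpr.eval, f38, ← hi₀] at hlt
      simp only [Test.Holds, WordExpr.eval, State.setW_wreg, if_true, State.setW_wmem, fw,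
        show (31 : ℕ) ≠ 42 by norm_num, if_false, f31] at hc
      have hc := le_antisymm hc.1 hc.2
      have hd₀ := hdiv i₀ h₁ hlt
      refine ⟨?_, ?_, by simp; omega⟩
      · simp only [State.setW_wreg, if_true]
        rcases hT.next k hk i₀ (by omega) with ⟨hn, hn'⟩ | ⟨i', n₁, n₂, n₃, n₄, n₅, n₆⟩
        · left
          refine ⟨hn, ?_⟩
          rintro _ ⟨⟨i, hi, rfl⟩, hy⟩
          exact (hn' i (hbelow i hi hy) hi.1 (by rw [hi.2, hd₀])).trans hc
        · right
          rw [n₄]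
          refine ⟨by simp only [addr]; omega, ⟨⟨i', ⟨n₂, n₃.trans hd₀⟩, rfl⟩, ?_⟩,
            fun hh => n₅ (hh.trans hc.symm), ?_⟩
          · have := mem_block.1 (show i' ∈ block h k j from ⟨n₂, n₃.trans hd₀⟩)
            exact h₄ i' n₁.le this.2.2
          · rintro _ ⟨⟨i, hi, rfl⟩, hy⟩ hic
            have hge := hbelow i hi hy
            refine hT.sorted_snd k hk i' i ?_ hi.1 (by rw [hi.2, n₃, hd₀])
            by_contra hlt'
            exact hic ((n₆ i hge (by omega)).trans hc)
      · simp only [State.setW_wreg, if_true]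
        rcases hT.next k hk i₀ (by omega) with ⟨hn, -⟩ | ⟨i', -, n₂, -, n₄, -⟩
        · rw [hn]; omega
        · rw [n₄, addr]; omega
    · simp only [Test.wlt_holds, WordExpr.eval, f38, ← hi₀] at hlt
      simp only [Test.Holds, WordExpr.eval, State.setW_wreg, if_true, State.setW_wmem, fw,
        show (31 : ℕ) ≠ 42 by norm_num, if_false, f31] at hc
      refine ⟨?_, by simp [addr]; omega, by simp; omega⟩
      simp only [State.setW_wreg, if_true]
      have hd₀ := hdiv i₀ h₁ hlt
      right
      refine ⟨by simp only [addr]; omega, ⟨⟨i₀, ⟨by omega, hd₀⟩, rfl⟩, ?_⟩, by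
        contrapose! hc; omega, ?_⟩
      · exact h₄ i₀ le_rfl hlt
      · rintro _ ⟨⟨i, hi, rfl⟩, hy⟩ -
        exact hT.sorted_snd k hk i₀ i (hbelow i hi hy) hi.1 (by rw [hi.2, hd₀])
    · simp only [Test.wlt_holds, WordExpr.eval, f38, ← hi₀] at hge
      refine ⟨Or.inl ⟨by simp, ?_⟩, by simp; omega, by simp; omega⟩
      rintro _ ⟨⟨i, hi, rfl⟩, hy⟩
      have := hbelow i hi hy
      have := (mem_block.1 hi).2.2
      omega

/-- Improves the best pointer found so far, in `w32`, by a query to a block. -/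
def improveByBlock : Program :=
  .seq lowestInBlock <|
  .ite (.and (.not (.wordLe (.reg 42) (.const 0)))
      (.not (.and (.not (.wordLe (.reg 32) (.const 0)))
        (.realLe (.load (.add (.reg 32) (.const 1))) (.load (.add (.reg 42) (.const 1)))))))
    (.setWord 32 (.reg 42)) .skip

lemma improveByBlock_noStore : improveByBlock.NoStore := by
  simp [improveByBlock, lowestInBlock_noStore]

lemma improveByBlock_above : improveByBlock.Above 32 := by
  simp [improveByBlock, lowestInBlock_above.mono (show 32 ≤ 38 by norm_num)]

lemma atLeast_union (J J' : Set ColoredPoint) (y : ℝ) :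
    atLeast (J ∪ J') y = atLeast J y ∪ atLeast J' y := by
  ext q; simp [atLeast, or_and_right]

lemma improveByBlock_spec (hT : RangeTree σ.wmem σ.rmem base h T)
    (hs : base + 2 * ((h + 1) * 2 ^ h) ≤ s) {k j : ℕ} (hk : k ≤ h)
    (hj : j * 2 ^ k + 2 ^ k ≤ 2 ^ h)
    (h35 : σ.wreg 35 = base + 2 * (k * 2 ^ h)) (h36 : σ.wreg 36 = 2 ^ k) (h37 : σ.wreg 37 = j)
    {I : Set ℕ} (hI : Lowest σ.wmem σ.rmem (atLeast
        ((fun i => entry σ.wmem σ.rmem (addr base h 0 i)) '' I) (σ.rreg 30))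
        (σ.wreg 31) (σ.wreg 32)) (hp : σ.wreg 32 + 1 < base + 2 * ((h + 1) * 2 ^ h)) :
    WP N s improveByBlock (fun τ t =>
      Lowest σ.wmem σ.rmem (atLeast
        ((fun i => entry σ.wmem σ.rmem (addr base h 0 i)) '' (I ∪ block h k j)) (σ.rreg 30))
        (σ.wreg 31) (τ.wreg 32) ∧ τ.wreg 32 + 1 < base + 2 * ((h + 1) * 2 ^ h) ∧
      (∀ i < 38, i ≠ 32 → τ.wreg i = σ.wreg i) ∧ (∀ i < 38, τ.rreg i = σ.rreg i) ∧
      SameMem σ τ ∧ t ≤ 40 * (h + 1) + 90) σ := by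
  refine WP.seq (WP.call lowestInBlock_above lowestInBlock_noStore
    (lowestInBlock_spec hT hs hk hj h35 h36 h37) ?_)
  rintro τ t hF hM ⟨hlow, hb, ht⟩
  rw [Set.image_union, atLeast_union]
  have e₁ : min (σ.wreg 32 + min 1 s) s = σ.wreg 32 + 1 := by
    rw [min_eq_left (a := 1) (by omega), min_eq_left (by omega)]
  have e₂ : min (τ.wreg 42 + min 1 s) s = τ.wreg 42 + 1 := by
    rw [min_eq_left (a := 1) (by omega), min_eq_left (by omega)]
  have e₃ := hF.w 32 (by norm_num)
  refine WP.ite (fun hc => WP.setWord ?_) (fun hc => WP.skip ?_)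
  · simp only [Test.Holds, WordExpr.eval, RealExpr.eval, e₁, e₂, e₃, hM.r, not_and, not_le,
      Nat.zero_le, inf_of_le_left] at hc
    refine ⟨?_, by simpa using hb, fun i hi hi' => by simp [hi', hF.w i hi],
      fun i hi => by simp [hF.r i hi], ⟨hM.w, hM.r⟩, by simp; omega⟩
    rw [Set.union_comm]
    simp only [State.setW_wreg, if_true, WordExpr.eval]
    exact hlow.union_left hI fun h0 => ⟨hc.1.ne', (hc.2 (by omega)).le⟩
  · simp only [Test.Holds, WordExpr.eval, RealExpr.eval, e₁, e₂, e₃, hM.r, not_and, not_le,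
      Nat.zero_le, inf_of_le_left, not_forall, not_lt] at hc
    refine ⟨?_, by rw [e₃]; exact hp, fun i hi hi' => hF.w i hi, fun i hi => hF.r i hi,
      ⟨hM.w, hM.r⟩, by simp; omega⟩
    rw [e₃]
    refine hI.union_left hlow fun h0 => ?_
    obtain ⟨h₁, h₂⟩ := hc (by omega)
    exact ⟨by omega, h₂⟩

end

/-! ### Lowest points in rectangles: the ascent through a range tree -/

section

variable {N : Seminorm ℝ Point} {s base h : ℕ} {T : Set ColoredPoint} {σ : State}

/-- If the node `w33` is a right child, take its block into account and go to the next node. -/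
def stepLeft : Program :=
  .ite (.wordLe (.const 1) (.sub (.reg 33) (.mul (.const 2) (.div (.reg 33) (.const 2)))))
    (.seq (.setWord 37 (.reg 33)) <| .seq improveByBlock <|
      .setWord 33 (.add (.reg 33) (.const 1))) .skip

/-- If the node before `w34` is a left child, take its block into account and go back to it. -/
def stepRight : Program :=
  .ite (.wordLe (.const 1) (.sub (.reg 34) (.mul (.const 2) (.div (.reg 34) (.const 2)))))
    (.seq (.setWord 34 (.sub (.reg 34) (.const 1))) <|
      .seq (.setWord 37 (.reg 34)) improveByBlock) .skip

/-- The way up through a range tree: the blocks from `w33` to `w34 - 1` on the current level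
cover what remains to be searched. -/
def climb : Program :=
  .loop (.wlt (.reg 33) (.reg 34)) <|
    .seq stepLeft <| .seq stepRight <|
    .seq (.setWord 33 (.div (.reg 33) (.const 2))) <|
    .seq (.setWord 34 (.div (.reg 34) (.const 2))) <|
    .seq (.setWord 35 (.add (.reg 35) (.mul (.const 2) (.load (.const 1))))) <|
    .setWord 36 (.mul (.const 2) (.reg 36))

lemma climb_above : climb.Above 32 := by
  simp [climb, stepLeft, stepRight, improveByBlock_above]

lemma climb_noStore : climb.NoStore := by
  simp [climb, stepLeft, stepRight, improveByBlock_noStore]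

/-- The indices between `L` and `R` outside of the blocks `l, …, r - 1` on level `k`. -/
def outside (L R k l r : ℕ) : Set ℕ := {i | L ≤ i ∧ i < R ∧ ¬ (l * 2 ^ k ≤ i ∧ i < r * 2 ^ k)}

/-- The invariant of `climb`. -/
structure ClimbInv (σ : State) (base h L R k l r : ℕ) (τ : State) : Prop where
  left : τ.wreg 33 = l
  right : τ.wreg 34 = r
  level : τ.wreg 35 = base + 2 * (k * 2 ^ h)
  width : τ.wreg 36 = 2 ^ k
  le_left : L ≤ l * 2 ^ k
  right_le : r * 2 ^ k ≤ R
  lowest : Lowest σ.wmem σ.rmem (atLeast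
    ((fun i => entry σ.wmem σ.rmem (addr base h 0 i)) '' outside L R k l r) (σ.rreg 30))
    (σ.wreg 31) (τ.wreg 32)
  bound : τ.wreg 32 + 1 < base + 2 * ((h + 1) * 2 ^ h)
  frame : Frame 32 σ τ
  mem : SameMem σ τ

lemma odd_test {s : ℕ} (hs : 2 ≤ s) {τ : State} {i x : ℕ} (hi : τ.wreg i = x) (hx : x ≤ s) :
    (Test.wordLe (.const 1) (.sub (.reg i) (.mul (.const 2) (.div (.reg i) (.const 2))))).Holds
      N s τ ↔ x % 2 = 1 := by
  simp only [Test.Holds, WordExpr.eval, hi]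
  rw [min_eq_left (a := 1) (by omega), min_eq_left (a := 2) (by omega), min_eq_left (by omega)]
  omega

/-- An odd left end is a right child, whose parent block would stick out of the range. Its block is
therefore searched by itself, which makes the left end even; `stepRight` does the same at the other
end. -/
lemma stepLeft_spec (hT : RangeTree σ.wmem σ.rmem base h T)
    (hs : base + 2 * ((h + 1) * 2 ^ h) ≤ s) {L R k l r : ℕ} (hk : k ≤ h) (hR : R ≤ 2 ^ h)
    {τ : State} (hI : ClimbInv σ base h L R k l r τ) (hlr : l < r) :
    WP N s stepLeft (fun υ t => (∃ l', l' % 2 = 0 ∧ l' ≤ r ∧ ClimbInv σ base h L R k l' r υ) ∧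
      t ≤ 40 * (h + 1) + 120) τ := by
  have hp : 1 ≤ 2 ^ k := Nat.one_le_two_pow
  have hhh : 2 ^ h ≤ (h + 1) * 2 ^ h := Nat.le_mul_of_pos_left _ (by omega)
  have h₁ : (l + 1) * 2 ^ k ≤ r * 2 ^ k := Nat.mul_le_mul_right _ hlr
  have h₂ : l ≤ l * 2 ^ k := Nat.le_mul_of_pos_right _ hp
  have h₃ := hI.right_le
  have hb := hT.one_lt_base
  rw [Nat.add_one_mul] at h₁
  have hodd := odd_test (N := N) (s := s) (by omega) hI.left (by omega)
  refine WP.ite (fun hc => ?_) (fun hc => ?_)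
  · rw [hodd] at hc
    refine WP.seq (WP.setWord' l (by simp [hI.left]) (WP.seq ?_))
    have hlow := hI.lowest
    have hbd := hI.bound
    rw [← hI.mem.w, ← hI.mem.r, ← hI.frame.r 30 (by norm_num), ← hI.frame.w 31 (by norm_num)]
      at hlow
    rw [← hI.mem.w, ← hI.mem.r] at hT
    refine (improveByBlock_spec (σ := τ.setW 37 l) (j := l) hT hs hk (by omega)
      (by simp [hI.level]) (by simp [hI.width]) (by simp) hlow hbd).mono ?_
    rintro υ t ⟨hl, hb', hw, hr, hm, ht⟩
    refine WP.setWord' (l + 1) ?_ ⟨⟨l + 1, by omega, hlr, ?_⟩, ?_⟩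
    · simp only [WordExpr.eval, hw 33 (by norm_num) (by norm_num), State.setW_wreg,
        show (33 : ℕ) ≠ 37 by norm_num, if_false, hI.left]
      rw [min_eq_left (a := 1) (by omega), min_eq_left (by omega)]
    · have hset : outside L R k l r ∪ block h k l = outside L R k (l + 1) r := by
        ext i
        have := hI.le_left
        rw [Set.mem_union, mem_block]
        simp only [outside, Set.mem_ofPred_eq, Nat.add_one_mul]
        omega
      refine ⟨by simp, ?_, ?_, ?_, ?_, hI.right_le, ?_, by simpa using hb', ?_, ?_⟩
      · simpa [hI.right] using hw 34 (by norm_num) (by norm_num)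
      · simpa [hI.level] using hw 35 (by norm_num) (by norm_num)
      · simpa [hI.width] using hw 36 (by norm_num) (by norm_num)
      · have := hI.le_left
        rw [Nat.add_one_mul]; omega
      · rw [← hI.mem.w, ← hI.mem.r, ← hI.frame.r 30 (by norm_num), ← hI.frame.w 31 (by norm_num),
          ← hset]
        simpa using hl
      · refine hI.frame.trans ⟨fun i hi => ?_, fun i hi => ?_⟩
        · simpa [show i ≠ 33 by omega, show i ≠ 37 by omega] using hw i (by omega) (by omega)
        · simpa using hr i (by omega)
      · exact hI.mem.trans ⟨by simpa using hm.w, by simpa using hm.r⟩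
    · simp; omega
  · rw [hodd] at hc
    exact WP.skip ⟨⟨l, by omega, hlr.le, hI⟩, by simp⟩

lemma stepRight_spec (hT : RangeTree σ.wmem σ.rmem base h T)
    (hs : base + 2 * ((h + 1) * 2 ^ h) ≤ s) {L R k l r : ℕ} (hk : k ≤ h) (hR : R ≤ 2 ^ h)
    {τ : State} (hI : ClimbInv σ base h L R k l r τ) (hl : l % 2 = 0) (hlr : l ≤ r) :
    WP N s stepRight (fun υ t => (∃ r', r' % 2 = 0 ∧ ClimbInv σ base h L R k l r' υ) ∧
      t ≤ 40 * (h + 1) + 120) τ := by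
  have hp : 1 ≤ 2 ^ k := Nat.one_le_two_pow
  have hhh : 2 ^ h ≤ (h + 1) * 2 ^ h := Nat.le_mul_of_pos_left _ (by omega)
  have h₂ : r ≤ r * 2 ^ k := Nat.le_mul_of_pos_right _ hp
  have h₃ := hI.right_le
  have hb := hT.one_lt_base
  have hodd := odd_test (N := N) (s := s) (by omega) hI.right (by omega)
  refine WP.ite (fun hc => ?_) (fun hc => ?_)
  · rw [hodd] at hc
    obtain ⟨r, rfl⟩ : ∃ r', r = r' + 1 := ⟨r - 1, by omega⟩
    have h₁ : l * 2 ^ k ≤ r * 2 ^ k := Nat.mul_le_mul_right _ (by omega)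
    rw [Nat.add_one_mul] at h₃
    refine WP.seq (WP.setWord' r ?_ (WP.seq (WP.setWord' r (by simp) ?_)))
    · simp only [WordExpr.eval, hI.right]
      rw [min_eq_left (a := 1) (by omega)]; omega
    have hlow := hI.lowest
    have hbd := hI.bound
    rw [← hI.mem.w, ← hI.mem.r, ← hI.frame.r 30 (by norm_num), ← hI.frame.w 31 (by norm_num)]
      at hlow
    rw [← hI.mem.w, ← hI.mem.r] at hT
    refine (improveByBlock_spec (σ := (τ.setW 34 r).setW 37 r) (j := r) hT hs hk (by omega)
      (by simp [hI.level]) (by simp [hI.width]) (by simp) hlow hbd).mono ?_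
    rintro υ t ⟨hl, hb', hw, hr, hm, ht⟩
    refine ⟨⟨r, by omega, ?_⟩, ?_⟩
    · have hset : outside L R k l (r + 1) ∪ block h k r = outside L R k l r := by
        ext i
        have := hI.le_left
        rw [Set.mem_union, mem_block]
        simp only [outside, Set.mem_ofPred_eq, Nat.add_one_mul]
        omega
      refine ⟨?_, ?_, ?_, ?_, hI.le_left, by omega, ?_, by simpa using hb', ?_, ?_⟩
      · simpa [hI.left] using hw 33 (by norm_num) (by norm_num)
      · simpa using hw 34 (by norm_num) (by norm_num)
      · simpa [hI.level] using hw 35 (by norm_num) (by norm_num)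
      · simpa [hI.width] using hw 36 (by norm_num) (by norm_num)
      · rw [← hI.mem.w, ← hI.mem.r, ← hI.frame.r 30 (by norm_num), ← hI.frame.w 31 (by norm_num),
          ← hset]
        simpa using hl
      · refine hI.frame.trans ⟨fun i hi => ?_, fun i hi => ?_⟩
        · simpa [show i ≠ 34 by omega, show i ≠ 37 by omega] using hw i (by omega) (by omega)
        · simpa using hr i (by omega)
      · exact hI.mem.trans ⟨by simpa using hm.w, by simpa using hm.r⟩
    · simp; omega
  · rw [hodd] at hc
    exact WP.skip ⟨⟨r, by omega, hI⟩, by simp⟩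

/-- The bottom-up decomposition of an index range into blocks: at most two blocks are searched on
each level, and what remains between the two even ends is again a union of blocks of the next level.
There are `h + 1` levels and each block costs `O(h + 1)`. -/
lemma climb_spec (hT : RangeTree σ.wmem σ.rmem base h T)
    (hs : base + 2 * ((h + 1) * 2 ^ h) ≤ s) (hm : σ.wmem 1 = 2 ^ h) {L R : ℕ} (hR : R ≤ 2 ^ h)
    (hI : ClimbInv σ base h L R 0 L R σ) :
    WP N s climb (fun τ t => Lowest σ.wmem σ.rmem (atLeast
      ((fun i => entry σ.wmem σ.rmem (addr base h 0 i)) '' {i | L ≤ i ∧ i < R}) (σ.rreg 30))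
        (σ.wreg 31) (τ.wreg 32) ∧ τ.wreg 32 + 1 < base + 2 * ((h + 1) * 2 ^ h) ∧
      t ≤ (80 * (h + 1) + 280) * (h + 1) + 10) σ := by
  have hb := hT.one_lt_base
  have hhh : 2 ^ h ≤ (h + 1) * 2 ^ h := Nat.le_mul_of_pos_left _ (by omega)
  refine WP.loop (fun j τ => ∃ k l r, j + k = h + 1 ∧ ClimbInv σ base h L R k l r τ)
    (80 * (h + 1) + 270) (h + 1) ?_ ⟨0, L, R, by omega, hI⟩ ?_
  · rintro j τ ⟨k, l, r, hj, hI⟩ hlt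
    simp only [Test.wlt_holds, WordExpr.eval, hI.left, hI.right] at hlt
    -- A block larger than the whole tree does not fit below `R ≤ 2 ^ h`, so the ascent stops after
    -- the root.
    have hk : k ≤ h := by
      by_contra hk
      have h₁ : 2 ^ (h + 1) ≤ 2 ^ k := Nat.pow_le_pow_right (by norm_num) (by omega)
      have h₂ : 1 * 2 ^ k ≤ r * 2 ^ k := Nat.mul_le_mul_right _ (by omega)
      have := hI.right_le
      have h₃ : 1 ≤ 2 ^ h := Nat.one_le_two_pow
      rw [pow_succ] at h₁
      omega
    refine WP.seq ((stepLeft_spec hT hs hk hR hI hlt).mono ?_)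
    rintro υ t ⟨⟨l', hl', hlr', hI'⟩, ht⟩
    refine WP.seq ((stepRight_spec hT hs hk hR hI' hl' hlr').mono ?_)
    rintro ω u ⟨⟨r', hr', hI''⟩, hu⟩
    have e₁ : min 2 s = 2 := min_eq_left (by omega)
    have hkh : (k + 1) * 2 ^ h ≤ (h + 1) * 2 ^ h := Nat.mul_le_mul_right _ (by omega)
    have hpk : 2 ^ k ≤ 2 ^ h := Nat.pow_le_pow_right (by norm_num) hk
    have hp : 1 ≤ 2 ^ k := Nat.one_le_two_pow
    refine WP.seq (WP.setWord' (l' / 2) ?_ (WP.seq (WP.setWord' (r' / 2) ?_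
      (WP.seq (WP.setWord' (base + 2 * ((k + 1) * 2 ^ h)) ?_
        (WP.setWord' (2 ^ (k + 1)) ?_ ⟨?_, j - 1, by omega, k + 1, l' / 2, r' / 2, by omega,
          ?_⟩))))))
    · simp [hI''.left, e₁]
    · simp [hI''.right, e₁]
    · simp only [WordExpr.eval, State.setW_wreg, State.setW_wmem, hI''.mem.w, e₁, hI''.level,
        show (35 : ℕ) ≠ 34 by norm_num, show (35 : ℕ) ≠ 33 by norm_num, if_false]
      rw [min_eq_left (a := 1) (by omega), hm]
      have := Nat.add_one_mul k (2 ^ h)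
      rw [min_eq_left (a := 2 * _) (by omega), min_eq_left (by omega)]
      omega
    · simp only [WordExpr.eval, State.setW_wreg, e₁, hI''.width,
        show (36 : ℕ) ≠ 34 by norm_num, show (36 : ℕ) ≠ 33 by norm_num,
        show (36 : ℕ) ≠ 35 by norm_num, if_false]
      rw [min_eq_left (by omega), pow_succ]; omega
    · simp; omega
    · have el : l' / 2 * 2 ^ (k + 1) = l' * 2 ^ k := by
        obtain ⟨x, rfl⟩ : ∃ x, l' = 2 * x := ⟨l' / 2, by omega⟩
        rw [Nat.mul_div_cancel_left _ (by norm_num)]; ring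
      have er : r' / 2 * 2 ^ (k + 1) = r' * 2 ^ k := by
        obtain ⟨x, rfl⟩ : ∃ x, r' = 2 * x := ⟨r' / 2, by omega⟩
        rw [Nat.mul_div_cancel_left _ (by norm_num)]; ring
      refine ⟨by simp, by simp, by simp, by simp, ?_, ?_, ?_, by simpa using hI''.bound,
        hI''.frame.trans ⟨fun i hi => ?_, fun i hi => by simp⟩, hI''.mem.trans ⟨rfl, rfl⟩⟩
      · rw [el]; exact hI''.le_left
      · rw [er]; exact hI''.right_le
      · simpa [outside, el, er] using hI''.lowest
      · simp [show i ≠ 33 by omega, show i ≠ 34 by omega, show i ≠ 35 by omega,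
          show i ≠ 36 by omega]
  · rintro τ t - ⟨k, l, r, hj, hI⟩ hlt ht
    simp only [Test.wlt_holds, WordExpr.eval, hI.left, hI.right] at hlt
    have hset : outside L R k l r = {i | L ≤ i ∧ i < R} := by
      have : r * 2 ^ k ≤ l * 2 ^ k := Nat.mul_le_mul_right _ (by omega)
      ext i
      simp only [outside, Set.mem_ofPred_eq]
      omega
    refine ⟨hset ▸ hI.lowest, hI.bound, ht.trans ?_⟩
    simp only [Test.wlt_cost, WordExpr.cost]
    nlinarith

/-- The points of `J` in the rectangle `[x₁, x₂] × [y₁, y₂]`. -/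
def inBox (J : Set ColoredPoint) (x₁ x₂ y₁ y₂ : ℝ) : Set ColoredPoint :=
  {q | q ∈ J ∧ (x₁ ≤ q.1 ∧ q.1 ≤ x₂) ∧ y₁ ≤ q.2.1 ∧ q.2.1 ≤ y₂}

/-- Finds, in the range tree with the address `w30`, a lowest point with a color other than `w31`
in the rectangle `[r28, r29] × [r30, r31]`. The pointer to it is put into `w32`. -/
def lowest : Program :=
  .seq (.setWord 39 (.const 0)) <|
  .seq (.setWord 40 (.load (.const 1))) <|
  .seq (bsearch 39 40 41 .skip
    (.realLe (.reg 28) (.load (.add (.reg 30) (.mul (.const 2) (.reg 41)))))) <|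
  .seq (.setWord 33 (.reg 39)) <|
  .seq (.setWord 39 (.const 0)) <|
  .seq (.setWord 40 (.load (.const 1))) <|
  .seq (bsearch 39 40 41 .skip
    (.not (.realLe (.load (.add (.reg 30) (.mul (.const 2) (.reg 41)))) (.reg 29)))) <|
  .seq (.setWord 34 (.reg 39)) <|
  .seq (.setWord 35 (.reg 30)) <|
  .seq (.setWord 36 (.const 1)) <|
  .seq (.setWord 32 (.const 0)) <|
  .seq climb <|
  .ite (.wordLe (.reg 32) (.const 0)) .skip
    (.ite (.realLe (.load (.add (.reg 32) (.const 1))) (.reg 31)) .skip (.setWord 32 (.const 0)))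

lemma lowest_above : lowest.Above 32 := by
  simp [lowest, bsearch, climb_above]

lemma lowest_noStore : lowest.NoStore := by
  simp [lowest, bsearch, climb_noStore]

/-- Binary search by `x`-coordinate in a range tree. -/
lemma rank_spec (hT : RangeTree σ.wmem σ.rmem base h T)
    (hs : base + 2 * ((h + 1) * 2 ^ h) ≤ s) (h30 : σ.wreg 30 = base)
    (h39 : σ.wreg 39 = 0) (h40 : σ.wreg 40 = 2 ^ h) {b : Test} {P : ℝ → Prop}
    (hP : ∀ x y, x ≤ y → P x → P y) (hcost : b.cost ≤ 20)
    (hbP : ∀ τ, Frame 39 σ τ → SameMem σ τ →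
      min (τ.wreg 30 + min (min 2 s * τ.wreg 41) s) s = addr base h 0 (τ.wreg 41) →
      (b.Holds N s τ ↔ P (σ.rmem (addr base h 0 (τ.wreg 41))))) :
    WP N s (bsearch 39 40 41 .skip b) (fun τ t => Frame 39 σ τ ∧ SameMem σ τ ∧
      τ.wreg 39 ≤ 2 ^ h ∧ (∀ i < 2 ^ h, P (σ.rmem (addr base h 0 i)) ↔ τ.wreg 39 ≤ i) ∧
      t ≤ 41 * (h + 1) + 5) σ := by
  have hb := hT.one_lt_base
  have hhh : 2 ^ h ≤ (h + 1) * 2 ^ h := Nat.le_mul_of_pos_left _ (by omega)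
  have hp : 1 ≤ 2 ^ h := Nat.one_le_two_pow
  refine WP.bsearch (l := 39) (by norm_num) (by norm_num) le_rfl trivial trivial
    (fun i => P (σ.rmem (addr base h 0 i))) 1 (h + 1) (by omega) (by omega)
    (by rw [h39, h40, pow_succ]; omega) ?_ ?_ ?_
  · intro i i' h₁ h₂ h₃
    exact hP _ _ (hT.sorted_fst i i' h₂ (by omega))
  · intro τ hF hM h₁ h₂
    refine WP.skip ⟨le_rfl, hbP τ hF hM ?_⟩
    rw [hF.w 30 (by norm_num), h30, min_eq_left (a := 2) (by omega),
      min_eq_left (a := 2 * _) (by omega), addr, min_eq_left (by omega)]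
    omega
  · intro τ t hF hM h₁ h₂ h₃ h₄ ht
    rw [h39] at h₁ h₃
    rw [h40] at h₂ h₄
    refine ⟨hF, hM, h₂, fun i hi => ⟨fun hPi => ?_, fun hi' => h₄ i hi' hi⟩, ht.trans ?_⟩
    · by_contra hlt
      exact h₃ i (by omega) (by omega) hPi
    · have : (1 + b.cost + 20) * (h + 1) ≤ 41 * (h + 1) := Nat.mul_le_mul_right _ (by omega)
      omega

/-- Two binary searches on level `0` turn the bounds for `x` into an index range `[L, R)`, and the
ascent respects only the lower bound for `y`. The upper bound is needed just once: if a lowest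
admissible point exceeds it, then so do all the others. -/
lemma lowest_spec (hT : RangeTree σ.wmem σ.rmem base h T)
    (hs : base + 2 * ((h + 1) * 2 ^ h) ≤ s) (hm : σ.wmem 1 = 2 ^ h) (h30 : σ.wreg 30 = base) :
    WP N s lowest (fun τ t =>
      Lowest σ.wmem σ.rmem (inBox T (σ.rreg 28) (σ.rreg 29) (σ.rreg 30) (σ.rreg 31))
        (σ.wreg 31) (τ.wreg 32) ∧ τ.wreg 32 + 1 < base + 2 * ((h + 1) * 2 ^ h) ∧
      t ≤ 600 * (h + 1) ^ 2) σ := by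
  have hb := hT.one_lt_base
  have hhh : 2 ^ h ≤ (h + 1) * 2 ^ h := Nat.le_mul_of_pos_left _ (by omega)
  have hp : 1 ≤ 2 ^ h := Nat.one_le_two_pow
  refine WP.seq (WP.setWord' 0 (by simp) (WP.seq (WP.setWord' (2 ^ h) ?_ (WP.seq ?_))))
  · simp [min_eq_left (show 1 ≤ s by omega), hm]
  refine (rank_spec (σ := (σ.setW 39 0).setW 40 (2 ^ h)) (P := fun x => σ.rreg 28 ≤ x) hT hs
    (by simpa using h30) (by simp) (by simp) (fun x y h₁ h₂ => h₂.trans h₁) (by simp) ?_).mono ?_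
  · intro τ hF hM he
    simp [he, hF.r 28, hM.r]
  rintro τ₁ t₁ ⟨hF₁, hM₁, hl₁, hr₁, ht₁⟩
  refine WP.seq (WP.setWord' _ rfl (WP.seq (WP.setWord' 0 (by simp) (WP.seq
    (WP.setWord' (2 ^ h) ?_ (WP.seq ?_))))))
  · simp [min_eq_left (show 1 ≤ s by omega), hM₁.w, hm]
  simp only [WordExpr.eval]
  set L := τ₁.wreg 39 with hL
  have hF₂ : Frame 32 σ (((τ₁.setW 33 L).setW 39 0).setW 40 (2 ^ h)) := by
    refine ⟨fun i hi => ?_, fun i hi => ?_⟩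
    · simp [hF₁.w i (by omega), show i ≠ 33 by omega, show i ≠ 39 by omega,
        show i ≠ 40 by omega]
    · simp [hF₁.r i (by omega)]
  have hM₂ : SameMem σ (((τ₁.setW 33 L).setW 39 0).setW 40 (2 ^ h)) := ⟨hM₁.w, hM₁.r⟩
  have hw₂ : (((τ₁.setW 33 L).setW 39 0).setW 40 (2 ^ h)).wreg 33 = L := by simp
  have h39 : (((τ₁.setW 33 L).setW 39 0).setW 40 (2 ^ h)).wreg 39 = 0 := by simp
  have h40 : (((τ₁.setW 33 L).setW 39 0).setW 40 (2 ^ h)).wreg 40 = 2 ^ h := by simp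
  generalize ((τ₁.setW 33 L).setW 39 0).setW 40 (2 ^ h) = τ₂ at *
  refine (rank_spec (σ := τ₂) (P := fun x => σ.rreg 29 < x) (by rw [hM₂.w, hM₂.r]; exact hT) hs
    (by rw [hF₂.w 30 (by norm_num), h30]) h39 h40 (fun x y h₁ h₂ => h₂.trans_le h₁)
    (by simp) ?_).mono ?_
  · intro τ hF hM he
    simp [he, hF.r 29, hF₂.r 29, hM.r]
  rintro τ₃ t₃ ⟨hF₃, hM₃, hl₃, hr₃, ht₃⟩
  refine WP.seq (WP.setWord' _ rfl (WP.seq (WP.setWord' base ?_ (WP.seq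
    (WP.setWord' 1 ?_ (WP.seq (WP.setWord' 0 (by simp) (WP.seq ?_))))))))
  · simp [hF₃.w 30, hF₂.w 30, h30]
  · simp; omega
  simp only [WordExpr.eval]
  set R := τ₃.wreg 39 with hR
  have hF₄ : Frame 32 σ ((((τ₃.setW 34 R).setW 35 base).setW 36 1).setW 32 0) := by
    refine ⟨fun i hi => ?_, fun i hi => ?_⟩
    · simp [hF₃.w i (by omega), hF₂.w i (by omega), show i ≠ 32 by omega, show i ≠ 34 by omega,
        show i ≠ 35 by omega, show i ≠ 36 by omega]
    · simp [hF₃.r i (by omega), hF₂.r i (by omega)]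
  have hM₄ : SameMem σ ((((τ₃.setW 34 R).setW 35 base).setW 36 1).setW 32 0) :=
    hM₂.trans ⟨hM₃.w, hM₃.r⟩
  have g₁ : ((((τ₃.setW 34 R).setW 35 base).setW 36 1).setW 32 0).wreg 33 = L := by
    simp [hF₃.w 33, hw₂]
  have g₂ : ((((τ₃.setW 34 R).setW 35 base).setW 36 1).setW 32 0).wreg 34 = R := by simp
  have g₃ : ((((τ₃.setW 34 R).setW 35 base).setW 36 1).setW 32 0).wreg 35 = base := by simp
  have g₄ : ((((τ₃.setW 34 R).setW 35 base).setW 36 1).setW 32 0).wreg 36 = 1 := by simp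
  have g₅ : ((((τ₃.setW 34 R).setW 35 base).setW 36 1).setW 32 0).wreg 32 = 0 := by simp
  generalize (((τ₃.setW 34 R).setW 35 base).setW 36 1).setW 32 0 = τ₄ at *
  have hT' := hT
  rw [← hM₄.w, ← hM₄.r] at hT'
  refine WP.call climb_above climb_noStore
    (climb_spec (σ := τ₄) hT' hs (by rw [hM₄.w, hm]) (L := L) (R := R) hl₃ ?_) ?_
  · refine ⟨g₁, g₂, by simp [g₃], by simp [g₄], by simp, by simp, ?_, by omega, .refl _ _,
      .refl _⟩
    -- Nothing has been searched at the start, so the null pointer is a correct result.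
    have : outside L R 0 L R = ∅ := by ext i; simp [outside]; tauto
    rw [this, g₅]
    left; simp [atLeast]
  rintro τ₅ t₅ hF₅ hM₅ ⟨hlow, hbd, ht₅⟩
  rw [hM₄.w, hM₄.r, hF₄.r 30 (by norm_num), hF₄.w 31 (by norm_num)] at hlow
  have hF := hF₄.trans hF₅
  have hM := hM₄.trans hM₅
  -- The rectangle is the part below `r31` of the region that the ascent has searched.
  have hsub : ∀ q, q ∈ inBox T (σ.rreg 28) (σ.rreg 29) (σ.rreg 30) (σ.rreg 31) ↔
      q ∈ atLeast ((fun i => entry σ.wmem σ.rmem (addr base h 0 i)) '' {i | L ≤ i ∧ i < R})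
        (σ.rreg 30) ∧ q.2.1 ≤ σ.rreg 31 := by
    intro q
    rw [hM₂.r] at hr₃
    simp only [State.setW_rmem] at hr₁
    rw [← hT.points]
    constructor
    · rintro ⟨⟨i, hi, rfl⟩, ⟨h₁, h₂⟩, h₃, h₄⟩
      refine ⟨⟨⟨i, ⟨(hr₁ i hi).1 h₁, ?_⟩, rfl⟩, h₃⟩, h₄⟩
      by_contra hle
      exact absurd ((hr₃ i hi).2 (by omega)) (not_lt.2 h₂)
    · rintro ⟨⟨⟨i, hi, rfl⟩, h₃⟩, h₄⟩
      have hi' : i < 2 ^ h := lt_of_lt_of_le hi.2 hl₃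
      refine ⟨⟨i, hi', rfl⟩, ⟨(hr₁ i hi').2 hi.1, ?_⟩, h₃, h₄⟩
      by_contra hle
      exact absurd ((hr₃ i hi').1 (not_le.1 hle)) (by have := hi.2; omega)
  have e₁ : min (τ₅.wreg 32 + min 1 s) s = τ₅.wreg 32 + 1 := by
    rw [min_eq_left (a := 1) (by omega), min_eq_left (by omega)]
  have htime : ∀ x, x ≤ 50 → t₁ + t₃ + t₅ + x ≤ 600 * (h + 1) ^ 2 := by
    intro x hx
    have h₁ : (80 * (h + 1) + 280) * (h + 1) = 80 * (h + 1) ^ 2 + 280 * (h + 1) := by ring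
    have h₂ : h + 1 ≤ (h + 1) ^ 2 := Nat.le_self_pow (by norm_num) _
    omega
  refine WP.ite (fun hc => WP.skip ?_) (fun hc => WP.ite (fun hc' => WP.skip ?_)
    (fun hc' => WP.setWord ?_))
  · simp only [Test.Holds, WordExpr.eval] at hc
    refine ⟨Or.inl ⟨by omega, fun q hq => ?_⟩, hbd, ?_⟩
    · rcases hlow with ⟨-, hlow⟩ | ⟨h0, -⟩
      · exact hlow q ((hsub q).1 hq).1
      · omega
    · simp; refine le_trans ?_ (htime 30 (by norm_num)); omega
  · simp only [Test.Holds, WordExpr.eval, RealExpr.eval, e₁, hM.r, hF.r 31 (by norm_num)] at hc'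
    refine ⟨?_, hbd, ?_⟩
    · rcases hlow with ⟨h0, hlow⟩ | ⟨h0, h₁, h₂, h₃⟩
      · exact Or.inl ⟨h0, fun q hq => hlow q ((hsub q).1 hq).1⟩
      · exact Or.inr ⟨h0, (hsub _).2 ⟨h₁, hc'⟩, h₂, fun q hq => h₃ q ((hsub q).1 hq).1⟩
    · simp; refine le_trans ?_ (htime 40 (by norm_num)); omega
  · simp only [Test.Holds, WordExpr.eval, RealExpr.eval, e₁, hM.r, hF.r 31 (by norm_num),
      not_le] at hc'
    refine ⟨Or.inl ⟨by simp, fun q hq => ?_⟩, by simp; omega, ?_⟩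
    · rcases hlow with ⟨h0, hlow⟩ | ⟨h0, h₁, h₂, h₃⟩
      · exact hlow q ((hsub q).1 hq).1
      · by_contra hne
        have := ((hsub q).1 hq).2
        exact absurd (h₃ q ((hsub q).1 hq).1 hne) (by linarith)
    · simp; refine le_trans ?_ (htime 40 (by norm_num)); omega

end

/-! ### The scale of a query -/

section

variable {N : Seminorm ℝ Point} {s : ℕ} {σ : State}

/-- The points of `A` whose coordinates exceed `x` and `y` by at most `r` in the norm. -/
def near (N : Seminorm ℝ Point) (A : Set ColoredPoint) (x y r : ℝ) : Set ColoredPoint :=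
  {q | q ∈ A ∧ N (1, 0) * (q.1 - x) ≤ r ∧ N (0, 1) * (q.2.1 - y) ≤ r}

/-- There are points of different colors in `A` and `B`. -/
def Bichromatic (A B : Set ColoredPoint) : Prop := ∃ a ∈ A, ∃ b ∈ B, a.2.2 ≠ b.2.2

/-- The norm of the first unit vector. -/
def normFst : RealExpr := .normOf (.const 1) (.const 0)

/-- The norm of the second unit vector. -/
def normSnd : RealExpr := .normOf (.const 0) (.const 1)

@[simp] lemma normFst_eval : normFst.eval N s σ = N (1, 0) := by simp [normFst]
@[simp] lemma normSnd_eval : normSnd.eval N s σ = N (0, 1) := by simp [normSnd]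
@[simp] lemma normFst_cost : normFst.cost = 3 := rfl
@[simp] lemma normSnd_cost : normSnd.cost = 3 := rfl

/-- Puts the minimum of two real values into a register. -/
def setMin (i : ℕ) (x y : RealExpr) : Program :=
  .ite (.realLe x y) (.setReal i x) (.setReal i y)

lemma WP.setMin {Q : State → ℕ → Prop} {i : ℕ} {x y : RealExpr}
    (h : ∀ t ≤ 2 * x.cost + 2 * y.cost + 3, Q (σ.setR i (min (x.eval N s σ) (y.eval N s σ))) t) :
    WP N s (AnchoredCRCP.setMin i x y) Q σ := by
  refine WP.ite (fun hc => WP.setReal ?_) (fun hc => WP.setReal ?_)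
  · rw [min_eq_left hc] at h
    exact h _ (by simp; omega)
  · rw [min_eq_right (not_le.1 hc).le] at h
    exact h _ (by simp; omega)

/-- A side of a query: register `b` holds the address of a range tree, and the real registers from
`o` on hold the coordinates of the corners of a rectangle. The memory has the height `h` of the
range tree in its header. -/
structure Side (σ : State) (s h b o : ℕ) (T : Set ColoredPoint) : Prop where
  tree : RangeTree σ.wmem σ.rmem (σ.wreg b) h T
  le : σ.wreg b + 2 * ((h + 1) * 2 ^ h) ≤ s
  leaves : σ.wmem 1 = 2 ^ h
  color : ∀ q ∈ T, q.2.2 ≠ 0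
  b_lt : b < 15
  o_lt : o + 3 < 15

/-- The points in the rectangle of a side. -/
def Side.box (σ : State) (o : ℕ) (T : Set ColoredPoint) : Set ColoredPoint :=
  inBox T (σ.rreg o) (σ.rreg (o + 2)) (σ.rreg (o + 1)) (σ.rreg (o + 3))

lemma Side.congr {h b o : ℕ} {T : Set ColoredPoint} (hS : Side σ s h b o T) {τ : State}
    (hF : Frame 15 σ τ) (hM : SameMem σ τ) : Side τ s h b o T := by
  have := hF.w b hS.b_lt
  refine ⟨?_, ?_, ?_, hS.color, hS.b_lt, hS.o_lt⟩
  · rw [hM.w, hM.r, this]; exact hS.tree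
  · rw [this]; exact hS.le
  · rw [hM.w]; exact hS.leaves

lemma Side.box_congr {h b o : ℕ} {T : Set ColoredPoint} (hS : Side σ s h b o T) {τ : State}
    (hF : Frame 15 σ τ) : Side.box τ o T = Side.box σ o T := by
  have := hS.o_lt
  simp only [Side.box]
  rw [hF.r _ (by omega), hF.r _ (by omega), hF.r _ (by omega), hF.r _ (by omega)]

/-- Lowest point with a color other than `c` on a side, at most `r25` away from the corner. -/
def lowestNear (b o : ℕ) (c : WordExpr) : Program :=
  .seq (.setReal 28 (.reg o)) <|
  .seq (setMin 29 (.add (.reg o) (.div (.reg 25) normFst)) (.reg (o + 2))) <|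
  .seq (.setReal 30 (.reg (o + 1))) <|
  .seq (setMin 31 (.add (.reg (o + 1)) (.div (.reg 25) normSnd)) (.reg (o + 3))) <|
  .seq (.setWord 31 c) <|
  .seq (.setWord 30 (.reg b)) lowest

lemma lowestNear_above (b o : ℕ) (c : WordExpr) : (lowestNear b o c).Above 28 := by
  simp [lowestNear, setMin, lowest_above.mono (show 28 ≤ 32 by norm_num)]

lemma lowestNear_noStore (b o : ℕ) (c : WordExpr) : (lowestNear b o c).NoStore := by
  simp [lowestNear, setMin, lowest_noStore]

lemma IsMonotoneNorm.fst_pos (hN : IsMonotoneNorm N) : 0 < N (1, 0) := by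
  refine lt_of_le_of_ne (apply_nonneg _ _) fun h => ?_
  have := hN.1 _ h.symm
  simp at this

lemma IsMonotoneNorm.snd_pos (hN : IsMonotoneNorm N) : 0 < N (0, 1) := by
  refine lt_of_le_of_ne (apply_nonneg _ _) fun h => ?_
  have := hN.1 _ h.symm
  simp at this

/-- The norms of the unit vectors are positive, so the bounds that define `near` can be divided by
them; together with the sides of the box they again form a rectangle. Only two forms of `c` occur:
`0`, which forbids no point, and the color of a record found earlier. -/
lemma lowestNear_spec (hN : IsMonotoneNorm N) {h b o : ℕ} {T : Set ColoredPoint}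
    (hS : Side σ s h b o T) (i : ℕ) (c : WordExpr)
    (hc : c = .const 0 ∨ c = .load (.reg i)) {c₀ : ℕ} (hc₀ : c.eval s σ = c₀) :
    WP N s (lowestNear b o c) (fun τ t =>
      Lowest σ.wmem σ.rmem
        (near N (Side.box σ o T) (σ.rreg o) (σ.rreg (o + 1)) (σ.rreg 25)) c₀ (τ.wreg 32) ∧
      t ≤ 650 * (h + 1) ^ 2) σ := by
  have hb := hS.b_lt
  have ho := hS.o_lt
  have h1 : 1 ≤ (h + 1) ^ 2 := Nat.one_le_pow _ _ (by omega)
  have hcc : c.cost ≤ 2 := by rcases hc with rfl | rfl <;> simp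
  refine WP.seq (WP.setReal (WP.seq (WP.setMin fun t₁ ht₁ => WP.seq (WP.setReal (WP.seq
    (WP.setMin fun t₂ ht₂ => WP.seq (WP.setWord' c₀ ?_ (WP.seq (WP.setWord' (σ.wreg b) ?_ ?_)))))))))
  · rcases hc with rfl | rfl
    · simpa using hc₀
    · simpa using hc₀
  · simp [show b ≠ 31 by omega]
  have e₁ : o ≠ 28 := by omega
  have e₂ : o + 1 ≠ 28 := by omega
  have e₃ : o + 2 ≠ 28 := by omega
  have e₄ : o + 3 ≠ 28 := by omega
  have e₅ : o + 1 ≠ 29 := by omega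
  have e₆ : o + 3 ≠ 29 := by omega
  have e₇ : o + 1 ≠ 30 := by omega
  have e₈ : o + 3 ≠ 30 := by omega
  simp only [RealExpr.cost, normFst_cost, normSnd_cost] at ht₁ ht₂
  refine (lowest_spec (σ := _) (base := σ.wreg b) (h := h) (T := T) ?_ hS.le ?_ ?_).mono ?_
  · simpa using hS.tree
  · simpa using hS.leaves
  · simp
  rintro τ t ⟨hl, -, ht⟩
  refine ⟨?_, by simp; omega⟩
  simp [e₁, e₂, e₃, e₄, e₅, e₆, e₇, e₈] at hl
  convert hl using 1
  ext q
  simp only [near, Side.box, inBox, Set.mem_ofPred_eq, le_min_iff, ← sub_le_iff_le_add',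
    le_div_iff₀' hN.fst_pos, le_div_iff₀' hN.snd_pos]
  tauto

/-- The test whether two pointers have been found. -/
def bothFound : Test :=
  .and (.not (.wordLe (.reg 25) (.const 0))) (.not (.wordLe (.reg 26) (.const 0)))

@[simp] lemma bothFound_holds : bothFound.Holds N s σ ↔ σ.wreg 25 ≠ 0 ∧ σ.wreg 26 ≠ 0 := by
  simp [bothFound]

/-- Looks for a bichromatic pair at the scale `r25`. -/
def probe : Program :=
  .seq (lowestNear 1 7 (.const 0)) <|
  .seq (.setWord 25 (.reg 32)) <|
  .seq (lowestNear 2 11 (.load (.reg 25))) <|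
  .seq (.setWord 26 (.reg 32)) <|
  .ite bothFound .skip <|
  .seq (lowestNear 1 7 (.load (.reg 25))) <|
  .seq (.setWord 25 (.reg 32)) <|
  .seq (lowestNear 2 11 (.load (.reg 25))) (.setWord 26 (.reg 32))

lemma probe_above : probe.Above 25 := by
  simp [probe, (lowestNear_above _ _ _).mono (show 25 ≤ 28 by norm_num)]

lemma probe_noStore : probe.NoStore := by
  simp [probe, lowestNear_noStore]

/-- There is a bichromatic pair at the scale `r`. -/
def AtScale (N : Seminorm ℝ Point) (σ : State) (T T' : Set ColoredPoint) (r : ℝ) : Prop :=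
  Bichromatic (near N (Side.box σ 7 T) (σ.rreg 7) (σ.rreg 8) r)
    (near N (Side.box σ 11 T') (σ.rreg 11) (σ.rreg 12) r)

lemma AtScale.mono {T T' : Set ColoredPoint} {r r' : ℝ} (h : AtScale N σ T T' r) (hr : r ≤ r') :
    AtScale N σ T T' r' := by
  obtain ⟨a, ⟨ha, h₁, h₂⟩, b, ⟨hb, h₃, h₄⟩, hab⟩ := h
  exact ⟨a, ⟨ha, h₁.trans hr, h₂.trans hr⟩, b, ⟨hb, h₃.trans hr, h₄.trans hr⟩, hab⟩

lemma Lowest.bichromatic {wm : ℕ → ℕ} {rm : ℕ → ℝ} {A B : Set ColoredPoint} {c p q : ℕ}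
    (hp : Lowest wm rm A c p) (hq : Lowest wm rm B (wm p) q) (h : p ≠ 0 ∧ q ≠ 0) :
    Bichromatic A B := by
  rcases hp with ⟨h₁, -⟩ | ⟨-, h₁, h₂, -⟩
  · exact absurd h₁ h.1
  rcases hq with ⟨h₃, -⟩ | ⟨-, h₃, h₄, -⟩
  · exact absurd h₃ h.2
  exact ⟨_, h₁, _, h₃, Ne.symm h₄⟩

/-- If `A` is nonempty, then `p` is found because `0` is not the color of a point. The failure of
the first attempt then means that all points of `B` have the color of `p`. A bichromatic pair
therefore needs a point of `A` of another color, and any such point goes with any point of `B`; the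
second attempt looks for exactly this. -/
lemma Lowest.bichromatic_iff {wm : ℕ → ℕ} {rm : ℕ → ℝ} {A B : Set ColoredPoint} {p q p' q' : ℕ}
    (hA : ∀ a ∈ A, a.2.2 ≠ 0) (hp : Lowest wm rm A 0 p) (hq : Lowest wm rm B (wm p) q)
    (h : ¬ (p ≠ 0 ∧ q ≠ 0)) (hp' : Lowest wm rm A (wm p) p')
    (hq' : Lowest wm rm B (wm p') q') : (p' ≠ 0 ∧ q' ≠ 0) ↔ Bichromatic A B := by
  refine ⟨hp'.bichromatic hq', ?_⟩
  rintro ⟨a, ha, b, hb, hab⟩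
  have hp0 : p ≠ 0 := by
    rcases hp with ⟨-, h₁⟩ | ⟨h₁, -⟩
    · exact absurd (h₁ a ha) (hA a ha)
    · exact h₁
  have hq0 : q = 0 := by tauto
  have hB : ∀ b ∈ B, b.2.2 = wm p := by
    rcases hq with ⟨-, h₁⟩ | ⟨h₁, -⟩
    · exact h₁
    · exact absurd hq0 h₁
  have hne : a.2.2 ≠ wm p := by rw [← hB b hb]; exact hab
  rcases hp' with ⟨-, h₁⟩ | ⟨h₁, -, h₂, -⟩
  · exact absurd (h₁ a ha) hne
  refine ⟨h₁, ?_⟩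
  rcases hq' with ⟨-, h₃⟩ | ⟨h₃, -⟩
  · exact absurd ((h₃ b hb).symm.trans (hB b hb)) h₂
  · exact h₃

/-- Four searches at most decide whether the scale is large enough. Heights are irrelevant here:
lowest points merely serve as representatives with prescribed color restrictions. -/
lemma probe_spec (hN : IsMonotoneNorm N) {h : ℕ} {T T' : Set ColoredPoint}
    (hA : Side σ s h 1 7 T) (hB : Side σ s h 2 11 T') :
    WP N s probe (fun τ t => (bothFound.Holds N s τ ↔ AtScale N σ T T' (σ.rreg 25)) ∧
      t ≤ 2700 * (h + 1) ^ 2) σ := by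
  have h1 : 1 ≤ (h + 1) ^ 2 := Nat.one_le_pow _ _ (by omega)
  set A := near N (Side.box σ 7 T) (σ.rreg 7) (σ.rreg 8) (σ.rreg 25) with hAdef
  set B := near N (Side.box σ 11 T') (σ.rreg 11) (σ.rreg 12) (σ.rreg 25) with hBdef
  have hcol : ∀ a ∈ A, a.2.2 ≠ 0 := fun a ha => hA.color a ha.1.1
  refine WP.seq (WP.call (lowestNear_above _ _ _) (lowestNear_noStore _ _ _)
    (lowestNear_spec hN hA 0 (.const 0) (Or.inl rfl) (c₀ := 0) (by simp)) ?_)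
  rintro τ₁ t₁ hF₁ hM₁ ⟨hp, ht₁⟩
  refine WP.seq (WP.setWord' _ rfl (WP.seq ?_))
  simp only [WordExpr.eval]
  set p := τ₁.wreg 32
  have hF₁' : Frame 25 σ (τ₁.setW 25 p) :=
    ⟨fun i hi => by simp [show i ≠ 25 by omega, hF₁.w i (by omega)],
      fun i hi => by simp [hF₁.r i (by omega)]⟩
  have hr₁' : (τ₁.setW 25 p).rreg 25 = σ.rreg 25 := by simp [hF₁.r 25]
  have hM₁' : SameMem σ (τ₁.setW 25 p) := ⟨hM₁.w, hM₁.r⟩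
  have hp₁ : (τ₁.setW 25 p).wreg 25 = p := by simp
  generalize τ₁.setW 25 p = σ₁ at *
  have hF15 := hF₁'.mono (show 15 ≤ 25 by norm_num)
  refine WP.call (lowestNear_above _ _ _) (lowestNear_noStore _ _ _)
    (lowestNear_spec hN (hB.congr hF15 hM₁') 25 (.load (.reg 25)) (Or.inr rfl) rfl) ?_
  rintro τ₂ t₂ hF₂ hM₂ ⟨hq, ht₂⟩
  simp only [WordExpr.eval] at hq
  rw [hB.box_congr hF15, hF15.r 11 (by norm_num), hF15.r 12 (by norm_num), hr₁', ← hBdef, hp₁,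
    hM₁'.w, hM₁'.r] at hq
  refine WP.seq (WP.setWord' _ rfl ?_)
  simp only [WordExpr.eval]
  set q := τ₂.wreg 32
  have hF₂' : Frame 25 σ (τ₂.setW 26 q) := hF₁'.trans
    ⟨fun i hi => by simp [show i ≠ 26 by omega, hF₂.w i (by omega)],
      fun i hi => by simp [hF₂.r i (by omega)]⟩
  have hr₂' : (τ₂.setW 26 q).rreg 25 = σ.rreg 25 := by simp [hF₂.r 25, hr₁']
  have hM₂' : SameMem σ (τ₂.setW 26 q) := hM₁'.trans ⟨hM₂.w, hM₂.r⟩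
  have hp₂ : (τ₂.setW 26 q).wreg 25 = p := by simp [hF₂.w 25, hp₁]
  have hq₂ : (τ₂.setW 26 q).wreg 26 = q := by simp
  generalize τ₂.setW 26 q = σ₂ at *
  refine WP.ite (fun hc => WP.skip ⟨?_, ?_⟩) (fun hc => ?_)
  · refine iff_of_true hc ?_
    rw [bothFound_holds, hp₂, hq₂] at hc
    exact hp.bichromatic hq hc
  · simp [bothFound]; omega
  rw [bothFound_holds, hp₂, hq₂] at hc
  have hF15₂ := hF₂'.mono (show 15 ≤ 25 by norm_num)
  refine WP.seq (WP.call (lowestNear_above _ _ _) (lowestNear_noStore _ _ _)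
    (lowestNear_spec hN (hA.congr hF15₂ hM₂') 25 (.load (.reg 25)) (Or.inr rfl) rfl) ?_)
  rintro τ₃ t₃ hF₃ hM₃ ⟨hp', ht₃⟩
  simp only [WordExpr.eval] at hp'
  rw [hA.box_congr hF15₂, hF15₂.r 7 (by norm_num), hF15₂.r 8 (by norm_num), hr₂', ← hAdef, hp₂,
    hM₂'.w, hM₂'.r] at hp'
  refine WP.seq (WP.setWord' _ rfl (WP.seq ?_))
  simp only [WordExpr.eval]
  set p' := τ₃.wreg 32
  have hF₃' : Frame 25 σ (τ₃.setW 25 p') := hF₂'.trans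
    ⟨fun i hi => by simp [show i ≠ 25 by omega, hF₃.w i (by omega)],
      fun i hi => by simp [hF₃.r i (by omega)]⟩
  have hr₃' : (τ₃.setW 25 p').rreg 25 = σ.rreg 25 := by simp [hF₃.r 25, hr₂']
  have hM₃' : SameMem σ (τ₃.setW 25 p') := hM₂'.trans ⟨hM₃.w, hM₃.r⟩
  have hp₃ : (τ₃.setW 25 p').wreg 25 = p' := by simp
  generalize τ₃.setW 25 p' = σ₃ at *
  have hF15₃ := hF₃'.mono (show 15 ≤ 25 by norm_num)
  refine WP.call (lowestNear_above _ _ _) (lowestNear_noStore _ _ _)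
    (lowestNear_spec hN (hB.congr hF15₃ hM₃') 25 (.load (.reg 25)) (Or.inr rfl) rfl) ?_
  rintro τ₄ t₄ hF₄ hM₄ ⟨hq', ht₄⟩
  simp only [WordExpr.eval] at hq'
  rw [hB.box_congr hF15₃, hF15₃.r 11 (by norm_num), hF15₃.r 12 (by norm_num), hr₃', ← hBdef, hp₃,
    hM₃'.w, hM₃'.r] at hq'
  refine WP.setWord ⟨?_, ?_⟩
  · rw [bothFound_holds]
    simp only [State.setW_wreg, WordExpr.eval, if_true, show (25 : ℕ) ≠ 26 by norm_num, if_false,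
      hF₄.w 25 (by norm_num), hp₃]
    exact Lowest.bichromatic_iff hcol hp hq hc hp' hq'
  · simp [bothFound]; omega

/-- Binary search for the smallest key at which `probe` is successful. The scale in `r20` is
improved to it. -/
def improveScale (key : RealExpr) : Program :=
  .seq (.setWord 22 (.const 0)) <|
  .seq (.setWord 23 (.load (.const 1))) <|
  .seq (bsearch 22 23 24 (.seq (.setReal 25 key) probe) bothFound) <|
  .ite (.wlt (.reg 22) (.load (.const 1)))
    (.seq (.setWord 24 (.reg 22)) <|
      .seq (.setReal 25 key) <| setMin 20 (.reg 20) (.reg 25)) .skip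

lemma improveScale_above (key : RealExpr) : (improveScale key).Above 20 := by
  simp [improveScale, bsearch, setMin, probe_above.mono (show 20 ≤ 25 by norm_num)]

lemma improveScale_noStore (key : RealExpr) : (improveScale key).NoStore := by
  simp [improveScale, bsearch, setMin, probe_noStore]

lemma AtScale.congr {h : ℕ} {T T' : Set ColoredPoint} {r : ℝ} (hA : Side σ s h 1 7 T)
    (hB : Side σ s h 2 11 T') {τ : State} (hF : Frame 15 σ τ) :
    AtScale N τ T T' r ↔ AtScale N σ T T' r := by
  simp only [AtScale]
  rw [hA.box_congr hF, hB.box_congr hF, hF.r 7 (by norm_num), hF.r 8 (by norm_num),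
    hF.r 11 (by norm_num), hF.r 12 (by norm_num)]

/-- Success of the test is monotone in the scale and the keys are sorted, so binary search finds the
smallest successful key. If no key succeeds, the scale in `r20` stays as it is; it is always one at
which a pair exists. -/
lemma improveScale_spec (hN : IsMonotoneNorm N) {h : ℕ} {T T' : Set ColoredPoint}
    (hA : Side σ s h 1 7 T) (hB : Side σ s h 2 11 T') (hr : AtScale N σ T T' (σ.rreg 20))
    (key : RealExpr) (hcost : key.cost ≤ 30) (k : ℕ → ℝ)
    (hk : ∀ i j, i ≤ j → j < 2 ^ h → k i ≤ k j)
    (hkey : ∀ τ, Frame 15 σ τ → SameMem σ τ → τ.wreg 24 < 2 ^ h →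
      key.eval N s τ = k (τ.wreg 24)) :
    WP N s (improveScale key) (fun τ t => AtScale N σ T T' (τ.rreg 20) ∧
      τ.rreg 20 ≤ σ.rreg 20 ∧ (∀ i < 2 ^ h, AtScale N σ T T' (k i) → τ.rreg 20 ≤ k i) ∧
      t ≤ 3000 * (h + 1) ^ 3) σ := by
  have h1 : 1 ≤ (h + 1) ^ 2 := Nat.one_le_pow _ _ (by omega)
  have hb := hA.tree.one_lt_base
  have hle := hA.le
  have hhh : 2 ^ h ≤ (h + 1) * 2 ^ h := Nat.le_mul_of_pos_left _ (by omega)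
  have hp : 1 ≤ 2 ^ h := Nat.one_le_two_pow
  have e1 : min 1 s = 1 := min_eq_left (by omega)
  refine WP.seq (WP.setWord' 0 (by simp) (WP.seq (WP.setWord' (2 ^ h) ?_ (WP.seq ?_))))
  · simp [e1, hA.leaves]
  set σ₁ := (σ.setW 22 0).setW 23 (2 ^ h) with hσ₁
  have hF₁ : Frame 22 σ σ₁ :=
    ⟨fun i hi => by simp [hσ₁, show i ≠ 22 by omega, show i ≠ 23 by omega],
      fun i hi => by simp [hσ₁]⟩
  have hM₁ : SameMem σ σ₁ := ⟨rfl, rfl⟩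
  have h22 : σ₁.wreg 22 = 0 := by simp [hσ₁]
  have h23 : σ₁.wreg 23 = 2 ^ h := by simp [hσ₁]
  clear_value σ₁
  refine WP.bsearch (l := 22) (by norm_num) (by norm_num) le_rfl ⟨le_rfl, probe_above⟩
    ⟨trivial, probe_noStore⟩ (fun i => AtScale N σ T T' (k i)) (2700 * (h + 1) ^ 2 + 31) (h + 1)
    (by omega) (by omega) (by rw [h22, h23, pow_succ]; omega) ?_ ?_ ?_
  · intro i i' h₁ h₂ h₃ h₄
    exact h₄.mono (hk i i' h₂ (by omega))
  · intro τ hF hM h₁ h₂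
    have hF' := (hF₁.trans hF).mono (show 15 ≤ 22 by norm_num)
    have hM' := hM₁.trans hM
    refine WP.seq (WP.setReal' (k (τ.wreg 24)) (hkey τ hF' hM' (by omega)) ?_)
    have hF'' : Frame 15 σ (τ.setR 25 (k (τ.wreg 24))) := hF'.trans
      ⟨fun i hi => by simp, fun i hi => by simp [show i ≠ 25 by omega]⟩
    refine (probe_spec hN (hA.congr hF'' ⟨hM'.w, hM'.r⟩)
      (hB.congr hF'' ⟨hM'.w, hM'.r⟩)).mono ?_
    rintro υ t ⟨h₃, ht⟩
    refine ⟨by omega, ?_⟩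
    rw [h₃, AtScale.congr hA hB hF'']
    simp
  · intro τ t hF hM h₁ h₂ h₃ h₄ ht
    have hF' := hF₁.trans hF
    have hM' := hM₁.trans hM
    have ht' : t + 100 ≤ 3000 * (h + 1) ^ 3 := by
      have : bothFound.cost = 9 := rfl
      rw [this] at ht
      have e : (2700 * (h + 1) ^ 2 + 31 + 9 + 20) * (h + 1) = 2700 * (h + 1) ^ 3 + 60 * (h + 1) := by
        ring
      have : h + 1 ≤ (h + 1) ^ 3 := Nat.le_self_pow (by norm_num) _
      omega
    rw [h22] at h₃
    rw [h23] at h₂ h₄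
    refine WP.ite (fun hc => WP.seq (WP.setWord (WP.seq (WP.setReal' (k (τ.wreg 22)) ?_
      (WP.setMin fun t' ht' => ?_))))) (fun hc => WP.skip ?_)
    · rw [hkey]
      · simp
      · exact (hF'.mono (by norm_num)).trans ⟨fun i hi => by simp [show i ≠ 24 by omega],
          fun i hi => by simp⟩
      · exact ⟨hM'.w, hM'.r⟩
      · simpa [e1, hM'.w, hA.leaves] using hc
    · have hc' : τ.wreg 22 < 2 ^ h := by simpa [e1, hM'.w, hA.leaves] using hc
      simp only [RealExpr.cost] at ht'
      simp only [RealExpr.eval, State.setR_rreg, State.setW_rreg, if_true,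
        show (20 : ℕ) ≠ 25 by norm_num, if_false, hF'.r 20 (by norm_num)]
      refine ⟨?_, min_le_left _ _, fun i hi hik => (min_le_right _ _).trans ?_, ?_⟩
      · rcases min_choice (σ.rreg 20) (k (τ.wreg 22)) with h | h <;> rw [h]
        · exact hr
        · exact h₄ _ le_rfl hc'
      · refine hk _ _ ?_ hi
        by_contra hlt
        exact h₃ i (by omega) (by omega) hik
      · simp; omega
    · have hc' : 2 ^ h ≤ τ.wreg 22 := by simpa [e1, hM'.w, hA.leaves] using hc
      rw [hF'.r 20 (by norm_num)]
      refine ⟨hr, le_rfl, fun i hi hik => absurd hik (h₃ i (by omega) (by omega)), ?_⟩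
      simp; omega

/-- The key of the record `w24` of a range tree, with respect to the `x`-coordinate. -/
def keyFst (b o : ℕ) : RealExpr :=
  .mul normFst (.sub (.load (.add (.reg b) (.mul (.const 2) (.reg 24)))) (.reg o))

/-- The key of the record `w24` of the root of a range tree, with respect to the
`y`-coordinate. -/
def keySnd (b o : ℕ) : RealExpr :=
  .mul normSnd (.sub (.load (.add (.add (.reg b) (.add (.load (.const 9))
    (.mul (.const 2) (.reg 24)))) (.const 1))) (.reg (o + 1)))

/-- Finds the smallest scale at which there is a bichromatic pair. -/
def findScale : Program :=
  .seq (improveScale (keyFst 1 7)) <| .seq (improveScale (keySnd 1 7)) <|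
  .seq (improveScale (keyFst 2 11)) <| improveScale (keySnd 2 11)

lemma findScale_above : findScale.Above 20 := by
  simp [findScale, improveScale_above]

lemma findScale_noStore : findScale.NoStore := by
  simp [findScale, improveScale_noStore]

lemma Side.keyFst_eval {h b o : ℕ} {T : Set ColoredPoint} (hS : Side σ s h b o T) (τ : State)
    (hF : Frame 15 σ τ) (hM : SameMem σ τ) (h24 : τ.wreg 24 < 2 ^ h) :
    (keyFst b o).eval N s τ =
      N (1, 0) * (σ.rmem (addr (σ.wreg b) h 0 (τ.wreg 24)) - σ.rreg o) := by
  have hb := hS.tree.one_lt_base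
  have hle := hS.le
  have ho := hS.o_lt
  have hhh : 2 ^ h ≤ (h + 1) * 2 ^ h := Nat.le_mul_of_pos_left _ (by omega)
  have : min (τ.wreg b + min (min 2 s * τ.wreg 24) s) s = addr (σ.wreg b) h 0 (τ.wreg 24) := by
    rw [hF.w b hS.b_lt, min_eq_left (a := 2) (by omega), min_eq_left (a := 2 * _) (by omega),
      min_eq_left (by omega), addr]
    omega
  simp only [keyFst, RealExpr.eval, WordExpr.eval, this, normFst_eval, hM.r, hF.r o (by omega)]

lemma Side.keySnd_eval {h b o : ℕ} {T : Set ColoredPoint} (hS : Side σ s h b o T)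
    (h9 : σ.wmem 9 = 2 * (h * 2 ^ h)) (hs : 9 ≤ s) (τ : State)
    (hF : Frame 15 σ τ) (hM : SameMem σ τ) (h24 : τ.wreg 24 < 2 ^ h) :
    (keySnd b o).eval N s τ =
      N (0, 1) * (σ.rmem (addr (σ.wreg b) h h (τ.wreg 24) + 1) - σ.rreg (o + 1)) := by
  have hb := hS.tree.one_lt_base
  have hle := hS.le
  have ho := hS.o_lt
  have hmul := Nat.add_one_mul h (2 ^ h)
  have : min (min (τ.wreg b + min (τ.wmem (min 9 s) + min (min 2 s * τ.wreg 24) s) s) s +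
      min 1 s) s = addr (σ.wreg b) h h (τ.wreg 24) + 1 := by
    rw [hF.w b hS.b_lt, min_eq_left (a := 2) (by omega), min_eq_left (a := 1) (by omega),
      min_eq_left (a := 9) (by omega), min_eq_left (a := 2 * _) (by omega), hM.w, h9,
      min_eq_left (a := 2 * _ + _) (by omega), min_eq_left (a := σ.wreg b + _) (by omega), addr,
      min_eq_left (by omega)]
    omega
  simp only [keySnd, RealExpr.eval, WordExpr.eval, this, normSnd_eval, hM.r,
    hF.r (o + 1) (by omega)]

lemma Side.keyFst_mono {h b o : ℕ} {T : Set ColoredPoint} (hS : Side σ s h b o T) (i j : ℕ)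
    (hij : i ≤ j) (hj : j < 2 ^ h) :
    N (1, 0) * (σ.rmem (addr (σ.wreg b) h 0 i) - σ.rreg o) ≤
      N (1, 0) * (σ.rmem (addr (σ.wreg b) h 0 j) - σ.rreg o) :=
  mul_le_mul_of_nonneg_left (sub_le_sub_right (hS.tree.sorted_fst i j hij hj) _) (apply_nonneg _ _)

lemma Side.keySnd_mono {h b o : ℕ} {T : Set ColoredPoint} (hS : Side σ s h b o T) (i j : ℕ)
    (hij : i ≤ j) (hj : j < 2 ^ h) :
    N (0, 1) * (σ.rmem (addr (σ.wreg b) h h i + 1) - σ.rreg (o + 1)) ≤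
      N (0, 1) * (σ.rmem (addr (σ.wreg b) h h j + 1) - σ.rreg (o + 1)) := by
  refine mul_le_mul_of_nonneg_left (sub_le_sub_right (hS.tree.sorted_snd h le_rfl i j hij hj ?_) _)
    (apply_nonneg _ _)
  rw [Nat.div_eq_of_lt (by omega), Nat.div_eq_of_lt hj]

lemma Side.exists_keyFst {h b o : ℕ} {T : Set ColoredPoint} (hS : Side σ s h b o T)
    {q : ColoredPoint} (hq : q ∈ T) :
    ∃ i < 2 ^ h, q.1 = σ.rmem (addr (σ.wreg b) h 0 i) := by
  rw [← hS.tree.points] at hq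
  obtain ⟨i, hi, rfl⟩ := hq
  exact ⟨i, hi, rfl⟩

lemma Side.exists_keySnd {h b o : ℕ} {T : Set ColoredPoint} (hS : Side σ s h b o T)
    {q : ColoredPoint} (hq : q ∈ T) :
    ∃ i < 2 ^ h, q.2.1 = σ.rmem (addr (σ.wreg b) h h i + 1) := by
  rw [← hS.tree.points] at hq
  obtain ⟨i, hi, rfl⟩ := hq
  have : entry σ.wmem σ.rmem (addr (σ.wreg b) h 0 i) ∈
      (fun i => entry σ.wmem σ.rmem (addr (σ.wreg b) h h i)) '' block h h 0 := by
    rw [hS.tree.image_block h le_rfl 0]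
    exact ⟨i, ⟨hi, Nat.div_eq_of_lt hi⟩, rfl⟩
  obtain ⟨j, hj, he⟩ := this
  exact ⟨j, hj.1, by simpa [entry] using (congrArg (fun q => q.2.1) he).symm⟩

/-- The smallest scale is a maximum of four distances of points from their corners, hence equal to
one of them. Level `0` of each range tree is sorted by `x` and level `h` by `y`, so all these
distances occur in four sorted lists of keys, and one search in each list is enough. -/
lemma findScale_spec (hN : IsMonotoneNorm N) {h : ℕ} {T T' : Set ColoredPoint}
    (hA : Side σ s h 1 7 T) (hB : Side σ s h 2 11 T') (hr : AtScale N σ T T' (σ.rreg 20))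
    (h9 : σ.wmem 9 = 2 * (h * 2 ^ h)) (hs : 9 ≤ s) :
    WP N s findScale (fun τ t => AtScale N σ T T' (τ.rreg 20) ∧
      (∀ ρ, AtScale N σ T T' ρ → τ.rreg 20 ≤ ρ) ∧ t ≤ 12000 * (h + 1) ^ 3) σ := by
  refine WP.seq (WP.call (improveScale_above _) (improveScale_noStore _)
    (improveScale_spec hN hA hB hr _ (by simp [keyFst]) _ hA.keyFst_mono hA.keyFst_eval) ?_)
  rintro τ₁ t₁ hF₁ hM₁ ⟨hr₁, -, hk₁, ht₁⟩
  replace hF₁ := hF₁.mono (show 15 ≤ 20 by norm_num)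
  have hA₁ := hA.congr hF₁ hM₁
  have hB₁ := hB.congr hF₁ hM₁
  rw [← AtScale.congr hA hB hF₁] at hr₁
  refine WP.seq (WP.call (improveScale_above _) (improveScale_noStore _)
    (improveScale_spec hN hA₁ hB₁ hr₁ _ (by simp [keySnd]) _ hA₁.keySnd_mono
      (hA₁.keySnd_eval (by rw [hM₁.w, h9]) hs)) ?_)
  rintro τ₂ t₂ hF₂ hM₂ ⟨hr₂, hle₂, hk₂, ht₂⟩
  replace hF₂ := hF₁.trans (hF₂.mono (show 15 ≤ 20 by norm_num))
  replace hM₂ := hM₁.trans hM₂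
  have hA₂ := hA.congr hF₂ hM₂
  have hB₂ := hB.congr hF₂ hM₂
  rw [AtScale.congr hA hB hF₁, ← AtScale.congr hA hB hF₂] at hr₂
  refine WP.seq (WP.call (improveScale_above _) (improveScale_noStore _)
    (improveScale_spec hN hA₂ hB₂ hr₂ _ (by simp [keyFst]) _ hB₂.keyFst_mono hB₂.keyFst_eval) ?_)
  rintro τ₃ t₃ hF₃ hM₃ ⟨hr₃, hle₃, hk₃, ht₃⟩
  replace hF₃ := hF₂.trans (hF₃.mono (show 15 ≤ 20 by norm_num))
  replace hM₃ := hM₂.trans hM₃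
  have hA₃ := hA.congr hF₃ hM₃
  have hB₃ := hB.congr hF₃ hM₃
  rw [AtScale.congr hA hB hF₂, ← AtScale.congr hA hB hF₃] at hr₃
  refine WP.mono (improveScale_spec hN hA₃ hB₃ hr₃ _ (by simp [keySnd]) _ hB₃.keySnd_mono
      (hB₃.keySnd_eval (by rw [hM₃.w, h9]) hs)) ?_
  rintro τ₄ t₄ ⟨hr₄, hle₄, hk₄, ht₄⟩
  rw [AtScale.congr hA hB hF₃] at hr₄
  refine ⟨hr₄, ?_, by omega⟩
  rintro ρ ⟨a, ⟨ha, ha₁, ha₂⟩, b, ⟨hb, hb₁, hb₂⟩, hab⟩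
  obtain ⟨i₁, hi₁, e₁⟩ := hA.exists_keyFst ha.1
  obtain ⟨i₂, hi₂, e₂⟩ := hA.exists_keySnd ha.1
  obtain ⟨i₃, hi₃, e₃⟩ := hB.exists_keyFst hb.1
  obtain ⟨i₄, hi₄, e₄⟩ := hB.exists_keySnd hb.1
  have key : ∀ μ, N (1, 0) * (a.1 - σ.rreg 7) ≤ μ → N (0, 1) * (a.2.1 - σ.rreg 8) ≤ μ →
      N (1, 0) * (b.1 - σ.rreg 11) ≤ μ → N (0, 1) * (b.2.1 - σ.rreg 12) ≤ μ →
      AtScale N σ T T' μ := fun μ h₁ h₂ h₃ h₄ =>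
    ⟨a, ⟨ha, h₁, h₂⟩, b, ⟨hb, h₃, h₄⟩, hab⟩
  replace hk₁ := hk₁ i₁ hi₁
  replace hk₂ := hk₂ i₂ hi₂
  replace hk₃ := hk₃ i₃ hi₃
  replace hk₄ := hk₄ i₄ hi₄
  rw [AtScale.congr hA hB hF₁] at hk₂
  rw [AtScale.congr hA hB hF₂] at hk₃
  rw [AtScale.congr hA hB hF₃] at hk₄
  rw [← e₁] at hk₁
  rw [hM₁.r, hF₁.w 1 (by norm_num), hF₁.r (7 + 1) (by norm_num), ← e₂] at hk₂
  rw [hM₂.r, hF₂.w 2 (by norm_num), hF₂.r 11 (by norm_num), ← e₃] at hk₃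
  rw [hM₃.r, hF₃.w 2 (by norm_num), hF₃.r (11 + 1) (by norm_num), ← e₄] at hk₄
  norm_num at hk₂ hk₄
  generalize N (1, 0) * (a.1 - σ.rreg 7) = x₁ at *
  generalize N (0, 1) * (a.2.1 - σ.rreg 8) = x₂ at *
  generalize N (1, 0) * (b.1 - σ.rreg 11) = x₃ at *
  generalize N (0, 1) * (b.2.1 - σ.rreg 12) = x₄ at *
  -- The pair already exists at the maximum of its own four distances, which is at most `ρ`.
  -- Whichever of the four is the maximum is a successful key in its list.
  have hmax := key (max (max x₁ x₂) (max x₃ x₄)) (by simp) (by simp) (by simp) (by simp)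
  have hle : max (max x₁ x₂) (max x₃ x₄) ≤ ρ := by simp [*]
  refine le_trans ?_ hle
  rcases max_choice (max x₁ x₂) (max x₃ x₄) with h | h
  · rcases max_choice x₁ x₂ with h' | h'
    · rw [h, h'] at hmax ⊢; linarith [hk₁ hmax]
    · rw [h, h'] at hmax ⊢; linarith [hk₂ hmax]
  · rcases max_choice x₃ x₄ with h' | h'
    · rw [h, h'] at hmax ⊢; linarith [hk₃ hmax]
    · rw [h, h'] at hmax ⊢; linarith [hk₄ hmax]

end

/-! ### Candidates -/

section

variable {N : Seminorm ℝ Point} {s : ℕ} {σ : State}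

lemma addr_lt {base h k i : ℕ} (hk : k ≤ h) (hi : i < 2 ^ h) :
    addr base h k i + 1 < base + 2 * ((h + 1) * 2 ^ h) := by
  have : (k + 1) * 2 ^ h ≤ (h + 1) * 2 ^ h := Nat.mul_le_mul_right _ (by omega)
  have := Nat.add_one_mul k (2 ^ h)
  rw [addr]; omega

/-- Candidates are stored outside the cells of the trees, so the trees survive these writes. The
construction uses it as well, to place separately built trees in one memory. -/
lemma RangeTree.congr {wm wm' : ℕ → ℕ} {rm rm' : ℕ → ℝ} {base h : ℕ} {T : Set ColoredPoint}
    (hT : RangeTree wm rm base h T)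
    (hw : ∀ p, base ≤ p → p < base + 2 * ((h + 1) * 2 ^ h) → wm' p = wm p)
    (hr : ∀ p, base ≤ p → p < base + 2 * ((h + 1) * 2 ^ h) → rm' p = rm p) :
    RangeTree wm' rm' base h T := by
  have lt : ∀ k ≤ h, ∀ i < 2 ^ h, base ≤ addr base h k i ∧
      addr base h k i + 1 < base + 2 * ((h + 1) * 2 ^ h) := fun k hk i hi =>
    ⟨Nat.le_add_right _ _, addr_lt hk hi⟩
  have e₁ : ∀ k ≤ h, ∀ i < 2 ^ h, wm' (addr base h k i) = wm (addr base h k i) := fun k hk i hi =>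
    hw _ (lt k hk i hi).1 (by have := (lt k hk i hi).2; omega)
  have e₂ : ∀ k ≤ h, ∀ i < 2 ^ h, wm' (addr base h k i + 1) = wm (addr base h k i + 1) :=
    fun k hk i hi => hw _ (by have := (lt k hk i hi).1; omega) (lt k hk i hi).2
  have r₁ : ∀ k ≤ h, ∀ i < 2 ^ h, rm' (addr base h k i) = rm (addr base h k i) := fun k hk i hi =>
    hr _ (lt k hk i hi).1 (by have := (lt k hk i hi).2; omega)
  have r₂ : ∀ k ≤ h, ∀ i < 2 ^ h, rm' (addr base h k i + 1) = rm (addr base h k i + 1) :=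
    fun k hk i hi => hr _ (by have := (lt k hk i hi).1; omega) (lt k hk i hi).2
  have e₃ : ∀ k ≤ h, ∀ i < 2 ^ h,
      entry wm' rm' (addr base h k i) = entry wm rm (addr base h k i) :=
    fun k hk i hi => by simp only [entry, e₁ k hk i hi, r₁ k hk i hi, r₂ k hk i hi]
  refine ⟨hT.one_lt_base, ?_, fun i j hij hj => ?_, fun k hk i j hij hj hd => ?_,
    fun k hk j => ?_, fun k hk i hi => ?_⟩
  · rw [← hT.points]
    exact Set.image_congr fun i hi => e₃ 0 (by omega) i hi
  · rw [r₁ 0 (by omega) i (by omega), r₁ 0 (by omega) j hj]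
    exact hT.sorted_fst i j hij hj
  · rw [r₂ k hk i (by omega), r₂ k hk j hj]
    exact hT.sorted_snd k hk i j hij hj hd
  · have := hT.image_block k hk j
    rw [Set.image_congr fun i hi => e₃ k hk i hi.1, this]
    exact Set.image_congr fun i hi => (e₃ 0 (by omega) i hi.1).symm
  · rcases hT.next k hk i hi with ⟨h₁, h₂⟩ | ⟨j, h₁, h₂, h₃, h₄, h₅, h₆⟩
    · left
      refine ⟨by rw [e₂ k hk i hi, h₁], fun j h₃ h₄ h₅ => ?_⟩
      rw [e₁ k hk j h₄, e₁ k hk i hi, h₂ j h₃ h₄ h₅]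
    · right
      refine ⟨j, h₁, h₂, h₃, by rw [e₂ k hk i hi, h₄], ?_, fun l h₇ h₈ => ?_⟩
      · rw [e₁ k hk j h₂, e₁ k hk i hi]; exact h₅
      · rw [e₁ k hk l (by omega), e₁ k hk i hi, h₆ l h₇ h₈]

lemma Lowest.congr {wm wm' : ℕ → ℕ} {rm : ℕ → ℝ} {J : Set ColoredPoint} {c p : ℕ}
    (hp : Lowest wm' rm J c p) (hw : wm' p = wm p) : Lowest wm rm J c p := by
  simpa only [Lowest, entry, hw] using hp

/-- Stores two candidates from the part of a side with `x`-coordinates between `r24` and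
`r24 + r21` to the cells `w22` and `w22 + 1`. -/
def gatherColumn (b o : ℕ) : Program :=
  .seq (.setReal 28 (.reg 24)) <|
  .seq (setMin 29 (.add (.reg 24) (.reg 21)) (.reg (o + 2))) <|
  .seq (.setReal 30 (.reg (o + 1))) <|
  .seq (.setReal 31 (.reg (o + 3))) <|
  .seq (.setWord 31 (.const 0)) <|
  .seq (.setWord 30 (.reg b)) <|
  .seq lowest <|
  .seq (.storeWord (.reg 22) (.reg 32)) <|
  .seq (.setWord 31 (.load (.reg 32))) <|
  .seq lowest <| .storeWord (.add (.reg 22) (.const 1)) (.reg 32)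

lemma gatherColumn_above (b o : ℕ) : (gatherColumn b o).Above 28 := by
  simp [gatherColumn, setMin, lowest_above.mono (show 28 ≤ 32 by norm_num)]

/-- The second search runs after the first candidate has been stored. That store goes to a cell
above the tree, so both results can be stated for the original memory `σ`. -/
lemma gatherColumn_spec {h b o : ℕ} {T : Set ColoredPoint} (hS : Side σ s h b o T)
    (hle : σ.wreg b + 2 * ((h + 1) * 2 ^ h) ≤ σ.wreg 22) (hs : σ.wreg 22 + 2 ≤ s) :
    WP N s (gatherColumn b o) (fun τ t => ∃ p q,
      Lowest σ.wmem σ.rmem (inBox T (σ.rreg 24) (min (σ.rreg 24 + σ.rreg 21) (σ.rreg (o + 2)))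
        (σ.rreg (o + 1)) (σ.rreg (o + 3))) 0 p ∧
      Lowest σ.wmem σ.rmem (inBox T (σ.rreg 24) (min (σ.rreg 24 + σ.rreg 21) (σ.rreg (o + 2)))
        (σ.rreg (o + 1)) (σ.rreg (o + 3))) (σ.wmem p) q ∧
      p + 1 < σ.wreg b + 2 * ((h + 1) * 2 ^ h) ∧ q + 1 < σ.wreg b + 2 * ((h + 1) * 2 ^ h) ∧
      τ.wmem = Function.update (Function.update σ.wmem (σ.wreg 22) p) (σ.wreg 22 + 1) q ∧
      τ.rmem = σ.rmem ∧ t ≤ 1270 * (h + 1) ^ 2) σ := by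
  have hb := hS.b_lt
  have ho := hS.o_lt
  have hb1 := hS.tree.one_lt_base
  have h1 : 1 ≤ (h + 1) ^ 2 := Nat.one_le_pow _ _ (by omega)
  have hhh : 2 ^ h ≤ (h + 1) * 2 ^ h := Nat.le_mul_of_pos_left _ (by omega)
  have hp : 1 ≤ 2 ^ h := Nat.one_le_two_pow
  refine WP.seq (WP.setReal (WP.seq (WP.setMin fun t₁ ht₁ => WP.seq (WP.setReal (WP.seq
    (WP.setReal (WP.seq (WP.setWord' 0 (by simp) (WP.seq (WP.setWord' (σ.wreg b) ?_
      (WP.seq ?_)))))))))))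
  · simp [show b ≠ 31 by omega]
  have e₂ : o + 1 ≠ 28 := by omega
  have e₃ : o + 2 ≠ 28 := by omega
  have e₄ : o + 3 ≠ 28 := by omega
  have e₅ : o + 1 ≠ 29 := by omega
  have e₆ : o + 3 ≠ 29 := by omega
  have e₈ : o + 3 ≠ 30 := by omega
  simp only [RealExpr.cost] at ht₁
  simp only [RealExpr.eval, State.setR_rreg, e₂, e₃, e₄, e₅, e₆, e₈, if_false,
    show (24 : ℕ) ≠ 28 by norm_num, show (21 : ℕ) ≠ 28 by norm_num]
  set x₂ := min (σ.rreg 24 + σ.rreg 21) (σ.rreg (o + 2)) with hx₂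
  set σ₁ := (((((σ.setR 28 (σ.rreg 24)).setR 29 x₂).setR 30 (σ.rreg (o + 1))).setR 31
    (σ.rreg (o + 3))).setW 31 0).setW 30 (σ.wreg b) with hσ₁
  have hF₁ : Frame 28 σ σ₁ := ⟨fun i hi => by simp [hσ₁, show i ≠ 30 by omega,
    show i ≠ 31 by omega], fun i hi => by simp [hσ₁, show i ≠ 28 by omega, show i ≠ 29 by omega,
    show i ≠ 30 by omega, show i ≠ 31 by omega]⟩
  have hM₁ : SameMem σ σ₁ := ⟨rfl, rfl⟩
  have g28 : σ₁.rreg 28 = σ.rreg 24 := by simp [hσ₁]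
  have g29 : σ₁.rreg 29 = x₂ := by simp [hσ₁]
  have g30 : σ₁.rreg 30 = σ.rreg (o + 1) := by simp [hσ₁]
  have g31 : σ₁.rreg 31 = σ.rreg (o + 3) := by simp [hσ₁]
  have gw30 : σ₁.wreg 30 = σ.wreg b := by simp [hσ₁]
  have gw31 : σ₁.wreg 31 = 0 := by simp [hσ₁]
  clear_value σ₁
  have hS₁ := hS.congr (hF₁.mono (by norm_num)) hM₁
  have hb₁ : σ₁.wreg b = σ.wreg b := hF₁.w b (by omega)
  have hT₁ := hS₁.tree
  rw [hb₁] at hT₁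
  refine WP.call lowest_above lowest_noStore (lowest_spec hT₁ hS.le hS₁.leaves gw30) ?_
  rintro τ₁ t₂ hF₂ hM₂ ⟨hl, hbd, ht₂⟩
  rw [g28, g29, g30, g31, gw31, hM₁.w, hM₁.r] at hl
  set p := τ₁.wreg 32 with hp
  have hM₂' := hM₁.trans hM₂
  refine WP.seq (WP.storeWord (σ.wreg 22) p ?_ ?_ (by omega) (WP.seq
    (WP.setWord' (σ.wmem p) ?_ (WP.seq ?_))))
  · simp [hF₂.w 22, hF₁.w 22]
  · simp [hp]
  -- The store has not overwritten the word at address `p`, so the color read for the second search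
  -- is the original one.
  · simp [← hp, show p ≠ σ.wreg 22 by omega, hM₂'.w]
  set σ₂ := (τ₁.setM (σ.wreg 22) p).setW 31 (σ.wmem p) with hσ₂
  have hr₂ : σ₂.rmem = σ.rmem := hM₂'.r
  have hw₂ : σ₂.wmem = Function.update σ.wmem (σ.wreg 22) p := by
    simp [hσ₂, State.setM, hM₂'.w, State.setW]
  have k28 : σ₂.rreg 28 = σ.rreg 24 := by simp [hσ₂, hF₂.r 28, g28]
  have k29 : σ₂.rreg 29 = x₂ := by simp [hσ₂, hF₂.r 29, g29]
  have k30 : σ₂.rreg 30 = σ.rreg (o + 1) := by simp [hσ₂, hF₂.r 30, g30]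
  have k31 : σ₂.rreg 31 = σ.rreg (o + 3) := by simp [hσ₂, hF₂.r 31, g31]
  have kw30 : σ₂.wreg 30 = σ.wreg b := by simp [hσ₂, hF₂.w 30, gw30]
  have kw31 : σ₂.wreg 31 = σ.wmem p := by simp [hσ₂]
  have kw22 : σ₂.wreg 22 = σ.wreg 22 := by simp [hσ₂, hF₂.w 22, hF₁.w 22]
  clear_value σ₂
  have hagree : ∀ x < σ.wreg b + 2 * ((h + 1) * 2 ^ h), σ₂.wmem x = σ.wmem x := fun x hx => by
    rw [hw₂, Function.update_of_ne (by omega)]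
  have hT₂ : RangeTree σ₂.wmem σ₂.rmem (σ.wreg b) h T := by
    rw [hr₂]; exact hS.tree.congr (fun p _ hp => hagree p hp) fun _ _ _ => rfl
  refine WP.call lowest_above lowest_noStore (lowest_spec hT₂ hS.le
    (by rw [hagree 1 (by omega)]; exact hS.leaves) kw30) ?_
  rintro τ₂ t₃ hF₃ hM₃ ⟨hl', hbd', ht₃⟩
  rw [k28, k29, k30, k31, kw31, hr₂] at hl'
  refine WP.storeWord (σ.wreg 22 + 1) (τ₂.wreg 32) ?_ rfl (by omega)
    ⟨p, τ₂.wreg 32, hl, hl'.congr (hagree _ (by omega)), hbd, hbd', ?_, ?_, ?_⟩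
  · simp only [WordExpr.eval, hF₃.w 22 (by norm_num), kw22]
    rw [min_eq_left (a := 1) (by omega), min_eq_left (by omega)]
  · simp [State.setM, hM₃.w, hw₂]
  · simp [hM₃.r, hr₂]
  · simp; omega

/-- In `τ`, the `n` cells from `W` on hold candidates from `A`: pointers to points of `A` such
that for every point of `A` with an `x`-coordinate in `X`, and every color to be avoided that is
not its own, there is a candidate that is not higher and at most `w` further to the right. Nothing
else in the memory differs from `σ`. -/
structure Gathered (σ τ : State) (e W n : ℕ) (A : Set ColoredPoint) (w : ℝ) (X : Set ℝ) :
    Prop where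
  valid : ∀ t < n, τ.wmem (W + t) ≠ 0 → entry σ.wmem σ.rmem (τ.wmem (W + t)) ∈ A
  lt : ∀ t < n, τ.wmem (W + t) + 1 < e
  cover : ∀ q ∈ A, q.1 ∈ X → ∀ c, q.2.2 ≠ c → ∃ t < n, τ.wmem (W + t) ≠ 0 ∧
    σ.wmem (τ.wmem (W + t)) ≠ c ∧ σ.rmem (τ.wmem (W + t)) ≤ q.1 + w ∧
    σ.rmem (τ.wmem (W + t) + 1) ≤ q.2.1
  wmem : ∀ p, p < W ∨ W + n ≤ p → τ.wmem p = σ.wmem p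
  rmem : τ.rmem = σ.rmem

/-- Stores candidates from a side, two from each column, to the memory from `W` on. -/
def gather (b o : ℕ) (W : WordExpr) : Program :=
  .seq (.setWord 22 W) <|
  .seq (.setWord 23 (.load (.const 2))) <|
  .seq (.setReal 24 (.reg o)) <|
  .loop (.wordLe (.const 1) (.reg 23)) <|
    .seq (gatherColumn b o) <|
    .seq (.setWord 22 (.add (.reg 22) (.const 2))) <|
    .seq (.setWord 23 (.sub (.reg 23) (.const 1))) <|
    .setReal 24 (.add (.reg 24) (.reg 21))

lemma gather_above (b o : ℕ) (W : WordExpr) : (gather b o W).Above 22 := by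
  simp [gather, (gatherColumn_above b o).mono (show 22 ≤ 28 by norm_num)]

lemma Side.congr' {h b o : ℕ} {T : Set ColoredPoint} (hS : Side σ s h b o T) {τ : State}
    (hF : Frame 15 σ τ) (hw : ∀ p < σ.wreg b + 2 * ((h + 1) * 2 ^ h), τ.wmem p = σ.wmem p)
    (hr : τ.rmem = σ.rmem) : Side τ s h b o T := by
  have hb := hF.w b hS.b_lt
  have h1 := hS.tree.one_lt_base
  refine ⟨?_, by rw [hb]; exact hS.le, by rw [hw 1 (by omega)]; exact hS.leaves, hS.color, hS.b_lt,
    hS.o_lt⟩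
  rw [hr, hb]
  exact hS.tree.congr (fun p _ hp => hw p hp) fun _ _ _ => rfl

/-- The first `i` columns of width `w` from `x` on. -/
def columns (x w : ℝ) (i : ℕ) : Set ℝ := {y | ∃ j < i, x + j * w ≤ y ∧ y ≤ x + (j + 1) * w}

/-- A nonempty column has a first candidate, because the color `0` that it avoids belongs to no
point. If the first candidate has the color `c` to be avoided, the second one, which differs from it
in color, replaces it. Both are not higher than the given point, and both lie in the same column,
which bounds the shift to the right by `w`. -/
lemma Gathered.step {τ υ : State} {h b o W i p q : ℕ} {T : Set ColoredPoint}
    (hS : Side σ s h b o T) {w : ℝ} (hw : 0 ≤ w)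
    (hG : Gathered σ τ (σ.wreg b + 2 * ((h + 1) * 2 ^ h)) W (2 * i) (Side.box σ o T) w
      (columns (σ.rreg o) w i))
    (hp : Lowest σ.wmem σ.rmem (inBox T (σ.rreg o + i * w)
      (min (σ.rreg o + i * w + w) (σ.rreg (o + 2))) (σ.rreg (o + 1)) (σ.rreg (o + 3))) 0 p)
    (hq : Lowest σ.wmem σ.rmem (inBox T (σ.rreg o + i * w)
      (min (σ.rreg o + i * w + w) (σ.rreg (o + 2))) (σ.rreg (o + 1)) (σ.rreg (o + 3)))
        (σ.wmem p) q)
    (hpe : p + 1 < σ.wreg b + 2 * ((h + 1) * 2 ^ h))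
    (hqe : q + 1 < σ.wreg b + 2 * ((h + 1) * 2 ^ h))
    (hwm : υ.wmem = Function.update (Function.update τ.wmem (W + 2 * i) p) (W + 2 * i + 1) q)
    (hrm : υ.rmem = τ.rmem) :
    Gathered σ υ (σ.wreg b + 2 * ((h + 1) * 2 ^ h)) W (2 * (i + 1)) (Side.box σ o T) w
      (columns (σ.rreg o) w (i + 1)) := by
  have u₀ : ∀ t < 2 * i, υ.wmem (W + t) = τ.wmem (W + t) := fun t ht => by
    rw [hwm, Function.update_of_ne (by omega), Function.update_of_ne (by omega)]
  have u₁ : υ.wmem (W + 2 * i) = p := by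
    rw [hwm, Function.update_of_ne (by omega), Function.update_self]
  have u₂ : υ.wmem (W + (2 * i + 1)) = q := by
    rw [hwm, ← Nat.add_assoc, Function.update_self]
  have hsub : ∀ a, a ∈ inBox T (σ.rreg o + i * w)
      (min (σ.rreg o + i * w + w) (σ.rreg (o + 2))) (σ.rreg (o + 1)) (σ.rreg (o + 3)) →
      a ∈ Side.box σ o T ∧ a.1 ≤ σ.rreg o + i * w + w := by
    rintro a ⟨ha, ⟨h₁, h₂⟩, h₃⟩
    have : 0 ≤ (i : ℝ) * w := by positivity
    exact ⟨⟨ha, ⟨by linarith, h₂.trans (min_le_right _ _)⟩, h₃⟩, h₂.trans (min_le_left _ _)⟩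
  have hcase : ∀ t < 2 * (i + 1), t < 2 * i ∨ t = 2 * i ∨ t = 2 * i + 1 := fun t ht => by omega
  refine ⟨fun t ht => ?_, fun t ht => ?_, ?_, fun x hx => ?_, by rw [hrm, hG.rmem]⟩
  · rcases hcase t ht with h | rfl | rfl
    · rw [u₀ t h]; exact hG.valid t h
    · rw [u₁]
      intro h0
      rcases hp with ⟨h₁, -⟩ | ⟨-, h₁, -⟩
      · exact absurd h₁ h0
      · exact (hsub _ h₁).1
    · rw [u₂]
      intro h0
      rcases hq with ⟨h₁, -⟩ | ⟨-, h₁, -⟩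
      · exact absurd h₁ h0
      · exact (hsub _ h₁).1
  · rcases hcase t ht with h | rfl | rfl
    · rw [u₀ t h]; exact hG.lt t h
    · rw [u₁]; exact hpe
    · rw [u₂]; exact hqe
  · rintro a ha ⟨j, hj, h₁, h₂⟩ c hc
    rcases Nat.lt_succ_iff_lt_or_eq.1 hj with hj | rfl
    · obtain ⟨t, ht, h₃⟩ := hG.cover a ha ⟨j, hj, h₁, h₂⟩ c hc
      exact ⟨t, by omega, by rw [u₀ t ht]; exact h₃⟩
    · have haB : a ∈ inBox T (σ.rreg o + j * w)
          (min (σ.rreg o + j * w + w) (σ.rreg (o + 2))) (σ.rreg (o + 1)) (σ.rreg (o + 3)) := by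
        obtain ⟨k₁, ⟨k₂, k₃⟩, k₄⟩ := ha
        exact ⟨k₁, ⟨h₁, le_min (by linarith) k₃⟩, k₄⟩
      rcases hp with ⟨-, h₃⟩ | ⟨h₃, h₄, h₅, h₆⟩
      · exact absurd (h₃ a haB) (hS.color a ha.1)
      by_cases hpc : σ.wmem p = c
      · rcases hq with ⟨-, g₃⟩ | ⟨g₃, g₄, g₅, g₆⟩
        · exact absurd ((g₃ a haB).trans hpc) hc
        · refine ⟨2 * j + 1, by omega, ?_⟩
          rw [u₂]
          have := (hsub _ g₄).2
          simp only [entry] at this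
          exact ⟨g₃, by rwa [hpc] at g₅, by linarith, g₆ a haB (by rwa [hpc])⟩
      · refine ⟨2 * j, by omega, ?_⟩
        rw [u₁]
        have := (hsub _ h₄).2
        simp only [entry] at this
        exact ⟨h₃, hpc, by linarith, h₆ a haB (hS.color a ha.1)⟩
  · rw [hwm, Function.update_of_ne (by omega), Function.update_of_ne (by omega)]
    exact hG.wmem x (by omega)

lemma gather_spec {h b o K W : ℕ} {T : Set ColoredPoint} (hS : Side σ s h b o T)
    (hW : σ.wreg b + 2 * ((h + 1) * 2 ^ h) ≤ W) (hs : W + 2 * K ≤ s) (e : WordExpr)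
    (he : e.eval s σ = W) (hcost : e.cost ≤ 5) (hK : σ.wmem 2 = K) (hw : 0 ≤ σ.rreg 21) :
    WP N s (gather b o e) (fun τ t => Gathered σ τ (σ.wreg b + 2 * ((h + 1) * 2 ^ h)) W (2 * K)
      (Side.box σ o T) (σ.rreg 21) (columns (σ.rreg o) (σ.rreg 21) K) ∧
      t ≤ 1300 * (h + 1) ^ 2 * K + 20) σ := by
  have hb := hS.b_lt
  have ho := hS.o_lt
  have hb1 := hS.tree.one_lt_base
  have h1 : 1 ≤ (h + 1) ^ 2 := Nat.one_le_pow _ _ (by omega)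
  have hhh : 2 ^ h ≤ (h + 1) * 2 ^ h := Nat.le_mul_of_pos_left _ (by omega)
  have hp : 1 ≤ 2 ^ h := Nat.one_le_two_pow
  have e1 : min 1 s = 1 := min_eq_left (by omega)
  have e2 : min 2 s = 2 := min_eq_left (by omega)
  refine WP.seq (WP.setWord' W he (WP.seq (WP.setWord' K ?_ (WP.seq (WP.setReal'
    (σ.rreg o) ?_ ?_)))))
  · simp [e2, hK]
  · simp
  -- Here `k` columns are still to be processed, and `K - k` columns have two cells each.
  refine WP.loop (fun k τ => k ≤ K ∧ Frame 22 σ τ ∧ τ.wreg 22 = W + 2 * (K - k) ∧ τ.wreg 23 = k ∧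
    τ.rreg 24 = σ.rreg o + ((K - k : ℕ) : ℝ) * σ.rreg 21 ∧
    Gathered σ τ (σ.wreg b + 2 * ((h + 1) * 2 ^ h)) W (2 * (K - k))
      (Side.box σ o T) (σ.rreg 21) (columns (σ.rreg o) (σ.rreg 21) (K - k)))
    (1290 * (h + 1) ^ 2) K ?_ ?_ ?_
  · rintro k τ ⟨hk, hF, h22, h23, h24, hG⟩ hc
    simp only [Test.Holds, WordExpr.eval, e1, h23] at hc
    have hF15 := hF.mono (show 15 ≤ 22 by norm_num)
    have hag : ∀ x < W, τ.wmem x = σ.wmem x := fun x hx => hG.wmem x (Or.inl hx)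
    have hSτ := hS.congr' hF15 (fun p hp => hag p (by omega)) hG.rmem
    have hbτ := hF15.w b hb
    refine WP.seq (WP.frame (gatherColumn_above b o) ((gatherColumn_spec hSτ
      (by rw [hbτ, h22]; omega) (by rw [h22]; omega)).mono ?_))
    rintro υ t ⟨p, q, hp, hq, hpe, hqe, hwm, hrm, ht⟩ hF'
    rw [h24, hF.r 21 (by norm_num), hF15.r (o + 1) (by omega), hF15.r (o + 2) (by omega),
      hF15.r (o + 3) (by omega), hG.rmem] at hp hq
    rw [hbτ] at hpe hqe
    rw [hag p (by omega)] at hq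
    rw [h22] at hwm
    have hG' := hG.step hS hw (hp.congr (hag p (by omega))) (hq.congr (hag q (by omega)))
      hpe hqe hwm hrm
    have hFυ := hF.trans (hF'.mono (by norm_num))
    refine WP.seq (WP.setWord' (W + 2 * (K - (k - 1))) ?_ (WP.seq (WP.setWord' (k - 1) ?_
      (WP.setReal' (σ.rreg o + ((K - (k - 1) : ℕ) : ℝ) * σ.rreg 21) ?_
        ⟨?_, k - 1, by omega, by omega, ?_, ?_, ?_, ?_, ?_⟩))))
    · simp only [WordExpr.eval, hF'.w 22 (by norm_num), h22, e2]
      rw [min_eq_left (by omega)]; omega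
    · simp [hF'.w 23, h23, e1]
    · simp only [RealExpr.eval, State.setW_rreg, hF'.r 24 (by norm_num), h24,
        hFυ.r 21 (by norm_num)]
      rw [show K - (k - 1) = (K - k) + 1 by omega]
      push_cast; ring
    · simp; omega
    · exact hFυ.trans ⟨fun i hi => by simp [show i ≠ 22 by omega, show i ≠ 23 by omega],
        fun i hi => by simp [show i ≠ 24 by omega]⟩
    · simp
    · simp
    · simp
    · rw [show K - (k - 1) = (K - k) + 1 by omega]
      exact ⟨hG'.valid, hG'.lt, hG'.cover, hG'.wmem, hG'.rmem⟩
  · refine ⟨le_rfl, ⟨fun i hi => by simp [show i ≠ 22 by omega, show i ≠ 23 by omega],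
        fun i hi => by simp [show i ≠ 24 by omega]⟩, by simp, by simp, by simp, ?_⟩
    refine ⟨by simp, by simp, ?_, fun p hp => rfl, rfl⟩
    rintro q hq ⟨j, hj, -⟩
    omega
  · rintro τ t k ⟨hk, hF, h22, h23, h24, hG⟩ hc ht
    simp only [Test.Holds, WordExpr.eval, e1, h23] at hc
    obtain rfl : k = 0 := by omega
    refine ⟨hG, ?_⟩
    simp only [Test.cost, WordExpr.cost] at ht
    have : (1290 * (h + 1) ^ 2 + (1 + 1 + 1) + 1) * K ≤ 1300 * (h + 1) ^ 2 * K :=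
      Nat.mul_le_mul_right _ (by omega)
    simp only [WordExpr.cost, RealExpr.cost]
    omega

end

/-! ### Comparison of the candidates -/

section

variable {N : Seminorm ℝ Point} {s : ℕ} {σ : State}

/-- The best pair found so far, in `r15, …, r18`, and its length, in `r19`, satisfy `Q`, and no
length in `H` is smaller; `w19` is zero if no pair has been found yet. -/
def Best (Q : Set (Point × Point × ℝ)) (H : Set ℝ) (σ : State) : Prop :=
  (σ.wreg 19 = 0 ∧ H = ∅) ∨ (σ.wreg 19 ≠ 0 ∧
    ((σ.rreg 15, σ.rreg 16), (σ.rreg 17, σ.rreg 18), σ.rreg 19) ∈ Q ∧ ∀ ℓ ∈ H, σ.rreg 19 ≤ ℓ)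

lemma Best.congr {Q : Set (Point × Point × ℝ)} {H : Set ℝ} (hσ : Best Q H σ) {τ : State}
    (hF : Frame 20 σ τ) : Best Q H τ := by
  simp only [Best] at hσ ⊢
  rwa [hF.w 19 (by norm_num), hF.r 15 (by norm_num), hF.r 16 (by norm_num),
    hF.r 17 (by norm_num), hF.r 18 (by norm_num), hF.r 19 (by norm_num)]

/-- This passes from the lengths that have actually been compared to larger ones, namely the lengths
of all pairs multiplied by `1 + ε`. -/
lemma Best.weaken {Q : Set (Point × Point × ℝ)} {H H' : Set ℝ} (hσ : Best Q H σ)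
    (h : ∀ ℓ' ∈ H', ∃ ℓ ∈ H, ℓ ≤ ℓ') : Best Q H' σ := by
  rcases hσ with ⟨h₁, h₂⟩ | ⟨h₁, h₂, h₃⟩
  · refine Or.inl ⟨h₁, Set.eq_empty_of_forall_notMem fun ℓ hℓ => ?_⟩
    obtain ⟨ℓ', hℓ', -⟩ := h ℓ hℓ
    simp [h₂] at hℓ'
  · refine Or.inr ⟨h₁, h₂, fun ℓ hℓ => ?_⟩
    obtain ⟨ℓ', hℓ', hle⟩ := h ℓ hℓ
    exact (h₃ ℓ' hℓ').trans hle

lemma Best.anti {Q : Set (Point × Point × ℝ)} {H H' : Set ℝ} (hσ : Best Q H σ)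
    (h : H' ⊆ H) : Best Q H' σ :=
  hσ.weaken fun ℓ hℓ => ⟨ℓ, h hℓ, le_rfl⟩

/-- The pointers `p` and `q` point to records with different colors. -/
def PairOK (σ : State) (p q : ℕ) : Prop := p ≠ 0 ∧ q ≠ 0 ∧ σ.wmem p ≠ σ.wmem q

/-- The length of the pair that two pointers represent. -/
def pointerLength (N : Seminorm ℝ Point) (σ : State) (p q : ℕ) : ℝ :=
  N (σ.rmem p + σ.rmem q, σ.rmem (p + 1) + σ.rmem (q + 1))

/-- Takes the pair of the pointers in `w24` and `w25` into account. -/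
def tryPair : Program :=
  .ite (.and (.not (.wordLe (.reg 24) (.const 0))) (.and (.not (.wordLe (.reg 25) (.const 0)))
    (.not (.and (.wordLe (.load (.reg 24)) (.load (.reg 25)))
      (.wordLe (.load (.reg 25)) (.load (.reg 24)))))))
  (.seq (.setReal 22 (.normOf (.add (.load (.reg 24)) (.load (.reg 25)))
      (.add (.load (.add (.reg 24) (.const 1))) (.load (.add (.reg 25) (.const 1)))))) <|
    .ite (.and (.not (.wordLe (.reg 19) (.const 0))) (.realLe (.reg 19) (.reg 22))) .skip <|
    .seq (.setReal 15 (.load (.reg 24))) <|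
    .seq (.setReal 16 (.mul (.reg 6) (.load (.add (.reg 24) (.const 1))))) <|
    .seq (.setReal 17 (.sub (.const 0) (.load (.reg 25)))) <|
    .seq (.setReal 18 (.sub (.const 0) (.mul (.reg 6) (.load (.add (.reg 25) (.const 1)))))) <|
    .seq (.setReal 19 (.reg 22)) (.setWord 19 (.const 1))) .skip

lemma tryPair_above : tryPair.Above 15 := by simp [tryPair]

lemma tryPair_noStore : tryPair.NoStore := by simp [tryPair]

/-- The pair that two pointers represent can be reported. -/
def PairIn (N : Seminorm ℝ Point) (σ : State) (Q : Set (Point × Point × ℝ)) (p q : ℕ) : Prop :=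
  ((σ.rmem p, σ.rreg 6 * σ.rmem (p + 1)), (-σ.rmem q, -(σ.rreg 6 * σ.rmem (q + 1))),
    pointerLength N σ p q) ∈ Q

lemma tryPair_spec {Q : Set (Point × Point × ℝ)} {H : Set ℝ} (hσ : Best Q H σ)
    {p q : ℕ} (h24 : σ.wreg 24 = p) (h25 : σ.wreg 25 = q) (hp : p + 1 < s) (hq : q + 1 < s)
    (hQ : PairOK σ p q → PairIn N σ Q p q) :
    WP N s tryPair (fun τ t =>
      Best Q (H ∪ {ℓ | PairOK σ p q ∧ ℓ = pointerLength N σ p q}) τ ∧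
      (∀ i, i ≠ 19 → τ.wreg i = σ.wreg i) ∧ t ≤ 100) σ := by
  have e₁ : min (p + min 1 s) s = p + 1 := by
    rw [min_eq_left (a := 1) (by omega), min_eq_left (by omega)]
  have e₂ : min (q + min 1 s) s = q + 1 := by
    rw [min_eq_left (a := 1) (by omega), min_eq_left (by omega)]
  refine WP.ite (fun hc => WP.seq (WP.setReal' (pointerLength N σ p q) ?_
    (WP.ite (fun hc' => WP.skip ?_) (fun hc' => WP.seq (WP.setReal' (σ.rmem p) ?_ (WP.seq
      (WP.setReal' (σ.rreg 6 * σ.rmem (p + 1)) ?_ (WP.seq (WP.setReal' (-σ.rmem q) ?_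
        (WP.seq (WP.setReal' (-(σ.rreg 6 * σ.rmem (q + 1))) ?_ (WP.seq (WP.setReal'
          (pointerLength N σ p q) ?_ (WP.setWord' 1 ?_ ?_))))))))))))))
    (fun hc => WP.skip ?_)
  · simp [h24, h25, e₁, e₂, pointerLength]
  · have hok : PairOK σ p q := by
      simp only [Test.Holds, WordExpr.eval, h24, h25] at hc
      refine ⟨by omega, by omega, fun h => hc.2.2 ⟨h.le, h.ge⟩⟩
    simp only [Test.Holds, WordExpr.eval, RealExpr.eval, State.setR_wreg, State.setR_rreg,
      if_true, show (19 : ℕ) ≠ 22 by norm_num, if_false] at hc'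
    refine ⟨?_, fun i hi => by simp, by simp⟩
    rcases hσ with ⟨h₁, -⟩ | ⟨h₁, h₂, h₃⟩
    · omega
    · refine Or.inr ⟨by simpa using h₁, by simpa using h₂, ?_⟩
      rintro ℓ (hℓ | ⟨-, rfl⟩)
      · simpa using h₃ ℓ hℓ
      · simpa using hc'.2
  · simp [h24]
  · simp [h24, e₁]
  · simp [h25]
  · simp [h25, e₂]
  · simp
  · simp; omega
  · have hok : PairOK σ p q := by
      simp only [Test.Holds, WordExpr.eval, h24, h25] at hc
      refine ⟨by omega, by omega, fun h => hc.2.2 ⟨h.le, h.ge⟩⟩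
    simp only [Test.Holds, WordExpr.eval, RealExpr.eval, State.setR_wreg, State.setR_rreg,
      if_true, show (19 : ℕ) ≠ 22 by norm_num, if_false, not_and, not_le] at hc'
    refine ⟨Or.inr ⟨by simp, ?_, ?_⟩, fun i hi => by simp [hi], by simp⟩
    · simpa [PairIn] using hQ hok
    · simp only [State.setW_rreg, State.setR_rreg, if_true]
      rintro ℓ (hℓ | ⟨-, rfl⟩)
      · rcases hσ with ⟨-, h₂⟩ | ⟨h₁, h₂, h₃⟩
        · simp [h₂] at hℓ
        · have := hc' (by omega)
          exact this.le.trans (h₃ ℓ hℓ)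
      · exact le_rfl
  · have : {ℓ | PairOK σ p q ∧ ℓ = pointerLength N σ p q} = ∅ := by
      simp only [Test.Holds, WordExpr.eval, h24, h25] at hc
      ext ℓ
      simp only [PairOK, Set.mem_ofPred_eq, Set.mem_empty_iff_false, iff_false, not_and]
      rintro ⟨h₁, h₂, h₃⟩ -
      exact hc ⟨by omega, by omega, fun h => h₃ (le_antisymm h.1 h.2)⟩
    rw [this, Set.union_empty]
    exact ⟨hσ, fun i hi => rfl, by simp⟩

/-- The end of the memory that the candidates occupy. -/
def endExpr : WordExpr := .add (.load (.const 8)) (.mul (.const 2) (.load (.const 2)))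

/-- Compares all pairs of candidates. -/
def comparePairs : Program :=
  .seq (.setWord 22 (.load (.const 3))) <|
  .loop (.wlt (.reg 22) (.load (.const 8))) <|
    .seq (.setWord 24 (.load (.reg 22))) <|
    .seq (.setWord 23 (.load (.const 8))) <|
    .seq (.loop (.wlt (.reg 23) endExpr) <|
      .seq (.setWord 25 (.load (.reg 23))) <|
      .seq tryPair (.setWord 23 (.add (.reg 23) (.const 1))))
    (.setWord 22 (.add (.reg 22) (.const 1)))

lemma comparePairs_above : comparePairs.Above 15 := by simp [comparePairs, tryPair_above]

lemma comparePairs_noStore : comparePairs.NoStore := by simp [comparePairs, tryPair_noStore]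

/-- The header of the memory of a data structure: `K` candidate columns for each of the sides,
and cells for the candidates from `W` on. -/
structure Header (σ : State) (s h K W : ℕ) : Prop where
  leaves : σ.wmem 1 = 2 ^ h
  columns : σ.wmem 2 = K
  first : σ.wmem 3 = W
  second : σ.wmem 8 = W + 2 * K
  root : σ.wmem 9 = 2 * (h * 2 ^ h)
  ratio : σ.rmem 1 = 4 / K
  size : W + 2 * K + 2 * K = s
  le : 16 ≤ W

lemma Header.congr {h K W : ℕ} (hH : Header σ s h K W) {τ : State}
    (hw : ∀ p < W, τ.wmem p = σ.wmem p) (hr : τ.rmem = σ.rmem) : Header τ s h K W := by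
  have := hH.le
  refine ⟨?_, ?_, ?_, ?_, ?_, ?_, hH.size, hH.le⟩
  · rw [hw _ (by omega), hH.leaves]
  · rw [hw _ (by omega), hH.columns]
  · rw [hw _ (by omega), hH.first]
  · rw [hw _ (by omega), hH.second]
  · rw [hw _ (by omega), hH.root]
  · rw [hr, hH.ratio]

lemma Header.sameMem {h K W : ℕ} (hH : Header σ s h K W) {τ : State} (hM : SameMem σ τ) :
    Header τ s h K W := hH.congr (fun _ _ => by rw [hM.w]) hM.r

lemma Header.endExpr_eval {h K W : ℕ} (hH : Header σ s h K W) : endExpr.eval s σ = s := by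
  have h₁ := hH.le
  have h₂ := hH.size
  simp only [endExpr, WordExpr.eval]
  rw [min_eq_left (a := 8) (by omega), min_eq_left (a := 2) (by omega), hH.second, hH.columns,
    min_eq_left (a := 2 * K) (by omega)]
  omega

lemma Header.eval {h K W i : ℕ} (hH : Header σ s h K W) (hi : i < 16) :
    (WordExpr.load (.const i)).eval s σ = σ.wmem i := by
  have h₁ := hH.le
  have h₂ := hH.size
  simp only [WordExpr.eval]
  rw [min_eq_left (by omega)]

/-- The lengths of the pairs that the pointers in certain cells represent. -/
def lengths (N : Seminorm ℝ Point) (σ : State) (P : ℕ → ℕ → Prop) : Set ℝ :=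
  {ℓ | ∃ x y, P x y ∧ PairOK σ (σ.wmem x) (σ.wmem y) ∧
    ℓ = pointerLength N σ (σ.wmem x) (σ.wmem y)}

/-- Null pointers and pairs of equal colors are skipped by `PairOK`. All `2 * K` cells of one side
meet all `2 * K` cells of the other, which gives the quadratic term of the query time. -/
lemma comparePairs_spec {Q : Set (Point × Point × ℝ)} {H : Set ℝ} (hσ : Best Q H σ)
    {h K W : ℕ} (hH : Header σ s h K W)
    (hlt : ∀ x, W ≤ x → x < s → σ.wmem x + 1 < s)
    (hQ : ∀ x y, W ≤ x → x < W + 2 * K → W + 2 * K ≤ y → y < s →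
      PairOK σ (σ.wmem x) (σ.wmem y) → PairIn N σ Q (σ.wmem x) (σ.wmem y)) :
    WP N s comparePairs (fun τ t =>
      Best Q (H ∪ lengths N σ fun x y => (W ≤ x ∧ x < W + 2 * K) ∧ W + 2 * K ≤ y ∧ y < s) τ ∧
      t ≤ 1000 * (K + 1) ^ 2) σ := by
  have h₁ := hH.le
  have h₂ := hH.size
  have e₁ : min 1 s = 1 := min_eq_left (by omega)
  refine WP.seq (WP.setWord' W (by rw [hH.eval (by norm_num), hH.first]) ?_)
  -- The inner loop has `2 * K` iterations with a body of cost at most `107` and a test of cost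
  -- `10`; this gives `236 * K` plus a constant for each pass of the outer loop.
  refine WP.loopFrame (l := 15) (by simp [tryPair_above]) (by simp [tryPair_noStore])
    (fun k τ => ∃ x, W ≤ x ∧ x ≤ W + 2 * K ∧ x + k = W + 2 * K ∧ τ.wreg 22 = x ∧
      Best Q (H ∪ lengths N σ fun x' y => (W ≤ x' ∧ x' < x) ∧ W + 2 * K ≤ y ∧ y < s) τ)
    (240 * K + 50) (2 * K) ?_ ⟨W, le_rfl, by omega, by omega, by simp, ?_⟩ ?_
  · rintro k τ hF hM ⟨x, hx₁, hx₂, hk, h22, hB⟩ hc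
    have hM' : SameMem σ τ := ⟨hM.w, hM.r⟩
    have hF' : Frame 15 σ τ := (show Frame 15 σ (σ.setW 22 W) from
      ⟨fun i hi => by simp [show i ≠ 22 by omega], fun i hi => by simp⟩).trans hF
    have hHτ := hH.sameMem hM'
    rw [Test.wlt_holds, hHτ.eval (by norm_num), hHτ.second] at hc
    simp only [WordExpr.eval, h22] at hc
    refine WP.seq (WP.setWord' (σ.wmem x) (by simp [h22, hM'.w]) (WP.seq (WP.setWord'
      (W + 2 * K) ?_ (WP.seq ?_))))
    · have := hHτ.eval (i := 8) (by norm_num)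
      simp only [WordExpr.eval] at this ⊢
      simp only [State.setW_wmem, this, hHτ.second]
    set τ₁ := (τ.setW 24 (σ.wmem x)).setW 23 (W + 2 * K) with hτ₁
    have hF₁ : Frame 15 σ τ₁ := hF'.trans ⟨fun i hi => by
      simp [hτ₁, show i ≠ 23 by omega, show i ≠ 24 by omega], fun i hi => by simp [hτ₁]⟩
    have hM₁ : SameMem σ τ₁ := ⟨hM'.w, hM'.r⟩
    have hB₁ : Best Q (H ∪ lengths N σ fun x' y => (W ≤ x' ∧ x' < x) ∧ W + 2 * K ≤ y ∧ y < s) τ₁ :=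
      by simpa [Best, hτ₁] using hB
    have g22 : τ₁.wreg 22 = x := by simp [hτ₁, h22]
    have g23 : τ₁.wreg 23 = W + 2 * K := by simp [hτ₁]
    have g24 : τ₁.wreg 24 = σ.wmem x := by simp [hτ₁]
    clear_value τ₁
    refine WP.loopFrame (l := 15) (by simp [tryPair_above]) (by simp [tryPair_noStore])
      (fun k υ => ∃ y, W + 2 * K ≤ y ∧ y + k = s ∧ υ.wreg 22 = x ∧ υ.wreg 23 = y ∧
        υ.wreg 24 = σ.wmem x ∧
        Best Q ((H ∪ lengths N σ fun x' y' => (W ≤ x' ∧ x' < x) ∧ W + 2 * K ≤ y' ∧ y' < s) ∪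
          lengths N σ fun x' y' => x' = x ∧ W + 2 * K ≤ y' ∧ y' < y) υ)
      107 (2 * K) ?_ ⟨W + 2 * K, le_rfl, by omega, g22, g23, g24, ?_⟩ ?_
    · rintro k υ hFυ hMυ ⟨y, hy, hyk, g₂, g₃, g₄, hBυ⟩ hc'
      have hFσ := hF₁.trans hFυ
      have hMσ := hM₁.trans hMυ
      have hHυ := hH.sameMem hMσ
      rw [Test.wlt_holds, hHυ.endExpr_eval] at hc'
      simp only [WordExpr.eval, g₃] at hc'
      refine WP.seq (WP.setWord' (σ.wmem y) (by simp [g₃, hMσ.w]) (WP.seq ?_))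
      have hPL : ∀ p q, pointerLength N (υ.setW 25 (σ.wmem y)) p q = pointerLength N σ p q :=
        fun p q => by simp [pointerLength, hMσ.r]
      have hOK : ∀ p q, PairOK (υ.setW 25 (σ.wmem y)) p q ↔ PairOK σ p q :=
        fun p q => by simp [PairOK, hMσ.w]
      have hIn : ∀ p q, PairIn N (υ.setW 25 (σ.wmem y)) Q p q ↔ PairIn N σ Q p q :=
        fun p q => by simp [PairIn, hMσ.r, hFσ.r 6, hPL]
      refine WP.frame (k := 15) tryPair_above ((tryPair_spec (σ := υ.setW 25 (σ.wmem y))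
        (H := (H ∪ lengths N σ fun x' y' => (W ≤ x' ∧ x' < x) ∧ W + 2 * K ≤ y' ∧ y' < s) ∪
          lengths N σ fun x' y' => x' = x ∧ W + 2 * K ≤ y' ∧ y' < y)
        (by simpa [Best] using hBυ) (p := σ.wmem x) (q := σ.wmem y) (by simp [g₄]) (by simp)
        (hlt x (by omega) (by omega)) (hlt y (by omega) (by omega)) ?_).mono ?_)
      · rw [hOK, hIn]
        exact hQ x y hx₁ (by omega) hy hc'
      rintro ω t ⟨hBω, hω, ht⟩ -
      simp only [hOK, hPL] at hBω
      refine WP.setWord' (y + 1) ?_ ⟨?_, k - 1, by omega, y + 1, by omega, by omega, ?_, by simp,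
        ?_, ?_⟩
      · simp only [WordExpr.eval, hω 23 (by norm_num), State.setW_wreg, g₃, e₁,
          show (23 : ℕ) ≠ 25 by norm_num, if_false]
        exact min_eq_left (by omega)
      · simp; omega
      · simp [hω 22, g₂]
      · simp [hω 24, g₄]
      · refine (hBω.congr ⟨fun i hi => by simp [show i ≠ 23 by omega], fun i hi => by simp⟩).anti ?_
        rintro ℓ (hℓ | ⟨x', y', ⟨rfl, h₃, h₄⟩, h₅⟩)
        · exact Or.inl (Or.inl hℓ)
        · rcases Nat.lt_succ_iff_lt_or_eq.1 h₄ with h₄ | rfl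
          · exact Or.inl (Or.inr ⟨x', y', ⟨rfl, h₃, h₄⟩, h₅⟩)
          · exact Or.inr h₅
    · refine hB₁.anti ?_
      rintro ℓ (hℓ | ⟨x', y', ⟨rfl, h₃, h₄⟩, h₅⟩)
      · exact hℓ
      · omega
    · rintro υ t k' hFυ hMυ ⟨y, hy, hyk, g₂, g₃, g₄, hBυ⟩ hc' ht
      have hHυ := hH.sameMem (hM₁.trans hMυ)
      rw [Test.wlt_holds, hHυ.endExpr_eval] at hc'
      simp only [WordExpr.eval, g₃] at hc'
      refine WP.setWord' (x + 1) ?_ ⟨?_, k - 1, by omega, x + 1, by omega, by omega, by omega,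
        by simp, ?_⟩
      · simp only [WordExpr.eval, g₂, e₁]
        exact min_eq_left (by omega)
      · simp [endExpr] at ht ⊢; omega
      · refine (hBυ.congr ⟨fun i hi => by simp [show i ≠ 22 by omega], fun i hi => by simp⟩).anti ?_
        rintro ℓ (hℓ | ⟨x', y', ⟨⟨h₂, h₃⟩, h₄⟩, h₅⟩)
        · exact Or.inl (Or.inl hℓ)
        · rcases Nat.lt_succ_iff_lt_or_eq.1 h₃ with h₃ | rfl
          · exact Or.inl (Or.inr ⟨x', y', ⟨⟨h₂, h₃⟩, h₄⟩, h₅⟩)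
          · exact Or.inr ⟨x', y', ⟨rfl, h₄.1, by omega⟩, h₅⟩
  · have : Best Q H (σ.setW 22 W) := by simpa [Best] using hσ
    refine this.anti ?_
    rintro ℓ (hℓ | ⟨x', y', ⟨⟨h₂, h₃⟩, h₄⟩, h₅⟩)
    · exact hℓ
    · omega
  · rintro τ t k hF hM ⟨x, hx₁, hx₂, hk, h22, hB⟩ hc ht
    have hHτ := hH.sameMem (τ := τ) ⟨hM.w, hM.r⟩
    rw [Test.wlt_holds, hHτ.eval (by norm_num), hHτ.second] at hc
    simp only [WordExpr.eval, h22] at hc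
    obtain rfl : x = W + 2 * K := by omega
    refine ⟨hB, ?_⟩
    simp at ht ⊢
    nlinarith

/-- Empties the cells of the candidates. -/
def clearCandidates : Program :=
  .seq (.setWord 22 (.load (.const 3))) <|
  .loop (.wlt (.reg 22) endExpr) <|
    .seq (.storeWord (.reg 22) (.const 0)) (.setWord 22 (.add (.reg 22) (.const 1)))

lemma clearCandidates_above : clearCandidates.Above 22 := by simp [clearCandidates]

/-- The memory has to be returned as it was. Since the working cells were zero before, no copy of
the old contents is required. -/
lemma clearCandidates_spec {h K W : ℕ} (hH : Header σ s h K W) :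
    WP N s clearCandidates (fun τ t => (∀ p, W ≤ p → p < s → τ.wmem p = 0) ∧
      (∀ p, p < W ∨ s ≤ p → τ.wmem p = σ.wmem p) ∧ τ.rmem = σ.rmem ∧ t ≤ 100 * (K + 1)) σ := by
  have h₁ := hH.le
  have h₂ := hH.size
  have e₁ : min 1 s = 1 := min_eq_left (by omega)
  refine WP.seq (WP.setWord' W (by rw [hH.eval (by norm_num), hH.first]) ?_)
  refine WP.loop (fun k τ => ∃ x, W ≤ x ∧ x + k = s ∧ τ.wreg 22 = x ∧
    (∀ p, W ≤ p → p < x → τ.wmem p = 0) ∧ (∀ p, p < W ∨ s ≤ p → τ.wmem p = σ.wmem p) ∧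
    τ.rmem = σ.rmem) 7 (4 * K) ?_ ⟨W, le_rfl, by omega, by simp, by omega, by simp, by simp⟩ ?_
  · rintro k τ ⟨x, hx, hk, h22, h₃, h₄, h₅⟩ hc
    have hHτ := hH.congr (τ := τ) (fun p hp => h₄ p (Or.inl hp)) h₅
    rw [Test.wlt_holds, hHτ.endExpr_eval] at hc
    simp only [WordExpr.eval, h22] at hc
    refine WP.seq (WP.storeWord x 0 (by simp [h22]) (by simp) hc (WP.setWord' (x + 1) ?_
      ⟨by simp, k - 1, by omega, x + 1, by omega, by omega, by simp, ?_, ?_, by simp [h₅]⟩))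
    · simp only [WordExpr.eval, State.setM_wreg, h22, e₁]
      exact min_eq_left (by omega)
    · intro p hp hpx
      rcases Nat.lt_succ_iff_lt_or_eq.1 hpx with h | rfl
      · simp [show p ≠ x by omega, h₃ p hp h]
      · simp
    · intro p hp
      simp [show p ≠ x by omega, h₄ p hp]
  · rintro τ t k ⟨x, hx, hk, h22, h₃, h₄, h₅⟩ hc ht
    have hHτ := hH.congr (τ := τ) (fun p hp => h₄ p (Or.inl hp)) h₅
    rw [Test.wlt_holds, hHτ.endExpr_eval] at hc
    simp only [WordExpr.eval, h22] at hc
    refine ⟨fun p hp hps => h₃ p hp (by omega), h₄, h₅, ?_⟩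
    simp [endExpr] at ht ⊢; omega

end

/-! ### The approximation guarantee and the search on two opposite sides -/

section

variable {N : Seminorm ℝ Point} {s : ℕ} {σ : State}

/-- The cells from `W` on hold `n` candidates from `A`. -/
structure Candidates (τ : State) (W n : ℕ) (A : Set ColoredPoint) (w : ℝ) (X : Set ℝ) : Prop where
  valid : ∀ x, W ≤ x → x < W + n → τ.wmem x ≠ 0 → entry τ.wmem τ.rmem (τ.wmem x) ∈ A
  cover : ∀ q ∈ A, q.1 ∈ X → ∀ c, q.2.2 ≠ c → ∃ x, (W ≤ x ∧ x < W + n) ∧ τ.wmem x ≠ 0 ∧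
    τ.wmem (τ.wmem x) ≠ c ∧ τ.rmem (τ.wmem x) ≤ q.1 + w ∧ τ.rmem (τ.wmem x + 1) ≤ q.2.1

lemma Gathered.candidates {τ υ : State} {e W n : ℕ} {A : Set ColoredPoint} {w : ℝ} {X : Set ℝ}
    (hG : Gathered σ τ e W n A w X) (hw : ∀ p < e, υ.wmem p = σ.wmem p)
    (hr : υ.rmem = σ.rmem) (hcell : ∀ t < n, υ.wmem (W + t) = τ.wmem (W + t)) :
    Candidates υ W n A w X := by
  refine ⟨fun x h₁ h₂ h₃ => ?_, fun q hq hX c hc => ?_⟩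
  · obtain ⟨t, rfl⟩ := Nat.exists_eq_add_of_le h₁
    have ht : t < n := by omega
    have := hG.lt t ht
    rw [hcell t ht] at h₃ ⊢
    have hv := hG.valid t ht h₃
    rw [entry] at hv ⊢
    rwa [hr, hw _ (by omega)]
  · obtain ⟨t, ht, h₁, h₂, h₃⟩ := hG.cover q hq hX c hc
    have := hG.lt t ht
    refine ⟨W + t, by omega, ?_⟩
    rw [hcell t ht, hr, hw _ (by omega)]
    exact ⟨h₁, h₂, h₃⟩

lemma mem_columns {x w y : ℝ} {K : ℕ} (hK : 1 ≤ K) (hx : x ≤ y) (hy : y ≤ x + K * w) :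
    y ∈ columns x w K := by
  induction K, hK using Nat.le_induction with
  | base => exact ⟨0, by norm_num, by simpa using hx, by simpa using hy⟩
  | succ K hK ih =>
    by_cases h : y ≤ x + K * w
    · obtain ⟨j, hj, h'⟩ := ih h
      exact ⟨j, by omega, h'⟩
    · exact ⟨K, by omega, (not_le.1 h).le, by push_cast at hy; exact hy⟩

lemma IsMonotoneNorm.fst_le (hN : IsMonotoneNorm N) {x y : ℝ} (hx : 0 ≤ x) :
    N (1, 0) * x ≤ N (x, y) := by
  have h₁ : N (x, 0) ≤ N (x, y) := hN.2 _ _ le_rfl (by simp)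
  have h₂ : N (x • ((1 : ℝ), (0 : ℝ))) = ‖x‖ * N (1, 0) := map_smul_eq_mul N x _
  simp only [Prod.smul_mk, smul_eq_mul, mul_zero, mul_one, Real.norm_of_nonneg hx] at h₂
  linarith

lemma IsMonotoneNorm.snd_le (hN : IsMonotoneNorm N) {x y : ℝ} (hy : 0 ≤ y) :
    N (0, 1) * y ≤ N (x, y) := by
  have h₁ : N (0, y) ≤ N (x, y) := hN.2 _ _ (by simp) le_rfl
  have h₂ : N (y • ((0 : ℝ), (1 : ℝ))) = ‖y‖ * N (0, 1) := map_smul_eq_mul N y _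
  simp only [Prod.smul_mk, smul_eq_mul, mul_zero, mul_one, Real.norm_of_nonneg hy] at h₂
  linarith

lemma norm_add_le {x y x' y' : ℝ} (hx : 0 ≤ x') (hy : 0 ≤ y') :
    N (x + x', y + y') ≤ N (x, y) + (N (1, 0) * x' + N (0, 1) * y') := by
  have h₁ : N (x' • ((1 : ℝ), (0 : ℝ))) = ‖x'‖ * N (1, 0) := map_smul_eq_mul N x' _
  have h₂ : N (y' • ((0 : ℝ), (1 : ℝ))) = ‖y'‖ * N (0, 1) := map_smul_eq_mul N y' _
  have h₃ := map_add_le_add N (x, y) (x' • ((1 : ℝ), (0 : ℝ)) + y' • ((0 : ℝ), (1 : ℝ)))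
  have h₄ := map_add_le_add N (x' • ((1 : ℝ), (0 : ℝ))) (y' • ((0 : ℝ), (1 : ℝ)))
  rw [Real.norm_of_nonneg hx] at h₁
  rw [Real.norm_of_nonneg hy] at h₂
  have e : (x, y) + (x' • ((1 : ℝ), (0 : ℝ)) + y' • ((0 : ℝ), (1 : ℝ))) = (x + x', y + y') := by
    simp
  rw [e] at h₃
  linarith

/-- The core of the approximation. A pair of length at most `4 * r` lies within the columns, and
replacing its points one after the other by candidates costs at most `ε * r`, while `r` is a lower
bound for all lengths. A longer pair need not be approximated itself: a pair that realizes the scale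
`r` is shorter, and its replacement serves for both. -/
lemma Candidates.approx (hN : IsMonotoneNorm N) {τ : State} {W W' K : ℕ} {A B : Set ColoredPoint}
    {w x y x' y' r ε : ℝ} (hx : x' = -x) (hy : y' = -y)
    (hA : Candidates τ W (2 * K) A w (columns x w K))
    (hB : Candidates τ W' (2 * K) B w (columns x' w K))
    (hAx : ∀ q ∈ A, x ≤ q.1 ∧ y ≤ q.2.1) (hBx : ∀ q ∈ B, x' ≤ q.1 ∧ y' ≤ q.2.1)
    (hK : 1 ≤ K) (hKε : 8 ≤ K * ε) (hw : w = r * (4 / K) / N (1, 0))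
    (hr : Bichromatic (near N A x y r) (near N B x' y' r))
    (hmin : ∀ ρ, Bichromatic (near N A x y ρ) (near N B x' y' ρ) → r ≤ ρ)
    {a b : ColoredPoint} (ha : a ∈ A) (hb : b ∈ B) (hab : a.2.2 ≠ b.2.2) :
    ∃ ℓ ∈ lengths N τ (fun p q => (W ≤ p ∧ p < W + 2 * K) ∧ (W' ≤ q ∧ q < W' + 2 * K)),
      ℓ ≤ (1 + ε) * N (a.1 + b.1, a.2.1 + b.2.1) := by
  subst hx hy
  have hα := hN.fst_pos
  have hβ := hN.snd_pos
  have hKpos : (0 : ℝ) < K := by exact_mod_cast hK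
  have hε : 0 < ε := by
    by_contra h
    have : (K : ℝ) * ε ≤ 0 := mul_nonpos_of_nonneg_of_nonpos hKpos.le (not_lt.1 h)
    linarith
  have hr0 : 0 ≤ r := by
    obtain ⟨a, ⟨ha, h₁, -⟩, -⟩ := hr
    exact (mul_nonneg hα.le (sub_nonneg.2 (hAx a ha).1)).trans h₁
  have hw0 : 0 ≤ w := by rw [hw]; positivity
  -- The `K` columns together reach exactly as far as a pair of length `4 * r` can.
  have hKw : N (1, 0) * (K * w) = 4 * r := by rw [hw]; field_simp
  -- Two shifts by one column width cost `8 * r / K`; this is where `8 ≤ K * ε` enters.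
  have hαw : N (1, 0) * (w + w) ≤ ε * r := by
    have : N (1, 0) * (w + w) = 8 * r / K := by rw [hw]; field_simp; ring
    rw [this, div_le_iff₀ hKpos]
    nlinarith
  -- The corners are negatives of each other, so the distance of one point from its corner is at
  -- most the corresponding coordinate of `a + b`. The pair therefore exists at the scale given by
  -- its own length.
  have hlow : ∀ a ∈ A, ∀ b ∈ B, a.2.2 ≠ b.2.2 → r ≤ N (a.1 + b.1, a.2.1 + b.2.1) := by
    intro a ha b hb hab
    obtain ⟨h₁, h₂⟩ := hAx a ha
    obtain ⟨h₃, h₄⟩ := hBx b hb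
    have hf := hN.fst_le (x := a.1 + b.1) (y := a.2.1 + b.2.1) (by linarith)
    have hs := hN.snd_le (x := a.1 + b.1) (y := a.2.1 + b.2.1) (by linarith)
    refine hmin _ ⟨a, ⟨ha, ?_, ?_⟩, b, ⟨hb, ?_, ?_⟩, hab⟩
    · exact (mul_le_mul_of_nonneg_left (by linarith) hα.le).trans hf
    · exact (mul_le_mul_of_nonneg_left (by linarith) hβ.le).trans hs
    · exact (mul_le_mul_of_nonneg_left (by linarith) hα.le).trans hf
    · exact (mul_le_mul_of_nonneg_left (by linarith) hβ.le).trans hs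
  have main : ∀ a ∈ A, ∀ b ∈ B, a.2.2 ≠ b.2.2 → N (a.1 + b.1, a.2.1 + b.2.1) ≤ 4 * r →
      ∃ ℓ ∈ lengths N τ (fun p q => (W ≤ p ∧ p < W + 2 * K) ∧ (W' ≤ q ∧ q < W' + 2 * K)),
        ℓ ≤ (1 + ε) * N (a.1 + b.1, a.2.1 + b.2.1) := by
    intro a ha b hb hab hle
    obtain ⟨h₁, h₂⟩ := hAx a ha
    obtain ⟨h₃, h₄⟩ := hBx b hb
    have hf := hN.fst_le (x := a.1 + b.1) (y := a.2.1 + b.2.1) (by linarith)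
    have hsum : a.1 + b.1 ≤ K * w := by
      refine le_of_mul_le_mul_left ?_ hα
      linarith
    -- First `a` is replaced by a candidate that avoids the color of `b`, then `b` by one that
    -- avoids the color of the new point, so the pair stays bichromatic.
    obtain ⟨p, hp, p₁, p₂, p₃, p₄⟩ := hA.cover a ha (mem_columns hK h₁ (by linarith)) _ hab
    obtain ⟨q, hq, q₁, q₂, q₃, q₄⟩ :=
      hB.cover b hb (mem_columns hK h₃ (by linarith)) _ (Ne.symm p₂)
    refine ⟨_, ⟨p, q, ⟨hp, hq⟩, ⟨p₁, q₁, Ne.symm q₂⟩, rfl⟩, ?_⟩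
    have vp := hAx _ (hA.valid p hp.1 hp.2 p₁)
    have vq := hBx _ (hB.valid q hq.1 hq.2 q₁)
    simp only [entry] at vp vq
    have hmono : pointerLength N τ (τ.wmem p) (τ.wmem q) ≤
        N (a.1 + b.1 + (w + w), a.2.1 + b.2.1 + 0) := by
      refine hN.2 _ _ ?_ ?_
      · rw [abs_of_nonneg (by linarith), abs_of_nonneg (by linarith)]; linarith
      · rw [abs_of_nonneg (by linarith), abs_of_nonneg (by linarith)]; linarith
    have hadd := norm_add_le (N := N) (x := a.1 + b.1) (y := a.2.1 + b.2.1) (x' := w + w) (y' := 0)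
      (by linarith) le_rfl
    have := mul_le_mul_of_nonneg_left (hlow a ha b hb hab) hε.le
    linarith
  by_cases hle : N (a.1 + b.1, a.2.1 + b.2.1) ≤ 4 * r
  · exact main a ha b hb hab hle
  · obtain ⟨a₀, ⟨ha₀, h₁, h₂⟩, b₀, ⟨hb₀, h₃, h₄⟩, hab₀⟩ := hr
    -- Each of the four distances is at most `r`, and the triangle inequality adds them up.
    have hle₀ : N (a₀.1 + b₀.1, a₀.2.1 + b₀.2.1) ≤ 4 * r := by
      obtain ⟨k₁, k₂⟩ := hAx a₀ ha₀
      obtain ⟨k₃, k₄⟩ := hBx b₀ hb₀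
      have := norm_add_le (N := N) (x := 0) (y := 0) (x' := a₀.1 + b₀.1) (y' := a₀.2.1 + b₀.2.1)
        (by linarith) (by linarith)
      rw [zero_add, zero_add, show ((0 : ℝ), (0 : ℝ)) = 0 from rfl, map_zero, zero_add] at this
      nlinarith
    obtain ⟨ℓ, hℓ, h₅⟩ := main a₀ ha₀ b₀ hb₀ hab₀ hle₀
    refine ⟨ℓ, hℓ, h₅.trans (mul_le_mul_of_nonneg_left ?_ (by linarith))⟩
    linarith

/-- What the registers and the memory hold when the search for pairs with one point on each of two
opposite sides begins. -/
structure Query (σ : State) (s h K W : ℕ) (T T' : Set ColoredPoint) : Prop where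
  sideA : Side σ s h 1 7 T
  sideB : Side σ s h 2 11 T'
  header : Header σ s h K W
  leA : σ.wreg 1 + 2 * ((h + 1) * 2 ^ h) ≤ W
  leB : σ.wreg 2 + 2 * ((h + 1) * 2 ^ h) ≤ W
  fst : σ.rreg 11 = -σ.rreg 7
  snd : σ.rreg 12 = -σ.rreg 8
  one_le : 1 ≤ K
  zero : ∀ p, W ≤ p → p < s → σ.wmem p = 0

/-- The search for pairs with one point on each of two opposite sides. -/
def searchPairs : Program :=
  .seq (.setReal 20 (.add (.mul normFst (.add (.reg 9) (.reg 13)))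
    (.mul normSnd (.add (.reg 10) (.reg 14))))) <|
  .seq (.setReal 25 (.reg 20)) <|
  .seq probe <|
  .ite bothFound
    (.seq findScale <|
      .seq (.setReal 21 (.div (.mul (.reg 20) (.load (.const 1))) normFst)) <|
      .seq (gather 1 7 (.load (.const 3))) <|
      .seq (gather 2 11 (.load (.const 8))) <|
      .seq comparePairs clearCandidates) .skip

lemma searchPairs_above : searchPairs.Above 15 := by
  simp [searchPairs, probe_above.mono (show 15 ≤ 25 by norm_num),
    findScale_above.mono (show 15 ≤ 20 by norm_num),
    (gather_above _ _ _).mono (show 15 ≤ 22 by norm_num), comparePairs_above,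
    clearCandidates_above.mono (show 15 ≤ 22 by norm_num)]

lemma inBox_corner {T : Set ColoredPoint} {x₁ x₂ y₁ y₂ : ℝ} :
    ∀ q ∈ inBox T x₁ x₂ y₁ y₂, x₁ ≤ q.1 ∧ y₁ ≤ q.2.1 := fun _ hq => ⟨hq.2.1.1, hq.2.2.1⟩

/-- At the scale of width plus height of the query, measured by the norms of the unit vectors,
`near` is no restriction. A single test at this scale decides whether there is any pair at all, and
it supplies the start value for `findScale`. -/
lemma atScale_extent {h K W : ℕ} {T T' : Set ColoredPoint} (hσ : Query σ s h K W T T')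
    (hb : Bichromatic (Side.box σ 7 T) (Side.box σ 11 T')) :
    AtScale N σ T T' (N (1, 0) * (σ.rreg 9 + σ.rreg 13) + N (0, 1) * (σ.rreg 10 + σ.rreg 14)) := by
  obtain ⟨a, ha, b, hb, hab⟩ := hb
  obtain ⟨-, ⟨h₁, h₂⟩, h₃, h₄⟩ := id ha
  obtain ⟨-, ⟨h₅, h₆⟩, h₇, h₈⟩ := id hb
  norm_num at h₁ h₂ h₃ h₄ h₅ h₆ h₇ h₈
  have e₁ := hσ.fst
  have e₂ := hσ.snd
  have hα : 0 ≤ N (1, 0) := apply_nonneg _ _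
  have hβ : 0 ≤ N (0, 1) := apply_nonneg _ _
  have p₁ : 0 ≤ N (1, 0) * (σ.rreg 9 + σ.rreg 13) := mul_nonneg hα (by linarith)
  have p₂ : 0 ≤ N (0, 1) * (σ.rreg 10 + σ.rreg 14) := mul_nonneg hβ (by linarith)
  refine ⟨a, ⟨ha, ?_, ?_⟩, b, ⟨hb, ?_, ?_⟩, hab⟩
  · have := mul_le_mul_of_nonneg_left (show a.1 - σ.rreg 7 ≤ σ.rreg 9 + σ.rreg 13 by linarith) hα
    linarith
  · have := mul_le_mul_of_nonneg_left (show a.2.1 - σ.rreg 8 ≤ σ.rreg 10 + σ.rreg 14 by linarith) hβ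
    linarith
  · have := mul_le_mul_of_nonneg_left (show b.1 - σ.rreg 11 ≤ σ.rreg 9 + σ.rreg 13 by linarith) hα
    linarith
  · have := mul_le_mul_of_nonneg_left
      (show b.2.1 - σ.rreg 12 ≤ σ.rreg 10 + σ.rreg 14 by linarith) hβ
    linarith

lemma AtScale.nonneg {T T' : Set ColoredPoint} {r : ℝ} (hr : AtScale N σ T T' r) : 0 ≤ r := by
  obtain ⟨a, ⟨ha, h₁, -⟩, -⟩ := hr
  exact (mul_nonneg (apply_nonneg _ _) (sub_nonneg.2 (inBox_corner a ha).1)).trans h₁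

lemma Query.congr {h K W : ℕ} {T T' : Set ColoredPoint} (hσ : Query σ s h K W T T') {τ : State}
    (hF : Frame 15 σ τ) (hM : SameMem σ τ) : Query τ s h K W T T' := by
  refine ⟨hσ.sideA.congr hF hM, hσ.sideB.congr hF hM, hσ.header.sameMem hM, ?_, ?_, ?_, ?_,
    hσ.one_le, ?_⟩
  · rw [hF.w 1 (by norm_num)]; exact hσ.leA
  · rw [hF.w 2 (by norm_num)]; exact hσ.leB
  · rw [hF.r 11 (by norm_num), hF.r 7 (by norm_num)]; exact hσ.fst
  · rw [hF.r 12 (by norm_num), hF.r 8 (by norm_num)]; exact hσ.snd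
  · rw [hM.w]; exact hσ.zero

/-- All pairs that the search on two opposite sides finds can be reported. -/
def AllIn (N : Seminorm ℝ Point) (σ : State) (T T' : Set ColoredPoint)
    (Q : Set (Point × Point × ℝ)) : Prop :=
  ∀ a ∈ Side.box σ 7 T, ∀ b ∈ Side.box σ 11 T', a.2.2 ≠ b.2.2 →
    ((a.1, σ.rreg 6 * a.2.1), (-b.1, -(σ.rreg 6 * b.2.1)), N (a.1 + b.1, a.2.1 + b.2.1)) ∈ Q

/-- The lengths of the pairs with one point on each of two opposite sides. -/
def sideLengths (N : Seminorm ℝ Point) (σ : State) (T T' : Set ColoredPoint) (ε : ℝ) : Set ℝ :=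
  {ℓ | ∃ a ∈ Side.box σ 7 T, ∃ b ∈ Side.box σ 11 T', a.2.2 ≠ b.2.2 ∧
    ℓ = (1 + ε) * N (a.1 + b.1, a.2.1 + b.2.1)}

/-- The part of `searchPairs` after the determination of the scale. -/
lemma candidates_spec (hN : IsMonotoneNorm N) {h K W : ℕ} {T T' : Set ColoredPoint}
    (hσ : Query σ s h K W T T') {ε : ℝ} (hε : 8 ≤ K * ε) {Q : Set (Point × Point × ℝ)} {H : Set ℝ}
    (hQ : AllIn N σ T T' Q) (hB : Best Q H σ) (hr : AtScale N σ T T' (σ.rreg 20))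
    (hmin : ∀ ρ, AtScale N σ T T' ρ → σ.rreg 20 ≤ ρ) :
    WP N s (.seq (.setReal 21 (.div (.mul (.reg 20) (.load (.const 1))) normFst)) <|
      .seq (gather 1 7 (.load (.const 3))) <|
      .seq (gather 2 11 (.load (.const 8))) <|
      .seq comparePairs clearCandidates) (fun τ t =>
      Best Q (H ∪ sideLengths N σ T T' ε) τ ∧ SameMem σ τ ∧
      t ≤ 2600 * (h + 1) ^ 2 * K + 2000 * (K + 1) ^ 2) σ := by
  have hH := hσ.header
  have hW := hH.le
  have hsz := hH.size
  have hA := hσ.sideA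
  have hBs := hσ.sideB
  have e₁ : min 1 s = 1 := min_eq_left (by omega)
  have hr0 := hr.nonneg
  set r := σ.rreg 20 with hrdef
  -- Words cannot be converted to reals, so the ratio `4 / K` is kept as a real number in the
  -- header.
  set w := r * (4 / K) / N (1, 0) with hw
  have hw0 : 0 ≤ w := by have := hN.fst_pos; positivity
  refine WP.seq (WP.setReal' w ?_ (WP.seq ?_))
  · simp [e₁, hH.ratio, hw, hrdef]
  set σ₁ := σ.setR 21 w with hσ₁
  have hF₁ : Frame 20 σ σ₁ := ⟨fun i hi => by simp [hσ₁], fun i hi => by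
    simp [hσ₁, show i ≠ 21 by omega]⟩
  have hM₁ : SameMem σ σ₁ := ⟨rfl, rfl⟩
  have g21 : σ₁.rreg 21 = w := by simp [hσ₁]
  clear_value σ₁
  have hA₁ := hA.congr (hF₁.mono (by norm_num)) hM₁
  have hH₁ := hH.sameMem hM₁
  refine WP.frame (gather_above _ _ _) ((gather_spec hA₁ (K := K) (W := W)
    (by rw [hF₁.w 1 (by norm_num)]; exact hσ.leA) (by omega) _
    (by rw [hH₁.eval (by norm_num), hH₁.first]) (by simp) hH₁.columns (by rw [g21]; exact hw0)).mono
    ?_)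
  rintro σ₂ t₁ ⟨hG₁, ht₁⟩ hF₂
  rw [hA.box_congr (hF₁.mono (by norm_num)), g21, hF₁.r 7 (by norm_num),
    hF₁.w 1 (by norm_num)] at hG₁
  have hFσ₂ := hF₁.trans (hF₂.mono (show 20 ≤ 22 by norm_num))
  have hag₂ : ∀ p, p < W ∨ W + 2 * K ≤ p → σ₂.wmem p = σ.wmem p := fun p hp => by
    rw [hG₁.wmem p hp, hM₁.w]
  have hrm₂ : σ₂.rmem = σ.rmem := hG₁.rmem.trans hM₁.r
  have g21' : σ₂.rreg 21 = w := by rw [hF₂.r 21 (by norm_num), g21]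
  have hleB := hσ.leB
  have hleA := hσ.leA
  have hB₂ := hBs.congr' (hFσ₂.mono (by norm_num)) (fun p hp => hag₂ p (Or.inl (by omega))) hrm₂
  have hH₂ := hH.congr (fun p hp => hag₂ p (Or.inl hp)) hrm₂
  refine WP.seq (WP.frame (gather_above _ _ _) ((gather_spec hB₂ (K := K) (W := W + 2 * K)
    (by rw [hFσ₂.w 2 (by norm_num)]; omega) (by omega) _
    (by rw [hH₂.eval (by norm_num), hH₂.second]) (by simp) hH₂.columns
    (by rw [g21']; exact hw0)).mono ?_))
  rintro σ₃ t₂ ⟨hG₂, ht₂⟩ hF₃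
  rw [hBs.box_congr (hFσ₂.mono (by norm_num)), g21', hFσ₂.r 11 (by norm_num),
    hFσ₂.w 2 (by norm_num)] at hG₂
  have hFσ₃ := hFσ₂.trans (hF₃.mono (show 20 ≤ 22 by norm_num))
  have hag₃ : ∀ p, p < W ∨ s ≤ p → σ₃.wmem p = σ.wmem p := fun p hp => by
    rw [hG₂.wmem p (by omega), hag₂ p (by omega)]
  have hrm₃ : σ₃.rmem = σ.rmem := hG₂.rmem.trans hrm₂
  have hH₃ := hH.congr (fun p hp => hag₃ p (Or.inl hp)) hrm₃
  have hC₁ : Candidates σ₃ W (2 * K) (Side.box σ 7 T) w (columns (σ.rreg 7) w K) := by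
    refine hG₁.candidates (fun p hp => ?_) ?_ fun t ht => ?_
    · rw [hM₁.w]; exact hag₃ p (Or.inl (by omega))
    · rw [hM₁.r]; exact hrm₃
    · exact hG₂.wmem _ (by omega)
  have hC₂ : Candidates σ₃ (W + 2 * K) (2 * K) (Side.box σ 11 T') w
      (columns (σ.rreg 11) w K) := by
    refine hG₂.candidates (fun p hp => ?_) hG₂.rmem fun t ht => rfl
    exact hG₂.wmem _ (by omega)
  have hIn : ∀ x y, W ≤ x → x < W + 2 * K → W + 2 * K ≤ y → y < s →
      PairOK σ₃ (σ₃.wmem x) (σ₃.wmem y) → PairIn N σ₃ Q (σ₃.wmem x) (σ₃.wmem y) ∧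
      ∃ ℓ, ℓ ∈ sideLengths N σ T T' ε := by
    rintro x y h₁ h₂ h₃ h₄ ⟨h₅, h₆, h₇⟩
    have v₁ := hC₁.valid x h₁ h₂ h₅
    have v₂ := hC₂.valid y h₃ (by omega) h₆
    refine ⟨?_, _, _, v₁, _, v₂, h₇, rfl⟩
    have := hQ _ v₁ _ v₂ h₇
    simpa [PairIn, pointerLength, entry, hFσ₃.r 6] using this
  have hlt : ∀ x, W ≤ x → x < s → σ₃.wmem x + 1 < s := by
    intro x h₁ h₂
    by_cases h₃ : x < W + 2 * K
    · obtain ⟨t, rfl⟩ := Nat.exists_eq_add_of_le h₁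
      have := hG₁.lt t (by omega)
      rw [hG₂.wmem _ (by omega)]
      omega
    · obtain ⟨t, rfl⟩ := Nat.exists_eq_add_of_le (not_lt.1 h₃)
      have := hG₂.lt t (by omega)
      omega
  refine WP.seq (WP.call comparePairs_above comparePairs_noStore (comparePairs_spec
    (hB.congr hFσ₃) hH₃ hlt fun x y h₁ h₂ h₃ h₄ h₅ => (hIn x y h₁ h₂ h₃ h₄ h₅).1) ?_)
  rintro σ₄ t₃ hF₄ hM₄ ⟨hB₄, ht₃⟩
  refine WP.frame clearCandidates_above ((clearCandidates_spec (hH₃.sameMem hM₄)).mono ?_)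
  rintro σ₅ t₄ ⟨hz, hag₅, hrm₅, ht₄⟩ hF₅
  refine ⟨(hB₄.congr (hF₅.mono (by norm_num))).weaken ?_, ⟨?_, ?_⟩, ?_⟩
  · rintro ℓ (hℓ | ⟨a, ha, b, hb, hab, rfl⟩)
    · exact ⟨ℓ, Or.inl hℓ, le_rfl⟩
    · obtain ⟨ℓ, ⟨x, y, ⟨h₁, h₂, h₃⟩, h₄⟩, hℓ'⟩ := hC₁.approx hN hσ.fst hσ.snd hC₂ inBox_corner
        inBox_corner hσ.one_le hε hw hr hmin ha hb hab
      exact ⟨ℓ, Or.inr ⟨x, y, ⟨h₁, h₂, by omega⟩, h₄⟩, hℓ'⟩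
  -- The cells of the candidates have been cleared, and they were zero in `σ`.
  · funext p
    by_cases hp : p < W ∨ s ≤ p
    · rw [hag₅ p hp, hM₄.w, hag₃ p hp]
    · rw [hz p (by omega) (by omega), hσ.zero p (by omega) (by omega)]
  · rw [hrm₅, hM₄.r, hrm₃]
  · simp
    nlinarith

/-- If the test at the largest possible scale fails, there are no pairs and nothing has to be
compared. Otherwise a scale exists, and minimality of the one found makes the candidates good
enough. -/
lemma searchPairs_spec (hN : IsMonotoneNorm N) {h K W : ℕ} {T T' : Set ColoredPoint}
    (hσ : Query σ s h K W T T') {ε : ℝ} (hε : 8 ≤ K * ε) {Q : Set (Point × Point × ℝ)} {H : Set ℝ}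
    (hQ : AllIn N σ T T' Q) (hB : Best Q H σ) :
    WP N s searchPairs (fun τ t => Best Q (H ∪ sideLengths N σ T T' ε) τ ∧ SameMem σ τ ∧
      t ≤ 15000 * (h + 1) ^ 3 + 2600 * (h + 1) ^ 2 * K + 2000 * (K + 1) ^ 2) σ := by
  have hbase := hσ.sideA.tree.one_lt_base
  set r := N (1, 0) * (σ.rreg 9 + σ.rreg 13) + N (0, 1) * (σ.rreg 10 + σ.rreg 14) with hr
  have h23 : (h + 1) ^ 2 ≤ (h + 1) ^ 3 := Nat.pow_le_pow_right (by omega) (by norm_num)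
  have h1 : 1 ≤ (h + 1) ^ 3 := Nat.one_le_pow _ _ (by omega)
  refine WP.seq (WP.setReal' r (by simp [hr]) (WP.seq (WP.setReal' r (by simp) (WP.seq ?_))))
  set σ₁ := (σ.setR 20 r).setR 25 r with hσ₁
  have hF₁ : Frame 20 σ σ₁ := ⟨fun i hi => by simp [hσ₁], fun i hi => by
    simp [hσ₁, show i ≠ 20 by omega, show i ≠ 25 by omega]⟩
  have hM₁ : SameMem σ σ₁ := ⟨rfl, rfl⟩
  have g20 : σ₁.rreg 20 = r := by simp [hσ₁]
  have g25 : σ₁.rreg 25 = r := by simp [hσ₁]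
  clear_value σ₁
  have hF15 := hF₁.mono (show 15 ≤ 20 by norm_num)
  have hσ₁ := hσ.congr hF15 hM₁
  refine WP.call probe_above probe_noStore (probe_spec hN hσ₁.sideA hσ₁.sideB) ?_
  rintro σ₂ t₁ hF₂ hM₂ ⟨hiff, ht₁⟩
  have hF := hF₁.trans (hF₂.mono (show 20 ≤ 25 by norm_num))
  have hM := hM₁.trans hM₂
  have hF15 := hF.mono (show 15 ≤ 20 by norm_num)
  have hσ₂ := hσ.congr hF15 hM
  rw [g25, AtScale.congr hσ.sideA hσ.sideB (hF₁.mono (by norm_num))] at hiff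
  have g20' : σ₂.rreg 20 = r := by rw [hF₂.r 20 (by norm_num), g20]
  refine WP.ite (fun hc => WP.seq ?_) (fun hc => WP.skip ⟨?_, hM, ?_⟩)
  · have hr₂ : AtScale N σ₂ T T' (σ₂.rreg 20) := by
      rw [g20', AtScale.congr hσ.sideA hσ.sideB hF15]
      exact hiff.1 hc
    have hsz := hσ.header.size
    have hle := hσ.header.le
    refine WP.call findScale_above findScale_noStore (findScale_spec hN hσ₂.sideA hσ₂.sideB hr₂
      hσ₂.header.root (by omega)) ?_
    rintro σ₃ t₂ hF₃ hM₃ ⟨hr₃, hmin, ht₂⟩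
    replace hF := hF.trans hF₃
    replace hM := hM.trans hM₃
    have hF15₃ := hF.mono (show 15 ≤ 20 by norm_num)
    have hAS : ∀ ρ, AtScale N σ₂ T T' ρ ↔ AtScale N σ₃ T T' ρ := fun ρ => by
      rw [AtScale.congr hσ.sideA hσ.sideB hF15, AtScale.congr hσ.sideA hσ.sideB hF15₃]
    have hQ₃ : AllIn N σ₃ T T' Q := by
      simp only [AllIn, hσ.sideA.box_congr hF15₃, hσ.sideB.box_congr hF15₃, hF.r 6 (by norm_num)]
      exact hQ
    refine (candidates_spec hN (hσ.congr hF15₃ hM) hε hQ₃ (hB.congr hF) ((hAS _).1 hr₃)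
      fun ρ hρ => hmin ρ ((hAS ρ).2 hρ)).mono ?_
    rintro τ t₃ ⟨hB', hM', ht₃⟩
    refine ⟨?_, hM.trans hM', ?_⟩
    · simpa only [sideLengths, hσ.sideA.box_congr hF15₃, hσ.sideB.box_congr hF15₃] using hB'
    · simp [bothFound]; omega
  · refine (hB.congr hF).anti ?_
    rintro ℓ (hℓ | ⟨a, ha, b, hb, hab, -⟩)
    · exact hℓ
    · exact absurd (hiff.2 (atScale_extent hσ ⟨a, ha, b, hb, hab⟩)) hc
  · simp [bothFound]; omega

end

/-! ### Construction of the data structure -/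

lemma exists_sorted_fst (E : ℕ → ColoredPoint) (m : ℕ) :
    ∃ e : ℕ → ColoredPoint, e '' {i | i < m} = E '' {i | i < m} ∧
      (∀ i j, i ≤ j → j < m → (e i).1 ≤ (e j).1) ∧ ∀ i, m ≤ i → e i = (0, 0, 0) := by
  let ρ := Tuple.sort fun i : Fin m => (E i).1
  refine ⟨fun i => if hi : i < m then E (ρ ⟨i, hi⟩) else (0, 0, 0), ?_, fun i j hij hj => ?_,
    fun i hi => dif_neg (by omega)⟩
  · ext q
    constructor
    · rintro ⟨i, hi, rfl⟩
      have hi' : i < m := hi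
      simp only [dif_pos hi']
      exact ⟨_, (ρ ⟨i, hi'⟩).2, rfl⟩
    · rintro ⟨i, hi, rfl⟩
      refine ⟨ρ.symm ⟨i, hi⟩, (ρ.symm ⟨i, hi⟩).2, ?_⟩
      simp
  · simp only [dif_pos hj, dif_pos (show i < m by omega)]
    exact Tuple.monotone_sort (fun i : Fin m => (E i).1) (show (⟨i, _⟩ : Fin m) ≤ ⟨j, _⟩ from hij)

/-- Sorting by the lexicographic key of block number and height sorts within the blocks. No index
leaves its block, since the block numbers are already in increasing order and a monotone
rearrangement of a tuple is unique. -/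
lemma exists_sorted_blocks (y : ℕ → ℝ) (m k : ℕ) :
    ∃ π : ℕ → ℕ, (∀ i < m, π i < m ∧ π i / 2 ^ k = i / 2 ^ k) ∧ (∀ i < m, ∃ j < m, π j = i) ∧
      (∀ i j, i ≤ j → j < m → i / 2 ^ k = j / 2 ^ k → y (π i) ≤ y (π j)) ∧ ∀ i, m ≤ i → π i = i := by
  let f : Fin m → ℕ ×ₗ ℝ := fun i => toLex ((i : ℕ) / 2 ^ k, y i)
  let ρ := Tuple.sort f
  have hmono : Monotone (f ∘ ρ) := Tuple.monotone_sort f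
  have hblock : ∀ i : Fin m, (ρ i : ℕ) / 2 ^ k = i / 2 ^ k := by
    let g : Fin m → ℕ := fun i => (i : ℕ) / 2 ^ k
    have h₁ : Monotone (g ∘ ρ) := fun i j hij => by
      have := hmono hij
      rcases Prod.Lex.le_iff.1 this with h | h
      · exact h.le
      · exact h.1.le
    have h₂ : Monotone (g ∘ (1 : Equiv.Perm (Fin m))) := fun i j hij => Nat.div_le_div_right hij
    intro i
    exact congrFun (Tuple.unique_monotone h₁ h₂) i
  refine ⟨fun i => if hi : i < m then ρ ⟨i, hi⟩ else i, fun i hi => ?_, fun i hi => ?_,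
    fun i j hij hj hd => ?_, fun i hi => dif_neg (by omega)⟩
  · simp only [dif_pos hi]
    exact ⟨(ρ ⟨i, hi⟩).2, hblock ⟨i, hi⟩⟩
  · refine ⟨ρ.symm ⟨i, hi⟩, (ρ.symm ⟨i, hi⟩).2, ?_⟩
    simp
  · have hi : i < m := by omega
    simp only [dif_pos hj, dif_pos hi]
    have := hmono (show (⟨i, hi⟩ : Fin m) ≤ ⟨j, hj⟩ from hij)
    rcases Prod.Lex.le_iff.1 this with h | h
    · have h' : (ρ ⟨i, hi⟩ : ℕ) / 2 ^ k < (ρ ⟨j, hj⟩ : ℕ) / 2 ^ k := h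
      rw [hblock, hblock] at h'
      exact absurd hd h'.ne
    · exact h.2

lemma exists_next (base h k i : ℕ) (hk : k ≤ h) (c : ℕ → ℕ) :
    ∃ q, q ≤ base + 2 * ((h + 1) * 2 ^ h) ∧
      ((q = 0 ∧ ∀ j, i ≤ j → j < 2 ^ h → j / 2 ^ k = i / 2 ^ k → c j = c i) ∨
        ∃ j, i < j ∧ j < 2 ^ h ∧ j / 2 ^ k = i / 2 ^ k ∧ q = addr base h k j ∧
          c j ≠ c i ∧ ∀ l, i ≤ l → l < j → c l = c i) := by
  classical
  by_cases hex : ∃ j, i < j ∧ j < 2 ^ h ∧ j / 2 ^ k = i / 2 ^ k ∧ c j ≠ c i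
  · obtain ⟨h₁, h₂, h₃, h₄⟩ := Nat.find_spec hex
    refine ⟨addr base h k (Nat.find hex), ?_, Or.inr ⟨Nat.find hex, h₁, h₂, h₃, rfl, h₄,
      fun l h₅ h₆ => ?_⟩⟩
    · have := addr_lt (base := base) hk h₂; omega
    · rcases h₅.eq_or_lt with rfl | h₅
      · rfl
      by_contra hne
      refine Nat.find_min hex h₆ ⟨h₅, by omega, ?_, hne⟩
      exact le_antisymm ((Nat.div_le_div_right h₆.le).trans h₃.le) (Nat.div_le_div_right h₅.le)
  · push Not at hex
    refine ⟨0, by omega, Or.inl ⟨rfl, fun j h₁ h₂ h₃ => ?_⟩⟩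
    rcases h₁.eq_or_lt with rfl | h₁
    · rfl
    · exact hex j h₁ h₂ h₃

/-- Every finite family of colored points has a range tree. -/
lemma exists_rangeTree (E : ℕ → ColoredPoint) (h base : ℕ) (hb : 1 < base)
    (hE : ∀ i < 2 ^ h, (E i).2.2 ≤ base + 2 * ((h + 1) * 2 ^ h)) :
    ∃ (wm : ℕ → ℕ) (rm : ℕ → ℝ), RangeTree wm rm base h (E '' {i | i < 2 ^ h}) ∧
      ∀ p, wm p ≤ base + 2 * ((h + 1) * 2 ^ h) := by
  obtain ⟨e, he, hsort, hout⟩ := exists_sorted_fst E (2 ^ h)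
  choose π hπ hsurj hπsort hπout using exists_sorted_blocks (fun i => (e i).2.1) (2 ^ h)
  have hnext : ∀ k i, ∃ q, q ≤ base + 2 * ((h + 1) * 2 ^ h) ∧ (k ≤ h → i < 2 ^ h →
      ((q = 0 ∧ ∀ j, i ≤ j → j < 2 ^ h → j / 2 ^ k = i / 2 ^ k →
        (e (π k j)).2.2 = (e (π k i)).2.2) ∨
        ∃ j, i < j ∧ j < 2 ^ h ∧ j / 2 ^ k = i / 2 ^ k ∧ q = addr base h k j ∧
          (e (π k j)).2.2 ≠ (e (π k i)).2.2 ∧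
          ∀ l, i ≤ l → l < j → (e (π k l)).2.2 = (e (π k i)).2.2)) := by
    intro k i
    by_cases hki : k ≤ h ∧ i < 2 ^ h
    · obtain ⟨q, h₁, h₂⟩ := exists_next base h k i hki.1 fun j => (e (π k j)).2.2
      exact ⟨q, h₁, fun _ _ => h₂⟩
    · exact ⟨0, by omega, fun h₁ h₂ => absurd ⟨h₁, h₂⟩ hki⟩
  choose next hle hnext using hnext
  have hcol : ∀ i, (e i).2.2 ≤ base + 2 * ((h + 1) * 2 ^ h) := by
    intro i
    by_cases hi : i < 2 ^ h
    · have : e i ∈ E '' {i | i < 2 ^ h} := he ▸ ⟨i, hi, rfl⟩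
      obtain ⟨j, hj, hje⟩ := this
      rw [← hje]; exact hE j hj
    · rw [hout i (by omega)]; exact Nat.zero_le _
  -- Inverse of `addr`: the level and the index are quotient and remainder modulo `2 ^ h`, and the
  -- parity of `p - base` tells the two cells of a record apart.
  let K : ℕ → ℕ := fun p => (p - base) / 2 / 2 ^ h
  let I : ℕ → ℕ := fun p => (p - base) / 2 % 2 ^ h
  let wm : ℕ → ℕ := fun p =>
    if (p - base) % 2 = 0 then (e (π (K p) (I p))).2.2 else next (K p) (I p)
  let rm : ℕ → ℝ := fun p =>
    if (p - base) % 2 = 0 then (e (π (K p) (I p))).1 else (e (π (K p) (I p))).2.1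
  have hpos : 0 < 2 ^ h := by positivity
  have hdec : ∀ k, ∀ i < 2 ^ h, (addr base h k i - base) % 2 = 0 ∧ K (addr base h k i) = k ∧
      I (addr base h k i) = i ∧ (addr base h k i + 1 - base) % 2 = 1 ∧
      K (addr base h k i + 1) = k ∧ I (addr base h k i + 1) = i := by
    intro k i hi
    have h₁ : addr base h k i - base = 2 * (k * 2 ^ h + i) := by rw [addr]; omega
    have h₂ : addr base h k i + 1 - base = 2 * (k * 2 ^ h + i) + 1 := by rw [addr]; omega
    have h₃ : (k * 2 ^ h + i) / 2 ^ h = k := by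
      rw [Nat.add_comm, Nat.add_mul_div_right _ _ hpos, Nat.div_eq_of_lt hi, Nat.zero_add]
    have h₄ : (k * 2 ^ h + i) % 2 ^ h = i := by
      rw [Nat.add_comm, Nat.add_mul_mod_self_right, Nat.mod_eq_of_lt hi]
    have h₅ : 2 * (k * 2 ^ h + i) / 2 = k * 2 ^ h + i := by omega
    have h₆ : (2 * (k * 2 ^ h + i) + 1) / 2 = k * 2 ^ h + i := by omega
    simp only [K, I, h₁, h₂, h₅, h₆, h₃, h₄]
    refine ⟨by omega, trivial, trivial, by omega, trivial, trivial⟩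
  have w₁ : ∀ k, ∀ i < 2 ^ h, wm (addr base h k i) = (e (π k i)).2.2 := by
    intro k i hi
    obtain ⟨h₁, h₂, h₃, -⟩ := hdec k i hi
    simp only [wm, h₁, h₂, h₃, if_true]
  have w₂ : ∀ k, ∀ i < 2 ^ h, wm (addr base h k i + 1) = next k i := by
    intro k i hi
    obtain ⟨-, -, -, h₁, h₂, h₃⟩ := hdec k i hi
    simp only [wm, h₁, h₂, h₃, one_ne_zero, if_false]
  have r₁ : ∀ k, ∀ i < 2 ^ h, rm (addr base h k i) = (e (π k i)).1 := by
    intro k i hi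
    obtain ⟨h₁, h₂, h₃, -⟩ := hdec k i hi
    simp only [rm, h₁, h₂, h₃, if_true]
  have r₂ : ∀ k, ∀ i < 2 ^ h, rm (addr base h k i + 1) = (e (π k i)).2.1 := by
    intro k i hi
    obtain ⟨-, -, -, h₁, h₂, h₃⟩ := hdec k i hi
    simp only [rm, h₁, h₂, h₃, one_ne_zero, if_false]
  have hent : ∀ k, ∀ i < 2 ^ h, entry wm rm (addr base h k i) = e (π k i) := by
    intro k i hi
    rw [entry, w₁ k i hi, r₁ k i hi, r₂ k i hi]
  -- Blocks of size one leave no freedom, so level `0` keeps the order by `x`.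
  have hπ0 : ∀ i < 2 ^ h, π 0 i = i := fun i hi => by simpa using (hπ 0 i hi).2
  have hbound : ∀ p, wm p ≤ base + 2 * ((h + 1) * 2 ^ h) := by
    intro p
    simp only [wm]
    split_ifs
    · exact hcol _
    · exact hle _ _
  clear_value wm rm
  refine ⟨wm, rm, ⟨hb, ?_, fun i j hij hj => ?_, fun k hk i j hij hj hd => ?_, fun k hk j => ?_,
    fun k hk i hi => ?_⟩, hbound⟩
  · rw [← he]
    refine Set.image_congr fun i hi => ?_
    rw [hent 0 i hi, hπ0 i hi]
  · rw [r₁ 0 i (by omega), r₁ 0 j hj, hπ0 i (by omega), hπ0 j hj]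
    exact hsort i j hij hj
  · rw [r₂ k i (by omega), r₂ k j hj]
    exact hπsort k i j hij hj hd
  · ext q
    constructor
    · rintro ⟨i, ⟨hi, hij⟩, rfl⟩
      refine ⟨π k i, ⟨(hπ k i hi).1, (hπ k i hi).2.trans hij⟩, ?_⟩
      simp only
      rw [hent k i hi, hent 0 _ (hπ k i hi).1, hπ0 _ (hπ k i hi).1]
    · rintro ⟨i, ⟨hi, hij⟩, rfl⟩
      obtain ⟨j', hj', rfl⟩ := hsurj k i hi
      refine ⟨j', ⟨hj', (hπ k j' hj').2.symm.trans hij⟩, ?_⟩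
      simp only
      rw [hent k j' hj', hent 0 _ hi, hπ0 _ hi]
  · rw [w₂ k i hi]
    rcases hnext k i hk hi with ⟨h₁, h₂⟩ | ⟨j, h₁, h₂, h₃, h₄, h₅, h₆⟩
    · left
      refine ⟨h₁, fun j h₃ h₄ h₅ => ?_⟩
      rw [w₁ k j h₄, w₁ k i hi, h₂ j h₃ h₄ h₅]
    · right
      refine ⟨j, h₁, h₂, h₃, h₄, ?_, fun l h₇ h₈ => ?_⟩
      · rw [w₁ k j h₂, w₁ k i hi]; exact h₅
      · rw [w₁ k l (by omega), w₁ k i hi, h₆ l h₇ h₈]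

/-! ### Reflected copies, colors as numbers, and the layout of the memory -/

/-- The points of `S`, with the coordinates multiplied by `u` and `v`, and with colors that are
numbers. -/
def reflected (S : Finset Point) (col : Point → ℕ) (u v : ℝ) : Set ColoredPoint :=
  (fun p : Point => (u * p.1, v * p.2, col p)) '' (S : Set Point)

lemma exists_enumeration (S : Finset Point) (hS : S.Nonempty) {m : ℕ} (hm : S.card ≤ m) :
    ∃ E : ℕ → Point, E '' {i | i < m} = S ∧ ∀ i, E i ∈ S := by
  have hpos : 0 < S.card := hS.card_pos
  -- The leaves of a tree are padded to a power of two by repeating the last point.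
  refine ⟨fun i => (S.equivFin.symm ⟨min i (S.card - 1), by omega⟩ : S), ?_, fun i =>
    Subtype.property _⟩
  ext p
  constructor
  · rintro ⟨i, -, rfl⟩
    exact Subtype.property _
  · intro hp
    have hlt := (S.equivFin ⟨p, hp⟩).2
    refine ⟨S.equivFin ⟨p, hp⟩, by simp only [Set.mem_ofPred_eq]; omega, ?_⟩
    have : (⟨min (S.equivFin ⟨p, hp⟩ : ℕ) (S.card - 1), by omega⟩ : Fin S.card) =
        S.equivFin ⟨p, hp⟩ := Fin.ext (by simp only; omega)
    simp only [this, Equiv.symm_apply_apply]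

lemma exists_rangeTree_reflected (S : Finset Point) (hS : S.Nonempty) {h : ℕ}
    (hm : S.card ≤ 2 ^ h) (col : Point → ℕ) (hcol : ∀ p ∈ S, col p ≤ S.card) (base : ℕ)
    (hb : 1 < base) (u v : ℝ) :
    ∃ (wm : ℕ → ℕ) (rm : ℕ → ℝ), RangeTree wm rm base h (reflected S col u v) ∧
      ∀ p, wm p ≤ base + 2 * ((h + 1) * 2 ^ h) := by
  obtain ⟨E, hE, hES⟩ := exists_enumeration S hS hm
  obtain ⟨wm, rm, hT, hle⟩ := exists_rangeTree (fun i => (u * (E i).1, v * (E i).2, col (E i)))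
    h base hb fun i hi => by
      have := hcol _ (hES i)
      have : 2 ^ h ≤ (h + 1) * 2 ^ h := Nat.le_mul_of_pos_left _ (by omega)
      simp only; omega
  refine ⟨wm, rm, ?_, hle⟩
  rwa [reflected, ← hE, Set.image_image]

/-- The colors in use are numbered from `1`, which leaves `0` as the color that forbids nothing. The
numbers are at most the number of points, so they fit into words. -/
lemma exists_color_numbers {κ : Type*} (S : Finset Point) (cl : Point → κ) :
    ∃ col : Point → ℕ, (∀ p ∈ S, col p ≤ S.card ∧ col p ≠ 0) ∧
      ∀ p ∈ S, ∀ q ∈ S, col p = col q ↔ cl p = cl q := by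
  classical
  let c := S.image cl
  have hmem : ∀ p ∈ S, cl p ∈ c := fun p hp => Finset.mem_image_of_mem cl hp
  refine ⟨fun p => if hp : cl p ∈ c then (c.equivFin ⟨cl p, hp⟩ : ℕ) + 1 else 0, fun p hp => ?_,
    fun p hp q hq => ?_⟩
  · simp only [dif_pos (hmem p hp)]
    have h₁ := (c.equivFin ⟨cl p, hmem p hp⟩).2
    have h₂ : c.card ≤ S.card := Finset.card_image_le
    omega
  · simp only [dif_pos (hmem p hp), dif_pos (hmem q hq), add_left_inj, Fin.val_inj,
      EmbeddingLike.apply_eq_iff_eq, Subtype.mk.injEq]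

/-- The memory of the data structure: a header, range trees for the points and their reflections,
and empty cells for the candidates. -/
structure IsBuilt (D : Storage) (S : Finset Point) (col : Point → ℕ) (h K W : ℕ) : Prop where
  leaves : D.word 1 = 2 ^ h
  columns : D.word 2 = K
  first : D.word 3 = W
  second : D.word 8 = W + 2 * K
  root : D.word 9 = 2 * (h * 2 ^ h)
  ratio : D.real 1 = 4 / K
  size : W + 2 * K + 2 * K = D.size
  le : 16 ≤ W
  zero : ∀ p, W ≤ p → D.word p = 0
  tree : ∀ i, (i = 4 ∨ i = 5 ∨ i = 6 ∨ i = 7) → D.word i + 2 * ((h + 1) * 2 ^ h) ≤ W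
  tree₁ : RangeTree D.word D.real (D.word 4) h (reflected S col 1 1)
  tree₂ : RangeTree D.word D.real (D.word 5) h (reflected S col (-1) (-1))
  tree₃ : RangeTree D.word D.real (D.word 6) h (reflected S col 1 (-1))
  tree₄ : RangeTree D.word D.real (D.word 7) h (reflected S col (-1) 1)

lemma exists_storage (S : Finset Point) (hS : S.Nonempty) {h : ℕ}
    (hm : S.card ≤ 2 ^ h) (col : Point → ℕ) (hcol : ∀ p ∈ S, col p ≤ S.card) (K : ℕ) :
    ∃ D : Storage, D.size = 16 + 4 * (2 * ((h + 1) * 2 ^ h)) + 4 * K ∧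
      IsBuilt D S col h K (16 + 4 * (2 * ((h + 1) * 2 ^ h))) := by
  set L := 2 * ((h + 1) * 2 ^ h) with hL
  have hpos : 1 ≤ 2 ^ h := Nat.one_le_two_pow
  have hh : h * 2 ^ h + 2 ^ h = (h + 1) * 2 ^ h := (Nat.add_one_mul _ _).symm
  -- The four sign patterns, in the order `(1, 1)`, `(-1, -1)`, `(1, -1)`, `(-1, 1)`; trees `0` and
  -- `1` serve one diagonal, and trees `2` and `3` the other.
  let u : ℕ → ℝ := fun j => if j = 0 ∨ j = 2 then 1 else -1
  let v : ℕ → ℝ := fun j => if j = 0 ∨ j = 3 then 1 else -1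
  choose wm rm hT hle using fun j : ℕ => exists_rangeTree_reflected S hS hm col hcol (16 + j * L)
    (by omega) (u j) (v j)
  let hdr : ℕ → ℕ := fun p =>
    if p = 1 then 2 ^ h else if p = 2 then K else if p = 3 then 16 + 4 * L
    else if p = 4 then 16 else if p = 5 then 16 + L else if p = 6 then 16 + 2 * L
    else if p = 7 then 16 + 3 * L else if p = 8 then 16 + 4 * L + 2 * K
    else if p = 9 then 2 * (h * 2 ^ h) else 0
  let word : ℕ → ℕ := fun p =>
    if p < 16 then hdr p else if p < 16 + 4 * L then wm ((p - 16) / L) p else 0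
  let real : ℕ → ℝ := fun p =>
    if p < 16 then (if p = 1 then 4 / (K : ℝ) else 0)
    else if p < 16 + 4 * L then rm ((p - 16) / L) p else 0
  have hword : ∀ i, word i ≤ 16 + 4 * L + 4 * K := by
    intro i
    simp only [word]
    split_ifs with h₁ h₂
    · simp only [hdr]
      split_ifs <;> omega
    · have h₃ := hle ((i - 16) / L) i
      have h₄ : (i - 16) / L < 4 := by
        rw [Nat.div_lt_iff_lt_mul (by omega)]; omega
      have h₅ : ((i - 16) / L + 1) * L ≤ 4 * L := Nat.mul_le_mul_right _ h₄
      rw [Nat.add_one_mul] at h₅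
      omega
    · omega
  let D : Storage := ⟨16 + 4 * L + 4 * K, word, real, hword, fun i hi => by
    simp only [word, if_neg (show ¬ i < 16 by omega), if_neg (show ¬ i < 16 + 4 * L by omega)],
    fun i hi => by
    simp only [real, if_neg (show ¬ i < 16 by omega), if_neg (show ¬ i < 16 + 4 * L by omega)]⟩
  have htree : ∀ j < 4, RangeTree D.word D.real (16 + j * L) h (reflected S col (u j) (v j)) := by
    intro j hj
    have hj' : (j + 1) * L ≤ 4 * L := Nat.mul_le_mul_right _ hj
    rw [Nat.add_one_mul] at hj'
    have hdiv : ∀ p, 16 + j * L ≤ p → p < 16 + j * L + L → (p - 16) / L = j := by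
      intro p h₁ h₂
      rw [Nat.div_eq_iff (by omega)]
      omega
    refine (hT j).congr (fun p h₁ h₂ => ?_) fun p h₁ h₂ => ?_
    · simp only [D, word, if_neg (show ¬ p < 16 by omega), if_pos (show p < 16 + 4 * L by omega),
        hdiv p h₁ h₂]
    · simp only [D, real, if_neg (show ¬ p < 16 by omega), if_pos (show p < 16 + 4 * L by omega),
        hdiv p h₁ h₂]
  have d4 : D.word 4 = 16 + 0 * L := by simp [D, word, hdr]
  have d5 : D.word 5 = 16 + 1 * L := by simp [D, word, hdr]
  have d6 : D.word 6 = 16 + 2 * L := by simp [D, word, hdr]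
  have d7 : D.word 7 = 16 + 3 * L := by simp [D, word, hdr]
  refine ⟨D, rfl, ⟨by simp [D, word, hdr], by simp [D, word, hdr], by simp [D, word, hdr],
    by simp [D, word, hdr], by simp [D, word, hdr], by simp [D, real], by simp only [D]; omega,
    by omega, fun p hp => ?_, ?_, ?_, ?_, ?_, ?_⟩⟩
  · simp only [D, word, if_neg (show ¬ p < 16 by omega), if_neg (show ¬ p < 16 + 4 * L by omega)]
  · rintro i (rfl | rfl | rfl | rfl)
    · rw [d4]; omega
    · rw [d5]; omega
    · rw [d6]; omega
    · rw [d7]; omega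
  · rw [d4]; simpa [u, v] using htree 0 (by norm_num)
  · rw [d5]; simpa [u, v] using htree 1 (by norm_num)
  · rw [d6]; simpa [u, v] using htree 2 (by norm_num)
  · rw [d7]; simpa [u, v] using htree 3 (by norm_num)

/-! ### The query program -/

/-- The search for the pairs whose lower point is the left one, for `v = 1`, and for those whose
lower point is the right one, for `v = -1`. Cells `i` and `j` hold the addresses of the range
trees, and `y` and `y'` are the upper bounds for the (reflected) `y`-coordinates. -/
def searchDiagonal (i j : ℕ) (v : ℚ) (y y' : RealExpr) : Program :=
  .seq (.setWord 1 (.load (.const i))) <|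
  .seq (.setWord 2 (.load (.const j))) <|
  .seq (.setReal 6 (.const v)) <|
  .seq (.setReal 7 (.reg 4)) <|
  .seq (.setReal 8 (.mul (.reg 6) (.reg 5))) <|
  .seq (.setReal 9 (.reg 2)) <|
  .seq (.setReal 10 y) <|
  .seq (.setReal 11 (.sub (.const 0) (.reg 7))) <|
  .seq (.setReal 12 (.sub (.const 0) (.reg 8))) <|
  .seq (.setReal 13 (.sub (.const 0) (.reg 0))) <|
  .seq (.setReal 14 y') searchPairs

/-- The query program. -/
def queryProgram : Program :=
  .seq (searchDiagonal 4 5 1 (.reg 3) (.sub (.const 0) (.reg 1))) <|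
  .seq (searchDiagonal 6 7 (-1) (.sub (.const 0) (.reg 1)) (.reg 3)) <|
  .seq (.setReal 0 (.reg 15)) <|
  .seq (.setReal 1 (.reg 16)) <|
  .seq (.setReal 2 (.reg 17)) <|
  .seq (.setReal 3 (.reg 18)) <|
  .setWord 0 (.reg 19)

section

variable {N : Seminorm ℝ Point} {S : Finset Point} {col : Point → ℕ} {D : Storage} {h K W : ℕ}
  {a b o : Point}

/-- The points `p` and `q` of `S` have different colors, and they lie in opposite corners of the
rectangle `[a, b]` that `o` determines: `p` to the right and `q` to the left, and `p` above `q` for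
`v = 1` and below `q` for `v = -1`. -/
def Opposite (S : Finset Point) (col : Point → ℕ) (a b o : Point) (v : ℝ) (p q : Point) : Prop :=
  (p ∈ S ∧ q ∈ S ∧ col p ≠ col q) ∧ (o.1 ≤ p.1 ∧ p.1 ≤ b.1) ∧ (a.1 ≤ q.1 ∧ q.1 ≤ o.1) ∧
    ((v = 1 ∧ (o.2 ≤ p.2 ∧ p.2 ≤ b.2) ∧ a.2 ≤ q.2 ∧ q.2 ≤ o.2) ∨
      (v = -1 ∧ (a.2 ≤ p.2 ∧ p.2 ≤ o.2) ∧ o.2 ≤ q.2 ∧ q.2 ≤ b.2))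

lemma norm_reflect (hN : IsMonotoneNorm N) {v : ℝ} (hv : v = 1 ∨ v = -1) (x y : ℝ) :
    N (x, v * y) = N (x, y) := by
  have : |v * y| = |y| := by rcases hv with rfl | rfl <;> simp
  exact le_antisymm (hN.2 _ _ le_rfl this.le) (hN.2 _ _ le_rfl this.ge)

/-- The state that `searchDiagonal` prepares for the search. -/
lemma searchDiagonal_spec (hN : IsMonotoneNorm N) (hD : IsBuilt D S col h K W) (hK : 1 ≤ K)
    (hcol : ∀ p ∈ S, col p ≠ 0) {ε : ℝ} (hε : 8 ≤ K * ε) {i j : ℕ} {v : ℚ} {y y' : RealExpr}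
    (hv : (v = 1 ∧ i = 4 ∧ j = 5 ∧ y = .reg 3 ∧ y' = .sub (.const 0) (.reg 1)) ∨
      (v = -1 ∧ i = 6 ∧ j = 7 ∧ y = .sub (.const 0) (.reg 1) ∧ y' = .reg 3))
    {σ : State} (hw : σ.wmem = D.word) (hr : σ.rmem = D.real)
    (h0 : σ.rreg 0 = a.1) (h1 : σ.rreg 1 = a.2) (h2 : σ.rreg 2 = b.1) (h3 : σ.rreg 3 = b.2)
    (h4 : σ.rreg 4 = o.1) (h5 : σ.rreg 5 = o.2)
    {Q : Set (Point × Point × ℝ)} {H : Set ℝ}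
    (hQ : ∀ p q, Opposite S col a b o v p q → (p, q, N (p - q)) ∈ Q) (hB : Best Q H σ) :
    WP N D.size (searchDiagonal i j v y y') (fun τ t =>
      Best Q (H ∪ {ℓ | ∃ p q, Opposite S col a b o v p q ∧ ℓ = (1 + ε) * N (p - q)}) τ ∧
      τ.wmem = D.word ∧ τ.rmem = D.real ∧ (∀ i < 6, τ.rreg i = σ.rreg i) ∧
      t ≤ 15000 * (h + 1) ^ 3 + 2600 * (h + 1) ^ 2 * K + 2000 * (K + 1) ^ 2 + 60) σ := by
  have hle := hD.le
  have hsz := hD.size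
  have hi16 : min i D.size = i ∧ min j D.size = j := by
    rcases hv with ⟨-, rfl, rfl, -⟩ | ⟨-, rfl, rfl, -⟩ <;> constructor <;>
      exact min_eq_left (by omega)
  have hvR : (v : ℝ) = 1 ∨ (v : ℝ) = -1 := by
    rcases hv with ⟨rfl, -⟩ | ⟨rfl, -⟩ <;> simp
  have hvv : (v : ℝ) * v = 1 := by rcases hvR with h | h <;> rw [h] <;> norm_num
  have hcost : y.cost ≤ 3 ∧ y'.cost ≤ 3 := by
    rcases hv with ⟨-, -, -, rfl, rfl⟩ | ⟨-, -, -, rfl, rfl⟩ <;> simp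
  -- Far ends of the two opposite corners in reflected coordinates: a reflection of the `y`-axis
  -- turns a lower bound into an upper one.
  set Y : ℝ := if v = 1 then b.2 else -a.2 with hY
  set Y' : ℝ := if v = 1 then -a.2 else b.2 with hY'
  refine WP.seq (WP.setWord' (D.word i) (by simp [hi16.1, hw]) (WP.seq (WP.setWord' (D.word j)
    (by simp [hi16.2, hw]) (WP.seq (WP.setReal' v (by simp) (WP.seq (WP.setReal' o.1 (by simp [h4])
    (WP.seq (WP.setReal' (v * o.2) (by simp [h5]) (WP.seq (WP.setReal' b.1 (by simp [h2])
    (WP.seq (WP.setReal' Y ?_ (WP.seq (WP.setReal' (-o.1) (by simp) (WP.seq (WP.setReal'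
    (-(v * o.2)) (by simp) (WP.seq (WP.setReal' (-a.1) (by simp [h0]) (WP.seq (WP.setReal'
    Y' ?_ ?_)))))))))))))))))))))
  · rcases hv with ⟨rfl, -, -, rfl, -⟩ | ⟨rfl, -, -, rfl, -⟩
    · simp [hY, h3]
    · norm_num [hY, h1]
  · rcases hv with ⟨rfl, -, -, -, rfl⟩ | ⟨rfl, -, -, -, rfl⟩
    · simp [hY', h1]
    · norm_num [hY', h3]
  set σ₁ := ((((((((((σ.setW 1 (D.word i)).setW 2 (D.word j)).setR 6 v).setR 7 o.1).setR 8
    (v * o.2)).setR 9 b.1).setR 10 Y).setR 11 (-o.1)).setR 12 (-(v * o.2))).setR 13 (-a.1)).setR 14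
    Y' with hσ₁
  have hw₁ : σ₁.wmem = D.word := by simp [hσ₁, hw]
  have hr₁ : σ₁.rmem = D.real := by simp [hσ₁, hr]
  have hreg : ∀ i < 6, σ₁.rreg i = σ.rreg i := fun i hi => by
    simp [hσ₁, show i ≠ 6 by omega, show i ≠ 7 by omega, show i ≠ 8 by omega, show i ≠ 9 by omega,
      show i ≠ 10 by omega, show i ≠ 11 by omega, show i ≠ 12 by omega, show i ≠ 13 by omega,
      show i ≠ 14 by omega]
  have g1 : σ₁.wreg 1 = D.word i := by simp [hσ₁]
  have g2 : σ₁.wreg 2 = D.word j := by simp [hσ₁]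
  have g6 : σ₁.rreg 6 = v := by simp [hσ₁]
  have g7 : σ₁.rreg 7 = o.1 := by simp [hσ₁]
  have g8 : σ₁.rreg 8 = v * o.2 := by simp [hσ₁]
  have g9 : σ₁.rreg 9 = b.1 := by simp [hσ₁]
  have g10 : σ₁.rreg 10 = Y := by simp [hσ₁]
  have g11 : σ₁.rreg 11 = -o.1 := by simp [hσ₁]
  have g12 : σ₁.rreg 12 = -(v * o.2) := by simp [hσ₁]
  have g13 : σ₁.rreg 13 = -a.1 := by simp [hσ₁]
  have g14 : σ₁.rreg 14 = Y' := by simp [hσ₁]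
  have hB₁ : Best Q H σ₁ := by simpa [Best, hσ₁] using hB
  clear_value σ₁
  have htreeA : RangeTree D.word D.real (D.word i) h (reflected S col 1 v) := by
    rcases hv with ⟨rfl, rfl, -⟩ | ⟨rfl, rfl, -⟩
    · simpa using hD.tree₁
    · simpa using hD.tree₃
  have htreeB : RangeTree D.word D.real (D.word j) h (reflected S col (-1) (-v)) := by
    rcases hv with ⟨rfl, -, rfl, -⟩ | ⟨rfl, -, rfl, -⟩
    · simpa using hD.tree₂
    · simpa using hD.tree₄
  have hcolors : ∀ x y : ℝ, ∀ q ∈ reflected S col x y, q.2.2 ≠ 0 := by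
    rintro x y _ ⟨p, hp, rfl⟩
    exact hcol p hp
  have hlei : D.word i + 2 * ((h + 1) * 2 ^ h) ≤ W := hD.tree i (by
    rcases hv with ⟨-, rfl, -⟩ | ⟨-, rfl, -⟩ <;> simp)
  have hlej : D.word j + 2 * ((h + 1) * 2 ^ h) ≤ W := hD.tree j (by
    rcases hv with ⟨-, -, rfl, -⟩ | ⟨-, -, rfl, -⟩ <;> simp)
  have hquery : Query σ₁ D.size h K W (reflected S col 1 v) (reflected S col (-1) (-v)) := by
    refine ⟨⟨?_, ?_, ?_, hcolors _ _, by norm_num, by norm_num⟩,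
      ⟨?_, ?_, ?_, hcolors _ _, by norm_num, by norm_num⟩, ⟨?_, ?_, ?_, ?_, ?_, ?_, hsz, hle⟩,
      ?_, ?_, by rw [g11, g7], by rw [g12, g8], hK, ?_⟩
    · rw [hw₁, hr₁, g1]; exact htreeA
    · rw [g1]; omega
    · rw [hw₁, hD.leaves]
    · rw [hw₁, hr₁, g2]; exact htreeB
    · rw [g2]; omega
    · rw [hw₁, hD.leaves]
    · rw [hw₁, hD.leaves]
    · rw [hw₁, hD.columns]
    · rw [hw₁, hD.first]
    · rw [hw₁, hD.second]
    · rw [hw₁, hD.root]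
    · rw [hr₁, hD.ratio]
    · rw [g1]; exact hlei
    · rw [g2]; exact hlej
    · rw [hw₁]; exact fun p hp _ => hD.zero p hp
  have hboxA : ∀ p : Point, (1 * p.1, (v : ℝ) * p.2, col p) ∈
      Side.box σ₁ 7 (reflected S col 1 v) → p ∈ S → (o.1 ≤ p.1 ∧ p.1 ≤ b.1) ∧
      v * o.2 ≤ v * p.2 ∧ v * p.2 ≤ Y := by
    rintro p ⟨-, h₁⟩ -
    simpa [g7, g8, g9, g10] using h₁
  have hboxB : ∀ p : Point, (-1 * p.1, -(v : ℝ) * p.2, col p) ∈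
      Side.box σ₁ 11 (reflected S col (-1) (-v)) → p ∈ S → (a.1 ≤ p.1 ∧ p.1 ≤ o.1) ∧
      v * p.2 ≤ v * o.2 ∧ -(v * p.2) ≤ Y' := by
    rintro p ⟨-, ⟨h₁, h₂⟩, h₃, h₄⟩ -
    simp [g11, g12, g13, g14] at h₁ h₂ h₃ h₄
    exact ⟨⟨h₂, h₁⟩, h₃, h₄⟩
  -- The reflections turn the difference `p - q` into a sum, up to a sign that a monotone norm does
  -- not see.
  have hlen : ∀ p q : Point, N (1 * p.1 + -1 * q.1, (v : ℝ) * p.2 + -(v : ℝ) * q.2) = N (p - q) := by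
    intro p q
    have : (1 * p.1 + -1 * q.1, (v : ℝ) * p.2 + -(v : ℝ) * q.2) =
        ((p - q).1, (v : ℝ) * (p - q).2) := by
      simp only [Prod.fst_sub, Prod.snd_sub]; ext <;> simp only <;> ring
    rw [this, norm_reflect hN hvR]
  have hQ₁ : AllIn N σ₁ (reflected S col 1 v) (reflected S col (-1) (-v)) Q := by
    rintro x hx y hy hxy
    obtain ⟨p, hp, rfl⟩ := hx.1
    obtain ⟨q, hq, rfl⟩ := hy.1
    obtain ⟨p₁, p₂, p₃⟩ := hboxA p hx hp
    obtain ⟨q₁, q₂, q₃⟩ := hboxB q hy hq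
    have hopp : Opposite S col a b o v p q := by
      refine ⟨⟨hp, hq, hxy⟩, p₁, q₁, ?_⟩
      rcases hv with ⟨rfl, -⟩ | ⟨rfl, -⟩
      · left
        norm_num [hY, hY'] at p₂ p₃ q₂ q₃ ⊢
        exact ⟨⟨p₂, p₃⟩, q₃, q₂⟩
      · right
        norm_num [hY, hY'] at p₂ p₃ q₂ q₃ ⊢
        exact ⟨⟨p₃, p₂⟩, q₂, q₃⟩
    have := hQ p q hopp
    rw [← hlen] at this
    convert this using 2
    · ext
      · simp
      · simp only [g6, ← mul_assoc, hvv, one_mul]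
    · congr 1
      ext
      · simp
      · simp only [g6, neg_mul, mul_neg, neg_neg, ← mul_assoc, hvv, one_mul]
  refine WP.frame searchPairs_above ((searchPairs_spec hN hquery hε hQ₁ hB₁).mono ?_)
  rintro τ t ⟨hBτ, hM, ht⟩ hF
  refine ⟨hBτ.anti ?_, by rw [hM.w, hw₁], by rw [hM.r, hr₁], fun i hi => by
    rw [hF.r i (by omega), hreg i hi], ?_⟩
  · rintro ℓ (hℓ | ⟨p, q, ⟨⟨hp, hq, hpq⟩, h₁, h₂, h₃⟩, rfl⟩)
    · exact Or.inl hℓ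
    · refine Or.inr ⟨(1 * p.1, (v : ℝ) * p.2, col p), ⟨⟨p, hp, rfl⟩, ?_⟩,
        (-1 * q.1, -(v : ℝ) * q.2, col q), ⟨⟨q, hq, rfl⟩, ?_⟩, hpq, by rw [hlen]⟩
      · norm_num [g7, g8, g9, g10]
        refine ⟨h₁, ?_⟩
        rcases hv with ⟨rfl, -⟩ | ⟨rfl, -⟩
        · norm_num [hY] at h₃ ⊢; exact h₃.1
        · norm_num [hY] at h₃ ⊢; exact ⟨h₃.1.2, h₃.1.1⟩
      · norm_num [g11, g12, g13, g14]
        refine ⟨⟨h₂.2, h₂.1⟩, ?_⟩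
        rcases hv with ⟨rfl, -⟩ | ⟨rfl, -⟩
        · norm_num [hY'] at h₃ ⊢; exact ⟨h₃.2.2, h₃.2.1⟩
        · norm_num [hY'] at h₃ ⊢; exact h₃.2
  · simp; omega

end

/-! ### Anchored pairs as pairs in opposite corners, and correctness of the query -/

lemma mem_boundingBox_pair {p q o : Point} :
    o ∈ boundingBox (s(p, q) : Sym2 Point) ↔
      (min p.1 q.1 ≤ o.1 ∧ o.1 ≤ max p.1 q.1) ∧ min p.2 q.2 ≤ o.2 ∧ o.2 ≤ max p.2 q.2 := by
  constructor
  · intro ho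
    have h := ho (min p.1 q.1, min p.2 q.2) (max p.1 q.1, max p.2 q.2) (by
      intro x hx
      rcases Sym2.mem_iff.1 hx with rfl | rfl
      · exact ⟨⟨min_le_left _ _, min_le_left _ _⟩, le_max_left _ _, le_max_left _ _⟩
      · exact ⟨⟨min_le_right _ _, min_le_right _ _⟩, le_max_right _ _, le_max_right _ _⟩)
    exact ⟨⟨h.1.1, h.2.1⟩, h.1.2, h.2.2⟩
  · rintro ⟨⟨h₁, h₂⟩, h₃, h₄⟩ u v huv
    obtain ⟨⟨p₁, p₂⟩, p₃, p₄⟩ := huv (show p ∈ s(p, q) from Sym2.mem_mk_left p q)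
    obtain ⟨⟨q₁, q₂⟩, q₃, q₄⟩ := huv (show q ∈ s(p, q) from Sym2.mem_mk_right p q)
    exact ⟨⟨(le_min p₁ q₁).trans h₁, (le_min p₂ q₂).trans h₃⟩, h₂.trans (max_le p₃ q₃),
      h₄.trans (max_le p₄ q₄)⟩

section

variable {κ : Type*} {N : Seminorm ℝ Point} {S : Finset Point} {cl : Point → κ} {col : Point → ℕ}
  {a b o : Point}

lemma Opposite.mem_pairsIn (hcl : ∀ p ∈ S, ∀ q ∈ S, col p = col q ↔ cl p = cl q) {v : ℝ}
    {p q : Point} (h : Opposite S col a b o v p q) :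
    s(p, q) ∈ pairsIn (anchoredBich S cl o) (Set.Icc a b) := by
  obtain ⟨⟨hp, hq, hpq⟩, ⟨h₁, h₂⟩, ⟨h₃, h₄⟩, h₅⟩ := h
  refine ⟨⟨⟨p, hp, q, hq, fun h => hpq ((hcl p hp q hq).2 h), rfl⟩, mem_boundingBox_pair.2 ?_⟩, ?_⟩
  · refine ⟨⟨(min_le_right _ _).trans h₄, h₁.trans (le_max_left _ _)⟩, ?_⟩
    rcases h₅ with ⟨-, ⟨h₅, h₆⟩, h₇, h₈⟩ | ⟨-, ⟨h₅, h₆⟩, h₇, h₈⟩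
    · exact ⟨(min_le_right _ _).trans h₈, h₅.trans (le_max_left _ _)⟩
    · exact ⟨(min_le_left _ _).trans h₆, h₇.trans (le_max_right _ _)⟩
  · intro x hx
    rcases Sym2.mem_iff.1 hx with rfl | rfl
    · rcases h₅ with ⟨-, ⟨h₅, h₆⟩, h₇, h₈⟩ | ⟨-, ⟨h₅, h₆⟩, h₇, h₈⟩
      · exact ⟨⟨h₃.trans (h₄.trans h₁), h₇.trans (h₈.trans h₅)⟩, h₂, h₆⟩
      · exact ⟨⟨h₃.trans (h₄.trans h₁), h₅⟩, h₂, h₆.trans (h₇.trans h₈)⟩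
    · rcases h₅ with ⟨-, ⟨h₅, h₆⟩, h₇, h₈⟩ | ⟨-, ⟨h₅, h₆⟩, h₇, h₈⟩
      · exact ⟨⟨h₃, h₇⟩, h₄.trans (h₁.trans h₂), h₈.trans (h₅.trans h₆)⟩
      · exact ⟨⟨h₃, h₅.trans (h₆.trans h₇)⟩, h₄.trans (h₁.trans h₂), h₈⟩

/-- Ordering the two points by `x` decides which is on the right, and their order by `y` decides the
diagonal. Corners are closed, so points on the axes through `o` are covered too. -/
lemma exists_opposite (hcl : ∀ p ∈ S, ∀ q ∈ S, col p = col q ↔ cl p = cl q) {φ : Sym2 Point}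
    (hφ : φ ∈ pairsIn (anchoredBich S cl o) (Set.Icc a b)) :
    ∃ p q, (Opposite S col a b o 1 p q ∨ Opposite S col a b o (-1) p q) ∧ φ = s(p, q) := by
  obtain ⟨⟨⟨p, hp, q, hq, hpq, rfl⟩, ho⟩, hsub⟩ := hφ
  obtain ⟨⟨o₁, o₂⟩, o₃, o₄⟩ := mem_boundingBox_pair.1 ho
  obtain ⟨⟨p₁, p₂⟩, p₃, p₄⟩ := hsub (show p ∈ s(p, q) from Sym2.mem_mk_left p q)
  obtain ⟨⟨q₁, q₂⟩, q₃, q₄⟩ := hsub (show q ∈ s(p, q) from Sym2.mem_mk_right p q)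
  have hne : col p ≠ col q := fun h => hpq ((hcl p hp q hq).1 h)
  rcases le_total p.1 q.1 with h | h
  · rw [min_eq_left h, max_eq_right h] at *
    refine ⟨q, p, ?_, Sym2.eq_swap⟩
    rcases le_total p.2 q.2 with h' | h'
    · rw [min_eq_left h', max_eq_right h'] at *
      exact Or.inl ⟨⟨hq, hp, hne.symm⟩, ⟨o₂, q₃⟩, ⟨p₁, o₁⟩, Or.inl ⟨rfl, ⟨o₄, q₄⟩, p₂, o₃⟩⟩
    · rw [min_eq_right h', max_eq_left h'] at *
      exact Or.inr ⟨⟨hq, hp, hne.symm⟩, ⟨o₂, q₃⟩, ⟨p₁, o₁⟩, Or.inr ⟨rfl, ⟨q₂, o₃⟩, o₄, p₄⟩⟩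
  · rw [min_eq_right h, max_eq_left h] at *
    refine ⟨p, q, ?_, rfl⟩
    rcases le_total p.2 q.2 with h' | h'
    · rw [min_eq_left h', max_eq_right h'] at *
      exact Or.inr ⟨⟨hp, hq, hne⟩, ⟨o₂, p₃⟩, ⟨q₁, o₁⟩, Or.inr ⟨rfl, ⟨p₂, o₃⟩, o₄, q₄⟩⟩
    · rw [min_eq_right h', max_eq_left h'] at *
      exact Or.inl ⟨⟨hp, hq, hne⟩, ⟨o₂, p₃⟩, ⟨q₁, o₁⟩, Or.inl ⟨rfl, ⟨o₄, p₄⟩, q₂, o₃⟩⟩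

lemma pairsIn_finite (X : Set Point) : (pairsIn (anchoredBich S cl o) X).Finite := by
  refine ((S ×ˢ S).finite_toSet.image fun x : Point × Point => s(x.1, x.2)).subset ?_
  rintro φ ⟨⟨⟨p, hp, q, hq, -, rfl⟩, -⟩, -⟩
  exact ⟨(p, q), by simp [hp, hq], rfl⟩

/-- The second diagonal continues with the best pair of the first. Whatever is recorded is an
admissible pair, and it is not longer than `1 + ε` times any admissible pair; with nothing recorded,
the family of admissible pairs is empty. -/
lemma queryProgram_spec (hN : IsMonotoneNorm N) {D : Storage} {h K W : ℕ}
    (hD : IsBuilt D S col h K W) (hK : 1 ≤ K) (hcol : ∀ p ∈ S, col p ≠ 0)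
    (hcl : ∀ p ∈ S, ∀ q ∈ S, col p = col q ↔ cl p = cl q) {ε T : ℝ} (hε : 8 ≤ K * ε)
    (hT : 30000 * ((h : ℝ) + 1) ^ 3 + 5200 * ((h : ℝ) + 1) ^ 2 * K + 4000 * ((K : ℝ) + 1) ^ 2 + 200
      ≤ T) :
    IsApproxAnchoredCRCP N ε S cl queryProgram D T := by
  intro a b o _
  set P := pairsIn (anchoredBich S cl o) (Set.Icc a b) with hP
  set Q : Set (Point × Point × ℝ) := {x | s(x.1, x.2.1) ∈ P ∧ x.2.2 = N (x.1 - x.2.1)} with hQdef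
  have hQ : ∀ v : ℝ, ∀ p q, Opposite S col a b o v p q → (p, q, N (p - q)) ∈ Q :=
    fun v p q hpq => ⟨hpq.mem_pairsIn hcl, rfl⟩
  suffices hWP : WP N D.size queryProgram (fun τ t => t ≤ 30000 * (h + 1) ^ 3 +
      5200 * (h + 1) ^ 2 * K + 4000 * (K + 1) ^ 2 + 200 ∧ τ.wmem = D.word ∧ τ.rmem = D.real ∧
      IsCorrectReport N ε P (reported τ)) (queryState D a b o) by
    obtain ⟨τ, t, he, ht, h₁, h₂, h₃⟩ := hWP
    refine ⟨τ, t, he, le_trans ?_ hT, h₁, h₂, h₃⟩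
    exact_mod_cast ht
  refine WP.seq ((searchDiagonal_spec (a := a) (b := b) (o := o) (H := ∅) hN hD hK hcol hε
    (Or.inl ⟨rfl, rfl, rfl, rfl, rfl⟩) rfl rfl rfl rfl rfl rfl rfl rfl (hQ _)
    (Or.inl ⟨rfl, rfl⟩)).mono ?_)
  rintro τ₁ t₁ ⟨hB₁, hw₁, hr₁, hreg₁, ht₁⟩
  refine WP.seq ((searchDiagonal_spec (a := a) (b := b) (o := o) hN hD hK hcol hε
    (Or.inr ⟨rfl, rfl, rfl, rfl, rfl⟩) hw₁ hr₁ (hreg₁ 0 (by norm_num)) (hreg₁ 1 (by norm_num))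
    (hreg₁ 2 (by norm_num)) (hreg₁ 3 (by norm_num)) (hreg₁ 4 (by norm_num))
    (hreg₁ 5 (by norm_num)) (hQ _) hB₁).mono ?_)
  rintro τ₂ t₂ ⟨hB₂, hw₂, hr₂, -, ht₂⟩
  refine WP.seq (WP.setReal (WP.seq (WP.setReal (WP.seq (WP.setReal (WP.seq (WP.setReal
    (WP.setWord ⟨?_, hw₂, hr₂, ?_⟩))))))))
  · simp only [RealExpr.cost, WordExpr.cost]
    linarith
  have hlen : ∀ φ ∈ P, ∃ p q, φ = s(p, q) ∧ (1 + ε) * N (p - q) ∈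
      ((∅ ∪ {ℓ | ∃ p q, Opposite S col a b o ((1 : ℚ) : ℝ) p q ∧ ℓ = (1 + ε) * N (p - q)}) ∪
        {ℓ | ∃ p q, Opposite S col a b o ((-1 : ℚ) : ℝ) p q ∧ ℓ = (1 + ε) * N (p - q)}) := by
    intro φ hφ
    obtain ⟨p, q, hpq | hpq, rfl⟩ := exists_opposite hcl hφ
    · exact ⟨p, q, rfl, Or.inl (Or.inr ⟨p, q, by simpa using hpq, rfl⟩)⟩
    · exact ⟨p, q, rfl, Or.inr ⟨p, q, by simpa using hpq, rfl⟩⟩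
  rcases hB₂ with ⟨h₁, h₂⟩ | ⟨h₁, ⟨h₂, h₃⟩, h₄⟩
  · have hrep : reported (((((τ₂.setR 0 (τ₂.rreg 15)).setR 1 (τ₂.rreg 16)).setR 2
        (τ₂.rreg 17)).setR 3 (τ₂.rreg 18)).setW 0 (τ₂.wreg 19)) = none := by
      simp [reported, h₁]
    simp at hrep ⊢
    rw [hrep]
    refine Set.eq_empty_of_forall_notMem fun φ hφ => ?_
    obtain ⟨p, q, -, hmem⟩ := hlen φ hφ
    rw [h₂] at hmem
    exact hmem
  · have hrep : reported (((((τ₂.setR 0 (τ₂.rreg 15)).setR 1 (τ₂.rreg 16)).setR 2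
        (τ₂.rreg 17)).setR 3 (τ₂.rreg 18)).setW 0 (τ₂.wreg 19)) =
        some s((τ₂.rreg 15, τ₂.rreg 16), (τ₂.rreg 17, τ₂.rreg 18)) := by
      simp [reported, h₁]
    simp at hrep ⊢
    rw [hrep]
    refine ⟨h₂, ?_⟩
    -- Finiteness provides an exact closest pair, with which the report is compared.
    obtain ⟨ψ, hψ, hmin⟩ := (pairsIn_finite (S := S) (cl := cl) (o := o)
      (Set.Icc a b)).exists_minimalFor (pairLength N) _ ⟨_, h₂⟩
    refine ⟨ψ, ⟨hψ, fun χ hχ => ?_⟩, ?_⟩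
    · rcases le_total (pairLength N ψ) (pairLength N χ) with h | h
      · exact h
      · exact hmin hχ h
    · obtain ⟨p, q, rfl, hmem⟩ := hlen ψ hψ
      have := h₄ _ hmem
      simp only at h₃
      rw [h₃] at this
      exact this

end

/-! ### The constants in the bounds -/

/-- The height of the range trees. -/
lemma height_bounds {n : ℕ} (hn : 2 ≤ n) :
    ((Nat.clog 2 n : ℝ) + 1 ≤ 5 * Real.log n) ∧ (2 : ℝ) ^ Nat.clog 2 n ≤ 2 * n := by
  have hpos : 0 < Nat.clog 2 n := Nat.clog_pos (by norm_num) hn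
  obtain ⟨k, hk⟩ : ∃ k, Nat.clog 2 n = k + 1 := ⟨Nat.clog 2 n - 1, by omega⟩
  have hlt : 2 ^ k < n := by
    have := Nat.pow_pred_clog_lt_self (b := 2) (by norm_num) (x := n) (by omega)
    rwa [hk] at this
  have hlt' : (2 : ℝ) ^ k < n := by exact_mod_cast hlt
  have hlog : k * Real.log 2 ≤ Real.log n := by
    rw [← Real.log_pow]
    exact Real.log_le_log (by positivity) hlt'.le
  have h2 : Real.log 2 ≤ Real.log n := Real.log_le_log (by norm_num) (by exact_mod_cast hn)
  have h2' := Real.log_two_gt_d9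
  constructor
  -- Here `(k + 2) * log 2 ≤ 3 * log n`, and `3 / log 2 < 5`.
  · rw [hk]
    push_cast
    nlinarith [(Nat.cast_nonneg k : (0 : ℝ) ≤ k)]
  · rw [hk, pow_succ]
    linarith

end AnchoredCRCP

theorem mainTheorem4 :
    ∃ (c : AnchoredCRCP.Program) (C : ℝ),
      ∀ N : Seminorm ℝ AnchoredCRCP.Point, AnchoredCRCP.IsMonotoneNorm N →
      ∀ ε : ℝ, 0 < ε →
      ∀ (κ : Type*) (S : Finset AnchoredCRCP.Point) (cl : AnchoredCRCP.Point → κ), 2 ≤ S.card →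
        ∃ D : AnchoredCRCP.Storage,
          (D.size : ℝ) ≤ C * (max 1 ε⁻¹ * (S.card : ℝ) * Real.log (S.card : ℝ) ^ 3) ∧
          AnchoredCRCP.IsApproxAnchoredCRCP N ε S cl c D
            (C * (Real.log (S.card : ℝ) ^ 3 + max 1 ε⁻¹ * Real.log (S.card : ℝ) ^ 2
              + (max 1 ε⁻¹) ^ 2)) := by
  refine ⟨AnchoredCRCP.queryProgram, 10 ^ 7, fun N hN ε hε κ S cl hS => ?_⟩
  obtain ⟨col, hcol, hcl⟩ := AnchoredCRCP.exists_color_numbers S cl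
  set E : ℝ := max 1 ε⁻¹ with hE
  set h := Nat.clog 2 S.card with hh
  -- Two column widths out of a total of `4 * r` may cost at most `ε * r`, which requires `8 ≤ K *
  -- ε`; using `E` in place of `ε⁻¹` keeps `K` positive for large `ε`.
  set K := ⌈8 * E⌉₊ with hK
  have hE1 : 1 ≤ E := le_max_left _ _
  have hK8 : 8 * E ≤ K := Nat.le_ceil _
  have hK9 : (K : ℝ) ≤ 9 * E := by
    have := Nat.ceil_lt_add_one (show 0 ≤ 8 * E by linarith)
    linarith
  have hK1 : 1 ≤ K := by
    have : (1 : ℝ) ≤ K := by linarith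
    exact_mod_cast this
  have hKε : 8 ≤ K * ε := by
    have h₁ : ε⁻¹ ≤ E := le_max_right _ _
    have h₂ : ε⁻¹ * ε = 1 := inv_mul_cancel₀ hε.ne'
    have h₃ : ε⁻¹ * ε ≤ E * ε := mul_le_mul_of_nonneg_right h₁ hε.le
    have h₄ : 8 * E * ε ≤ K * ε := mul_le_mul_of_nonneg_right hK8 hε.le
    linarith
  obtain ⟨hH, hpow⟩ := AnchoredCRCP.height_bounds hS
  obtain ⟨D, hsize, hD⟩ := AnchoredCRCP.exists_storage S (Finset.card_pos.1 (by omega))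
    (h := h) (Nat.le_pow_clog (by norm_num) _) col (fun p hp => (hcol p hp).1) K
  have hn : (2 : ℝ) ≤ S.card := by exact_mod_cast hS
  set n : ℝ := (S.card : ℝ) with hndef
  set L := Real.log n with hL
  have hL2 : 1 / 2 ≤ L := by
    have h2 : Real.log 2 ≤ L := Real.log_le_log (by norm_num) hn
    have := Real.log_two_gt_d9
    linarith
  have hh0 : (0 : ℝ) ≤ h := Nat.cast_nonneg _
  refine ⟨D, ?_, AnchoredCRCP.queryProgram_spec hN hD hK1 (fun p hp => (hcol p hp).2) hcl hKε ?_⟩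
  · rw [hsize]
    push_cast
    have h₁ : ((h : ℝ) + 1) * 2 ^ h ≤ 5 * L * (2 * n) :=
      mul_le_mul hH hpow (by positivity) (by linarith)
    -- The layout only needs `O(n * log n + E)` cells; `1 / 2 ≤ L` lets this be absorbed into the
    -- cubic bound.
    have h₂ : L ≤ 4 * L ^ 3 := by
      have : 0 ≤ L * ((2 * L - 1) * (2 * L + 1)) :=
        mul_nonneg (by linarith) (mul_nonneg (by linarith) (by linarith))
      linarith
    have h₃ : 1 ≤ 8 * L ^ 3 := by linarith
    have hn0 : 0 ≤ n := by linarith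
    have h₄ : n * L ^ 3 ≤ E * n * L ^ 3 := by
      have : 0 ≤ n * L ^ 3 := by positivity
      nlinarith
    have h₅ : n * L ≤ n * (4 * L ^ 3) := mul_le_mul_of_nonneg_left h₂ hn0
    have h₆ : E * 1 ≤ E * (n * (8 * L ^ 3)) := by
      refine mul_le_mul_of_nonneg_left ?_ (by linarith)
      nlinarith
    nlinarith
  · have h₁ : ((h : ℝ) + 1) ^ 3 ≤ (5 * L) ^ 3 := pow_le_pow_left₀ (by linarith) hH 3
    have h₂ : ((h : ℝ) + 1) ^ 2 ≤ (5 * L) ^ 2 := pow_le_pow_left₀ (by linarith) hH 2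
    have h₃ : ((h : ℝ) + 1) ^ 2 * K ≤ (5 * L) ^ 2 * (9 * E) :=
      mul_le_mul h₂ hK9 (by positivity) (by positivity)
    have h₄ : ((K : ℝ) + 1) ^ 2 ≤ (10 * E) ^ 2 := pow_le_pow_left₀ (by positivity) (by linarith) 2
    have h₅ : 1 ≤ E ^ 2 := one_le_pow₀ hE1
    have h₆ : 0 ≤ L ^ 3 := by positivity
    have h₇ : 0 ≤ E * L ^ 2 := by positivity
    nlinarith
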